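/- Let $g=\mathrm{diag}(1,-1,-1,-1)$ and let $\gamma^0,\dots,\gamma^3\in\mathbb{C}^{4\times4}$ satisfy $\gamma^\mu\gamma^\nu+\gamma^\nu\gamma^\mu=2g^{\mu\nu}\mathbb{1}$, with $\gamma^0$ hermitian and $\gamma^1,\gamma^2,\gamma^3$ anti-hermitian. Let $N=2$ and $K=16$, identify $\mathbb{C}^K=\mathbb{C}^4\otimes\mathbb{C}^4$, and write $M_1=M\otimes\mathbb{1}$, $M_2=\mathbb{1}\otimes M$ for $M\in\mathbb{C}^{4\times4}$. Let $\Omega=\mathbb{R}^{8}$ or $\Omega=\mathscr{S}^{(2)}=\{(t_1,\mathbf{x}_1,t_2,\mathbf{x}_2)\in\mathbb{R}^8 : (t_1-t_2)^2<|\mathbf{x}_1-\mathbf{x}_2|^2\}$. Let $m_1,m_2\in\mathbb{R}$, let $V_1,V_2\in C^1(\Omega,\mathbb{C}^{K\times K})$, and consider for $\psi:\Omega\to\mathbb{C}^K$ the multi-time Dirac system $$ i\,\partial_{t_k}\psi=\Big(-i\sum_{a=1}^3\gamma^0_k\gamma^a_k\,\partial_{k,a}+\gamma^0_k m_k+V_k(x_1,x_2)\Big)\psi,\qquad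 k=1,2, $$ where $x_k=(t_k,\mathbf{x}_k)$ and $\partial_{k,a}=\partial/\partial x_k^a$. The potentials $V_1,V_2$ are called non-interacting if there are a $C^1$ map $U$ from $\Omega$ to the unitary $K\times K$ matrices and $K\times K$-matrix-valued functions $W_1(x_1),W_2(x_2)$, where $W_k$ depends on $x_k$ only, such that for each $k$, at each point of $\Omega$ where a function $\psi$ is differentiable and satisfies the $k$-th equation, $U\psi$ satisfies the $k$-th equation with $V_k$ replaced by $W_k$. Otherwise they are called interacting. A potential $V_k$ is called Poincaré invariant if for every proper orthochronous Lorentz transformation $\Lambda$ there is an invertible $S(\Lambda)\in\mathbb{C}^{4\times4}$ with $S(\Lambda)^{-1}\gamma^\mu S(\Lambda)=\sum_\nu\Lambda^\mu{}_\nu\gamma^\nu$ for all $\mu$ (such a matrix exists and is unique up to a scalar factor) for which $$V_k(x_1,x_2)=S(\Lambda)^{\otimes2}\,V_k\big(\Lambda^{-1}(x_1-a),\Lambda^{-1}(x_2-a)\big)\,\big(S(\Lambda)^{-1}\big)^{\otimes2}$$ for all $a\in\mathbb{R}^4$ and $(x_1,x_2)\in\Omega$. **Theorem.** Suppose that $V_1,V_2$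 are interacting and that for every initial value $\varphi\in C_c^\infty(\mathbb{R}^{6}\cap\Omega,\mathbb{C}^K)$, where $\mathbb{R}^6\cap\Omega$ is the set of configurations in $\Omega$ with $t_1=t_2=0$, the multi-time Dirac system has a solution $\psi\in C^2(\Omega,\mathbb{C}^K)$ with $\psi=\varphi$ on $\mathbb{R}^6\cap\Omega$. Then $V_1$ and $V_2$ are not both Poincaré invariant. -/

import Mathlib

open scoped Kronecker ContDiff

noncomputable section

/-- Space-time points `x = (t, 𝐱)`: the coordinate with index `0` is the time. -/
abbrev SpaceTime : Type := Fin 4 → ℝ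

/-- Configurations `(x₁, x₂)` of two space-time points; the space is `ℝ⁸`. -/
abbrev Config : Type := Fin 2 → SpaceTime

/-- The spin space `ℂ⁴ ⊗ ℂ⁴ ≅ ℂ¹⁶` in coordinates. -/
abbrev Spinor : Type := Fin 4 × Fin 4 → ℂ

/-- Complex matrices of size `4`. -/
abbrev Mat4 : Type := Matrix (Fin 4) (Fin 4) ℂ

/-- Complex matrices acting on the two-particle spin space. -/
abbrev SpinMatrix : Type := Matrix (Fin 4 × Fin 4) (Fin 4 × Fin 4) ℂ

/-- The Minkowski metric `diag (1, -1, -1, -1)`. -/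
def minkowski : Matrix (Fin 4) (Fin 4) ℝ := Matrix.diagonal ![1, -1, -1, -1]

/-- `γ⁰, …, γ³` represent the Clifford algebra, with `γ⁰` hermitian and `γ¹, γ², γ³`
anti-hermitian. -/
structure IsGammaRep (γ : Fin 4 → Mat4) : Prop where
  anticomm : ∀ μ ν, γ μ * γ ν + γ ν * γ μ = (2 * (minkowski μ ν : ℂ)) • (1 : Mat4)
  hermitian : (γ 0).conjTranspose = γ 0
  antihermitian : ∀ a : Fin 3, (γ a.succ).conjTranspose = - γ a.succ

/-- `M_k`: the matrix `M` acting on the spin of the `k`-th particle. -/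
def onParticle (k : Fin 2) (M : Mat4) : SpinMatrix :=
  if k = 0 then M ⊗ₖ (1 : Mat4) else (1 : Mat4) ⊗ₖ M

/-- The partial derivative `∂_{k,μ} ψ` at `X`. -/
def partialD (k : Fin 2) (μ : Fin 4) (ψ : Config → Spinor) (X : Config) : Spinor :=
  fderiv ℝ ψ X (Pi.single k (Pi.single μ 1))

/-- The free Dirac Hamiltonian of the `k`-th particle (of mass `m k`), applied to `ψ`, at `X`. -/
def freeDirac (γ : Fin 4 → Mat4) (m : Fin 2 → ℝ) (k : Fin 2) (ψ : Config → Spinor)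
    (X : Config) : Spinor :=
  (-Complex.I) • ∑ a : Fin 3,
      (onParticle k (γ 0) * onParticle k (γ a.succ)).mulVec (partialD k a.succ ψ X)
    + (m k : ℂ) • (onParticle k (γ 0)).mulVec (ψ X)

/-- `ψ` satisfies at `X` the `k`-th multi-time Dirac equation with potential `W`:
`i ∂_{t_k} ψ = H_k⁰ ψ + W ψ`. -/
def SatisfiesDiracAt (γ : Fin 4 → Mat4) (m : Fin 2 → ℝ) (k : Fin 2) (W : Config → SpinMatrix)
    (ψ : Config → Spinor) (X : Config) : Prop :=
  Complex.I • partialD k 0 ψ X = freeDirac γ m k ψ X + (W X).mulVec (ψ X)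

/-- `ψ` solves on `Ω` the multi-time Dirac system with potentials `V`. -/
def SolvesSystem (γ : Fin 4 → Mat4) (m : Fin 2 → ℝ) (Ω : Set Config)
    (V : Fin 2 → Config → SpinMatrix) (ψ : Config → Spinor) : Prop :=
  ∀ k, ∀ X ∈ Ω, SatisfiesDiracAt γ m k (V k) ψ X

/-- The set of space-like configurations of two particles. -/
def spaceLike : Set Config :=
  {X | ∀ j k : Fin 2, j ≠ k →
    (X j 0 - X k 0) ^ 2 < ∑ a : Fin 3, (X j a.succ - X k a.succ) ^ 2}

/-- The configuration with times `t₁ = t₂ = 0` and spatial positions `q`. -/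
def atTimeZero (q : Fin 2 → Fin 3 → ℝ) : Config := fun k => Fin.cons 0 (q k)

/-- Every initial value in `C_c^∞(ℝ⁶ ∩ Ω, ℂ¹⁶)`, prescribed at `t₁ = t₂ = 0`, has a solution in
`C²(Ω, ℂ¹⁶)`. -/
def SolvableForAllData (γ : Fin 4 → Mat4) (m : Fin 2 → ℝ) (Ω : Set Config)
    (V : Fin 2 → Config → SpinMatrix) : Prop :=
  ∀ φ : (Fin 2 → Fin 3 → ℝ) → Spinor, ContDiff ℝ ∞ φ → HasCompactSupport φ →
    tsupport φ ⊆ atTimeZero ⁻¹' Ω →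
    ∃ ψ : Config → Spinor, ContDiffOn ℝ 2 ψ Ω ∧ SolvesSystem γ m Ω V ψ ∧
      ∀ q, atTimeZero q ∈ Ω → ψ (atTimeZero q) = φ q

/-- The potentials `V` are non-interacting on `Ω`: there are unitary maps `U(x₁, x₂)` on the spin
space and potentials `W_k(x_k)`, the `k`-th one a function of `x_k` alone, such that `U ψ` satisfies
the Dirac equations with the potentials `W_k` wherever `ψ` satisfies those with the `V_k`. -/
def IsNonInteracting (γ : Fin 4 → Mat4) (m : Fin 2 → ℝ) (Ω : Set Config)
    (V : Fin 2 → Config → SpinMatrix) : Prop :=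
  ∃ (U : Config → SpinMatrix) (W : Fin 2 → SpaceTime → SpinMatrix),
    (∀ i j, ContDiffOn ℝ 1 (fun X => U X i j) Ω) ∧
    (∀ X ∈ Ω, U X ∈ Matrix.unitaryGroup (Fin 4 × Fin 4) ℂ) ∧
    ∀ k, ∀ X ∈ Ω, ∀ ψ : Config → Spinor, DifferentiableAt ℝ ψ X →
      SatisfiesDiracAt γ m k (V k) ψ X →
      SatisfiesDiracAt γ m k (fun Y => W k (Y k)) (fun Y => (U Y).mulVec (ψ Y)) X

/-- The potentials are interacting if they are not non-interacting. -/
def IsInteracting (γ : Fin 4 → Mat4) (m : Fin 2 → ℝ) (Ω : Set Config)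
    (V : Fin 2 → Config → SpinMatrix) : Prop :=
  ¬ IsNonInteracting γ m Ω V

/-- Proper (orthochronous) Lorentz transformations. -/
structure IsProperLorentz (Λ : Matrix (Fin 4) (Fin 4) ℝ) : Prop where
  isometry : Λ.transpose * minkowski * Λ = minkowski
  det_eq_one : Λ.det = 1
  orthochronous : 0 < Λ 0 0

/-- `γ(v) = γ^μ v_μ = g_{μμ} v^μ γ^μ` (summed over `μ`) for a vector `v`. -/
def slash (γ : Fin 4 → Mat4) (v : SpaceTime) : Mat4 :=
  ∑ μ, ((minkowski μ μ * v μ : ℝ) : ℂ) • γ μ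

/-- `S` is a spin transformation matrix of `Λ`, `S γ S⁻¹ = Λ γ`: that is, `S γ(v) S⁻¹ = γ(Λ v)`
for all vectors `v`, or equivalently `S⁻¹ γ^μ S = Λ^μ_ν γ^ν`. Such an `S` exists for each proper
Lorentz transformation and is unique up to a nonzero scalar factor. -/
def IsSpinTransformation (γ : Fin 4 → Mat4) (Λ : Matrix (Fin 4) (Fin 4) ℝ) (S : Mat4ˣ) : Prop :=
  ∀ v : SpaceTime, (S : Mat4) * slash γ v * ((S⁻¹ : Mat4ˣ) : Mat4) = slash γ (Λ.mulVec v)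

/-- The potential `W` is Poincaré invariant on `Ω`:
`W(x₁, x₂) = S(Λ)^{⊗2} W(Λ⁻¹(x₁ - a), Λ⁻¹(x₂ - a)) S⁻¹(Λ)^{⊗2}`. The scalar factor that `S(Λ)`
leaves free cancels here. -/
def IsPoincareInvariant (γ : Fin 4 → Mat4) (Ω : Set Config) (W : Config → SpinMatrix) : Prop :=
  ∀ Λ : Matrix (Fin 4) (Fin 4) ℝ, IsProperLorentz Λ →
    ∃ S : Mat4ˣ, IsSpinTransformation γ Λ S ∧
      ∀ a : SpaceTime, ∀ X ∈ Ω,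
        W X = ((S : Mat4) ⊗ₖ (S : Mat4)) * W (fun k => (Λ⁻¹).mulVec (X k - a)) *
          (((S⁻¹ : Mat4ˣ) : Mat4) ⊗ₖ ((S⁻¹ : Mat4ˣ) : Mat4))

end

/-! Solvability and Poincaré invariance together force both potentials to be constant. Constant
potentials are non-interacting with U = 1, so no genuine gauge transformation is ever needed.

Compatibility. For a C² solution the two time derivatives commute. This gives a linear relation
between the value of the solution and its spatial first derivatives. Where solutions exist with
these 7·16 numbers arbitrary, all coefficients vanish: V₁ commutes with the α-matrices of particle
2, V₂ with those of particle 1, and a first order condition links the derivatives of V₁, V₂ to the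
commutator of the terms "mass plus potential" (`commutator_evolution`, `eventually_compatible`).

Algebra. Translation invariance makes each V_k a function of x = x₁ - x₂, and Lorentz invariance
becomes an infinitesimal covariance. With ω = α₁α₂α₃ the commutation relations give V₂ = 1⊗A + ω⊗B
and V₁ = C⊗1 + D⊗ω, where A, B, C, D are covariant fields of 4×4 matrices. The stabilizer of x fixes
no nonzero bivector, so these fields have no component along αᵢ or ωαᵢ. In the bivector component of
the compatibility condition with respect to the first spin factor, only the spatial derivatives of A
and B survive; they must vanish, and likewise those of C and D. Boost covariance then removes the
time dependence (`fderiv_eq_zero_of_compatible`).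

Propagation. Initial data are prescribed only at t₁ = t₂ = 0, so the freedom of the jets at other
times has to be proved. If V₁ is constant on the light cone from x down to time zero, the first
equation has explicit exponential solutions there. An energy estimate shows that solutions of the
system with the same (cut off) data agree with them on the cone, so the jets at the apex are
arbitrary (`exists_solution_of_jet`). Linear independence is an open condition, so compatibility
holds near the apex and the potentials are constant there. At time zero the cone is a single point,
which starts the argument; a point of least |t| in the closure of the set of exceptions yields a
contradiction (`eq_const_of_solvable`). -/

noncomputable section

set_option linter.unusedSimpArgs false

/-! ### The algebra of the Dirac matrices. -/

/-- The Dirac matrices `β, α₁, α₂, α₃`: pairwise anticommuting with squares `1`. -/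
structure IsDiracFrame (b : Mat4) (a : Fin 3 → Mat4) : Prop where
  sq_beta : b * b = 1
  sq_alpha : ∀ i, a i * a i = 1
  anti_beta : ∀ i, a i * b = -(b * a i)
  anti_alpha : ∀ i j, i ≠ j → a i * a j = -(a j * a i)

/-- The chirality matrix `α₁ α₂ α₃`. -/
def chirality (a : Fin 3 → Mat4) : Mat4 := a 0 * a 1 * a 2

namespace IsDiracFrame

variable {b : Mat4} {a : Fin 3 → Mat4}

/-- Rewriting rules that sort monomials in the Dirac matrices. -/
theorem rules (h : IsDiracFrame b a) :
    (b * b = 1 ∧ a 0 * a 0 = 1 ∧ a 1 * a 1 = 1 ∧ a 2 * a 2 = 1) ∧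
    (a 0 * b = -(b * a 0) ∧ a 1 * b = -(b * a 1) ∧ a 2 * b = -(b * a 2) ∧
      a 1 * a 0 = -(a 0 * a 1) ∧ a 2 * a 0 = -(a 0 * a 2) ∧ a 2 * a 1 = -(a 1 * a 2)) ∧
    (∀ x, b * (b * x) = x) ∧ (∀ i x, a i * (a i * x) = x) ∧
    (∀ i x, a i * (b * x) = -(b * (a i * x))) ∧
    (∀ x, a 1 * (a 0 * x) = -(a 0 * (a 1 * x))) ∧
    (∀ x, a 2 * (a 0 * x) = -(a 0 * (a 2 * x))) ∧
    (∀ x, a 2 * (a 1 * x) = -(a 1 * (a 2 * x))) := by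
  have h10 := h.anti_alpha 1 0 (by decide)
  have h20 := h.anti_alpha 2 0 (by decide)
  have h21 := h.anti_alpha 2 1 (by decide)
  refine ⟨⟨h.sq_beta, h.sq_alpha 0, h.sq_alpha 1, h.sq_alpha 2⟩,
    ⟨h.anti_beta 0, h.anti_beta 1, h.anti_beta 2, h10, h20, h21⟩, ?_, ?_, ?_, ?_, ?_, ?_⟩
  · intro x; rw [← mul_assoc, h.sq_beta, one_mul]
  · intro i x; rw [← mul_assoc, h.sq_alpha, one_mul]
  · intro i x; rw [← mul_assoc, h.anti_beta, neg_mul, mul_assoc]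
  · intro x; rw [← mul_assoc, h10, neg_mul, mul_assoc]
  · intro x; rw [← mul_assoc, h20, neg_mul, mul_assoc]
  · intro x; rw [← mul_assoc, h21, neg_mul, mul_assoc]

/-- The ordered products of the Dirac matrices. -/
def monomial (b : Mat4) (a : Fin 3 → Mat4) (I : Bool × Bool × Bool × Bool) : Mat4 :=
  (if I.1 then b else 1) * (if I.2.1 then a 0 else 1) * (if I.2.2.1 then a 1 else 1) *
    (if I.2.2.2 then a 2 else 1)

theorem monomial_ne_zero (h : IsDiracFrame b a) (I : Bool × Bool × Bool × Bool) :
    monomial b a I ≠ 0 := by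
  have hu : IsUnit (monomial b a I) := by
    unfold monomial
    have hb : IsUnit b := IsUnit.of_mul_eq_one b h.sq_beta
    have ha : ∀ i, IsUnit (a i) := fun i => IsUnit.of_mul_eq_one (a i) (h.sq_alpha i)
    refine ((IsUnit.mul ?_ ?_).mul ?_).mul ?_ <;> split_ifs <;> simp [hb, ha]
  exact hu.ne_zero

/-- A linear combination of conjugations which has the monomials as eigenvectors. -/
def separator (b : Mat4) (a : Fin 3 → Mat4) : Module.End ℂ Mat4 where
  toFun M := (a 0 * (a 1 * a 2)) * M * (a 2 * (a 1 * a 0)) +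
    (2 : ℂ) • ((b * (a 1 * a 2)) * M * (a 2 * (a 1 * b))) +
    (4 : ℂ) • ((b * (a 0 * a 2)) * M * (a 2 * (a 0 * b))) +
    (8 : ℂ) • ((b * (a 0 * a 1)) * M * (a 1 * (a 0 * b)))
  map_add' x y := by simp only [mul_add, add_mul, smul_add]; abel
  map_smul' c x := by
    simp only [mul_smul_comm, smul_mul_assoc, smul_add, RingHom.id_apply]
    simp only [smul_comm c]

/-- The eigenvalues of `separator` on the monomials. -/
def sepValue (I : Bool × Bool × Bool × Bool) : ℤ :=
  (if I.1 then -1 else 1) + 2 * (if I.2.1 then -1 else 1) + 4 * (if I.2.2.1 then -1 else 1) +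
    8 * (if I.2.2.2 then -1 else 1)

/-- Signs weighted by 1, 2, 4, 8 have pairwise different sums, so the 16 eigenvalues are distinct.
-/
theorem sepValue_injective : Function.Injective sepValue := by decide

/-- A product of three of the four generators commutes with its factors and anticommutes with the
fourth generator. Conjugation by it therefore changes the sign of a monomial exactly when the fourth
generator occurs in it. -/
theorem separator_monomial (h : IsDiracFrame b a) (I : Bool × Bool × Bool × Bool) :
    separator b a (monomial b a I) = ((sepValue I : ℤ) : ℂ) • monomial b a I := by
  obtain ⟨⟨r1, r2, r3, r4⟩, ⟨s1, s2, s3, s4, s5, s6⟩, t1, t2, t3, t4, t5, t6⟩ := h.rules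
  obtain ⟨i, j, k, l⟩ := I
  cases i <;> cases j <;> cases k <;> cases l <;>
  · simp only [separator, monomial, sepValue, LinearMap.coe_mk, AddHom.coe_mk, if_true,
      Bool.false_eq_true, if_false, one_mul, mul_one, mul_assoc, r1, r2, r3, r4, s1, s2, s3, s4,
      s5, s6, t1, t2, t3, t4, t5, t6, mul_neg, neg_neg]
    push_cast
    module

theorem linearIndependent_monomial (h : IsDiracFrame b a) :
    LinearIndependent ℂ (monomial b a) :=
  Module.End.eigenvectors_linearIndependent' (separator b a) (fun I => ((sepValue I : ℤ) : ℂ))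
    (Int.cast_injective.comp sepValue_injective) _
    (fun I => ⟨Module.End.mem_eigenspace_iff.mpr (h.separator_monomial I), h.monomial_ne_zero I⟩)

theorem span_monomial (h : IsDiracFrame b a) :
    Submodule.span ℂ (Set.range (monomial b a)) = ⊤ :=
  h.linearIndependent_monomial.span_eq_top_of_card_eq_finrank (by
    simp [Module.finrank_matrix])

/-- A linear condition closed under products holds for all matrices if it holds for the Dirac
matrices. -/
theorem induction (h : IsDiracFrame b a) {p : Mat4 → Prop} (one : p 1) (beta : p b)
    (alpha : ∀ i, p (a i)) (add : ∀ M N, p M → p N → p (M + N))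
    (smul : ∀ (c : ℂ) M, p M → p (c • M)) (mul : ∀ M N, p M → p N → p (M * N)) (M : Mat4) :
    p M := by
  have hM : M ∈ Submodule.span ℂ (Set.range (monomial b a)) := by
    rw [h.span_monomial]; trivial
  induction hM using Submodule.span_induction with
  | mem x hx =>
    obtain ⟨I, rfl⟩ := hx
    unfold monomial
    refine mul _ _ (mul _ _ (mul _ _ ?_ ?_) ?_) ?_ <;> split_ifs <;> simp [one, beta, alpha]
  | zero => simpa using smul 0 _ one
  | add x y _ _ hx hy => exact add _ _ hx hy
  | smul c x _ hx => exact smul c x hx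

/-- Schur's lemma for the Dirac matrices. -/
theorem eq_smul_one (h : IsDiracFrame b a) {Z : Mat4} (hb : Commute Z b)
    (ha : ∀ i, Commute Z (a i)) : ∃ z : ℂ, Z = z • (1 : Mat4) := by
  have hall : ∀ M, Commute Z M := fun M =>
    h.induction (p := fun M => Commute Z M) (Commute.one_right _) hb ha
      (fun _ _ => Commute.add_right) (fun c _ hM => hM.smul_right c)
      (fun _ _ => Commute.mul_right) M
  obtain ⟨z, hz⟩ := Matrix.mem_range_scalar_of_commute_single (M := Z)
    (fun i j _ => (hall _).symm)
  exact ⟨z, by rw [← hz, Matrix.smul_one_eq_diagonal]; rfl⟩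

theorem chirality_sq (h : IsDiracFrame b a) : chirality a * chirality a = -1 := by
  obtain ⟨⟨r1, r2, r3, r4⟩, ⟨s1, s2, s3, s4, s5, s6⟩, t1, t2, t3, t4, t5, t6⟩ := h.rules
  simp only [chirality, mul_assoc, r1, r2, r3, r4, s1, s2, s3, s4,
      s5, s6, t1, t2, t3, t4, t5, t6, mul_neg, neg_neg]

theorem alpha_mul_chirality (h : IsDiracFrame b a) (i : Fin 3) :
    a i * chirality a = chirality a * a i := by
  obtain ⟨⟨r1, r2, r3, r4⟩, ⟨s1, s2, s3, s4, s5, s6⟩, t1, t2, t3, t4, t5, t6⟩ := h.rules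
  fin_cases i <;>
  simp [chirality, mul_assoc, r1, r2, r3, r4, s1, s2, s3, s4, s5, s6, t1, t2, t3, t4, t5, t6]

theorem beta_mul_chirality (h : IsDiracFrame b a) :
    b * chirality a = -(chirality a * b) := by
  obtain ⟨⟨r1, r2, r3, r4⟩, ⟨s1, s2, s3, s4, s5, s6⟩, t1, t2, t3, t4, t5, t6⟩ := h.rules
  simp [chirality, mul_assoc, r1, r2, r3, r4, s1, s2, s3, s4, s5, s6, t1, t2, t3, t4, t5, t6]

end IsDiracFrame

/-- A matrix that anticommutes with an involution has trace `0`. -/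
theorem trace_eq_zero_of_anticommute {M g : Mat4} (hg : g * g = 1) (h : g * M = -(M * g)) :
    M.trace = 0 := by
  have h1 : M.trace = (g * (M * g)).trace := by
    rw [Matrix.trace_mul_comm, mul_assoc, hg, mul_one]
  rw [← mul_assoc, h, neg_mul, mul_assoc, hg, mul_one, Matrix.trace_neg] at h1
  linear_combination h1 / 2

/-- Passing to β = γ⁰ and αᵢ = γ⁰γⁱ turns the indefinite Clifford relations into those of four
anticommuting involutions. -/
theorem IsGammaRep.isDiracFrame {γ : Fin 4 → Mat4} (hγ : IsGammaRep γ) :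
    IsDiracFrame (γ 0) (fun i => γ 0 * γ i.succ) := by
  have h00 : γ 0 * γ 0 = 1 := by
    have := hγ.anticomm 0 0
    rw [← two_smul ℂ (γ 0 * γ 0)] at this
    simp only [minkowski, Matrix.diagonal_apply_eq] at this
    norm_num at this
    exact this
  have h0i : ∀ i : Fin 3, γ i.succ * γ 0 = -(γ 0 * γ i.succ) := fun i => by
    have := hγ.anticomm i.succ 0
    rw [minkowski, Matrix.diagonal_apply_ne _ (Fin.succ_ne_zero i)] at this
    simp at this
    exact eq_neg_of_add_eq_zero_left this
  have hii : ∀ i : Fin 3, γ i.succ * γ i.succ = -1 := fun i => by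
    have := hγ.anticomm i.succ i.succ
    rw [← two_smul ℂ (γ i.succ * γ i.succ), minkowski, Matrix.diagonal_apply_eq] at this
    have h2 : ((![1, -1, -1, -1] : Fin 4 → ℝ) i.succ) = -1 := by fin_cases i <;> rfl
    rw [h2] at this
    have h3 : (2 : ℂ) • (γ i.succ * γ i.succ + 1) = 0 := by
      rw [smul_add, this]; push_cast; module
    rcases smul_eq_zero.mp h3 with h | h
    · norm_num at h
    · exact eq_neg_of_add_eq_zero_left h
  have hij : ∀ i j : Fin 3, i ≠ j → γ i.succ * γ j.succ = -(γ j.succ * γ i.succ) :=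
    fun i j hne => by
    have := hγ.anticomm i.succ j.succ
    rw [minkowski, Matrix.diagonal_apply_ne _ (fun h => hne (Fin.succ_injective _ h))] at this
    simp at this
    exact eq_neg_of_add_eq_zero_left this
  have key : ∀ i j : Fin 3, γ 0 * γ i.succ * (γ 0 * γ j.succ) = -(γ i.succ * γ j.succ) := by
    intro i j
    rw [mul_assoc, ← mul_assoc (γ i.succ), h0i, neg_mul, mul_neg, mul_assoc, ← mul_assoc (γ 0),
      h00, one_mul]
  refine ⟨h00, fun i => ?_, fun i => ?_, fun i j hne => ?_⟩
  · rw [key, hii, neg_neg]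
  · rw [mul_assoc, h0i, mul_neg]
  · rw [key, key, hij i j hne]

theorem IsGammaRep.alpha_isHermitian {γ : Fin 4 → Mat4} (hγ : IsGammaRep γ) (i : Fin 3) :
    (γ 0 * γ i.succ).conjTranspose = γ 0 * γ i.succ := by
  rw [Matrix.conjTranspose_mul, hγ.hermitian, hγ.antihermitian, neg_mul]
  have := hγ.isDiracFrame.anti_beta i
  have h0 := hγ.isDiracFrame.sq_beta
  have h2 : γ i.succ * γ 0 = -(γ 0 * γ i.succ) := by
    have h3 := congrArg (fun M => γ 0 * M) this
    simp only [mul_neg, ← mul_assoc, h0, one_mul] at h3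
    exact h3
  rw [h2, neg_neg]

/-! ### Tensor products and the commutant of the one-particle matrices. -/

theorem onParticle_zero (M : Mat4) : onParticle 0 M = M ⊗ₖ (1 : Mat4) := by simp [onParticle]

theorem onParticle_one (M : Mat4) : onParticle 1 M = (1 : Mat4) ⊗ₖ M := by simp [onParticle]

theorem neg_kronecker (M N : Mat4) : (-M) ⊗ₖ N = -(M ⊗ₖ N) := by
  ext ⟨i, j⟩ ⟨k, l⟩
  simp [Matrix.kroneckerMap_apply]

/-- Exchange of the two tensor factors. -/
def swapSpin : SpinMatrix ≃ₐ[ℂ] SpinMatrix :=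
  Matrix.reindexAlgEquiv ℂ ℂ (Equiv.prodComm (Fin 4) (Fin 4))

theorem swapSpin_kronecker (M N : Mat4) : swapSpin (M ⊗ₖ N) = N ⊗ₖ M := by
  ext ⟨i, j⟩ ⟨k, l⟩
  simp [swapSpin, Matrix.kroneckerMap_apply, mul_comm]

/-- The partial trace over the first factor of `(N ⊗ 1) V`. -/
def partialTrace (N : Mat4) : SpinMatrix →ₗ[ℂ] Mat4 where
  toFun V := Matrix.of fun k l => ∑ i, ∑ j, N j i * V (i, k) (j, l)
  map_add' V W := by
    ext k l; simp [mul_add, Finset.sum_add_distrib]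
  map_smul' c V := by
    ext k l; simp [Finset.mul_sum, mul_left_comm]

theorem partialTrace_kronecker (N X Y : Mat4) :
    partialTrace N (X ⊗ₖ Y) = (N * X).trace • Y := by
  ext k l
  simp only [partialTrace, LinearMap.coe_mk, AddHom.coe_mk, Matrix.of_apply,
    Matrix.kroneckerMap_apply, Matrix.smul_apply, smul_eq_mul, Matrix.trace, Matrix.diag,
    Matrix.mul_apply, Finset.sum_mul]
  rw [Finset.sum_comm]
  exact Finset.sum_congr rfl fun i _ => Finset.sum_congr rfl fun j _ => by ring

theorem exists_eq_one_kronecker {X : SpinMatrix}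
    (h : ∀ M : Mat4, Commute X (M ⊗ₖ (1 : Mat4))) : ∃ A : Mat4, X = (1 : Mat4) ⊗ₖ A := by
  refine ⟨Matrix.of fun k l => X (0, k) (0, l), ?_⟩
  ext ⟨q, k⟩ ⟨j, l⟩
  -- This entry of the commutation with E_{0q} ⊗ 1 reads δ_{qj} X_{(0,k),(0,l)} = X_{(q,k),(j,l)}.
  have h1 := congrFun (congrFun (h (Matrix.single 0 q 1)) (0, k)) (j, l)
  simp only [Matrix.mul_apply, Fintype.sum_prod_type, Matrix.kroneckerMap_apply,
    Matrix.single_apply, Matrix.one_apply] at h1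
  simp only [Matrix.kroneckerMap_apply, Matrix.one_apply, Matrix.of_apply]
  by_cases hq : q = j
  · subst hq
    simp [ite_and] at h1
    simp [h1]
  · simp [ite_and, hq] at h1
    simp [hq, ← h1]

namespace IsDiracFrame

variable {b : Mat4} {a : Fin 3 → Mat4}

theorem exists_eq_one_kronecker_of_commute (h : IsDiracFrame b a) {X : SpinMatrix}
    (hb : Commute X (b ⊗ₖ (1 : Mat4))) (ha : ∀ i, Commute X (a i ⊗ₖ (1 : Mat4))) :
    ∃ A : Mat4, X = (1 : Mat4) ⊗ₖ A := by
  refine exists_eq_one_kronecker fun M =>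
    h.induction (p := fun M => Commute X (M ⊗ₖ (1 : Mat4))) ?_ hb ha ?_ ?_ ?_ M
  · rw [Matrix.one_kronecker_one]; exact Commute.one_right _
  · intro M N hM hN; rw [Matrix.add_kronecker]; exact hM.add_right hN
  · intro c M hM; rw [Matrix.smul_kronecker]; exact hM.smul_right c
  · intro M N hM hN
    have : (M * N) ⊗ₖ (1 : Mat4) = (M ⊗ₖ (1 : Mat4)) * (N ⊗ₖ (1 : Mat4)) := by
      rw [← Matrix.mul_kronecker_mul, one_mul]
    rw [this]; exact hM.mul_right hN

/-- The commutant of the `αᵢ ⊗ 1`. -/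
theorem exists_decomposition (h : IsDiracFrame b a) {V : SpinMatrix}
    (ha : ∀ i, Commute V (a i ⊗ₖ (1 : Mat4))) :
    ∃ A B : Mat4, V = (1 : Mat4) ⊗ₖ A + chirality a ⊗ₖ B := by
  set β : SpinMatrix := b ⊗ₖ (1 : Mat4) with hβ
  set w : SpinMatrix := chirality a ⊗ₖ (1 : Mat4) with hw
  have hββ : β * β = 1 := by
    rw [hβ, ← Matrix.mul_kronecker_mul, h.sq_beta, one_mul, Matrix.one_kronecker_one]
  have hww : w * w = -1 := by
    rw [hw, ← Matrix.mul_kronecker_mul, h.chirality_sq, one_mul, neg_kronecker,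
      Matrix.one_kronecker_one]
  have hβw : β * w = -(w * β) := by
    rw [hw, hβ, ← Matrix.mul_kronecker_mul, ← Matrix.mul_kronecker_mul, h.beta_mul_chirality,
      neg_kronecker]
  have haw : ∀ i, (a i ⊗ₖ (1 : Mat4)) * w = w * (a i ⊗ₖ (1 : Mat4)) := fun i => by
    rw [hw, ← Matrix.mul_kronecker_mul, ← Matrix.mul_kronecker_mul, h.alpha_mul_chirality]
  have haβ : ∀ i, (a i ⊗ₖ (1 : Mat4)) * β = -(β * (a i ⊗ₖ (1 : Mat4))) := fun i => by
    rw [hβ, ← Matrix.mul_kronecker_mul, ← Matrix.mul_kronecker_mul, h.anti_beta,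
      neg_kronecker]
  have hconj : ∀ i, Commute (β * V * β) (a i ⊗ₖ (1 : Mat4)) := fun i => by
    have hV := (ha i).eq
    unfold Commute SemiconjBy
    calc β * V * β * (a i ⊗ₖ (1 : Mat4)) = -(β * (V * (a i ⊗ₖ (1 : Mat4))) * β) := by
          rw [mul_assoc (β * V), ← neg_eq_iff_eq_neg.mpr (haβ i)]; noncomm_ring
      _ = -(β * (a i ⊗ₖ (1 : Mat4))) * V * β := by rw [hV]; noncomm_ring
      _ = _ := by rw [← haβ]; noncomm_ring
  -- V is split into its parts commuting and anticommuting with β. The first part commutes with all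
  -- Dirac matrices of the first factor.
  obtain ⟨A, hA⟩ := h.exists_eq_one_kronecker_of_commute (X := V + β * V * β)
    (by
      change (V + β * V * β) * β = β * (V + β * V * β)
      rw [add_mul, mul_add, mul_assoc (β * V), hββ, mul_one, ← mul_assoc β (β * V),
        ← mul_assoc β β, hββ, one_mul, add_comm])
    (fun i => (ha i).add_left (hconj i))
  -- The other part anticommutes with β. Multiplication by w, which also anticommutes with β and
  -- commutes with the αᵢ, brings it into the same commutant; w² = -1 undoes the factor.
  obtain ⟨B, hB⟩ := h.exists_eq_one_kronecker_of_commute (X := w * (V - β * V * β))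
    (by
      change w * (V - β * V * β) * β = β * (w * (V - β * V * β))
      have e1 : w * (V - β * V * β) * β = w * V * β - w * β * V * (β * β) := by noncomm_ring
      have e2 : β * (w * (V - β * V * β)) = β * w * V - β * w * β * V * β := by noncomm_ring
      have e3 : -(w * β) * V - -(w * β) * β * V * β = -(w * β * V) + w * (β * β) * V * β := by
        noncomm_ring
      rw [e1, e2, hβw, e3, hββ]
      noncomm_ring)
    (fun i => by
      refine Commute.mul_left ?_ ((ha i).sub_left (hconj i))
      exact (haw i).symm)
  refine ⟨(1 / 2 : ℂ) • A, (-(1 / 2) : ℂ) • B, ?_⟩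
  have h1 : chirality a ⊗ₖ B = -(V - β * V * β) := by
    have : chirality a ⊗ₖ B = w * ((1 : Mat4) ⊗ₖ B) := by
      rw [hw, ← Matrix.mul_kronecker_mul, one_mul, mul_one]
    rw [this, ← hB, ← mul_assoc, hww, neg_mul, one_mul]
  rw [Matrix.kronecker_smul, Matrix.kronecker_smul, ← hA, h1]
  module

/-! ### Bivector components and the stabilizer of a vector. -/

/-- The Lorentz group leaves no nonzero bivector fixed: a matrix that commutes with the
stabilizer of the vector `(t, y)`, `y ≠ 0`, has no component along the `αᵢ` and `ω αᵢ`. -/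
theorem trace_eq_zero_of_commute_stabilizer (h : IsDiracFrame b a) {C : Mat4} {t : ℂ}
    {y : Fin 3 → ℂ} (hy : y ≠ 0)
    (h01 : Commute (y 0 • a 1 - y 1 • a 0 - t • (a 0 * a 1)) C)
    (h12 : Commute (y 1 • a 2 - y 2 • a 1 - t • (a 1 * a 2)) C)
    (h20 : Commute (y 2 • a 0 - y 0 • a 2 - t • (a 2 * a 0)) C)
    (hR : Commute (y 0 • (a 1 * a 2) + y 1 • (a 2 * a 0) + y 2 • (a 0 * a 1)) C) (i : Fin 3) :
    (a i * C).trace = 0 ∧ (chirality a * a i * C).trace = 0 := by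
  obtain ⟨⟨r1, r2, r3, r4⟩, ⟨s1, s2, s3, s4, s5, s6⟩, t1, t2, t3, t4, t5, t6⟩ := h.rules
  -- If K commutes with C, cyclicity of the trace gives tr([K, N] C) = 0 for every N. Suitable
  -- choices of N make [K, N] a combination of the αᵢ or of the products αᵢαⱼ.
  have key : ∀ K N : Mat4, Commute K C → ((K * N - N * K) * C).trace = 0 := fun K N hK => by
    rw [sub_mul, Matrix.trace_sub, mul_assoc N, hK.eq, ← mul_assoc, Matrix.trace_mul_comm (N * C),
      mul_assoc, sub_self]
  set u : Fin 3 → ℂ := fun i => (a i * C).trace with hu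
  set s12 := (a 1 * a 2 * C).trace with hs12
  set s20 := (a 2 * a 0 * C).trace with hs20
  set s01 := (a 0 * a 1 * C).trace with hs01
  have e1 : y 0 * u 0 + y 1 * u 1 = 0 := by
    have := key _ (a 0 * a 1) h01
    have e : (y 0 • a 1 - y 1 • a 0 - t • (a 0 * a 1)) * (a 0 * a 1) -
        (a 0 * a 1) * (y 0 • a 1 - y 1 • a 0 - t • (a 0 * a 1)) =
        (-2 * y 0) • a 0 + (-2 * y 1) • a 1 := by
      simp only [sub_mul, mul_sub, smul_mul_assoc, mul_smul_comm, mul_assoc, r1, r2, r3, r4, s1,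
        s2, s3, s4, s5, s6, t1, t2, t3, t4, t5, t6, mul_neg, neg_mul, neg_neg, mul_one]
      module
    rw [e] at this
    simp only [add_mul, smul_mul_assoc, Matrix.trace_add, Matrix.trace_smul, smul_eq_mul] at this
    linear_combination -this / 2
  have e2 : y 1 * u 1 + y 2 * u 2 = 0 := by
    have := key _ (a 1 * a 2) h12
    have e : (y 1 • a 2 - y 2 • a 1 - t • (a 1 * a 2)) * (a 1 * a 2) -
        (a 1 * a 2) * (y 1 • a 2 - y 2 • a 1 - t • (a 1 * a 2)) =
        (-2 * y 1) • a 1 + (-2 * y 2) • a 2 := by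
      simp only [sub_mul, mul_sub, smul_mul_assoc, mul_smul_comm, mul_assoc, r1, r2, r3, r4, s1,
        s2, s3, s4, s5, s6, t1, t2, t3, t4, t5, t6, mul_neg, neg_mul, neg_neg, mul_one]
      module
    rw [e] at this
    simp only [add_mul, smul_mul_assoc, Matrix.trace_add, Matrix.trace_smul, smul_eq_mul] at this
    linear_combination -this / 2
  have e3 : y 2 * u 2 + y 0 * u 0 = 0 := by
    have := key _ (a 2 * a 0) h20
    have e : (y 2 • a 0 - y 0 • a 2 - t • (a 2 * a 0)) * (a 2 * a 0) -
        (a 2 * a 0) * (y 2 • a 0 - y 0 • a 2 - t • (a 2 * a 0)) =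
        (-2 * y 2) • a 2 + (-2 * y 0) • a 0 := by
      simp only [sub_mul, mul_sub, smul_mul_assoc, mul_smul_comm, mul_assoc, r1, r2, r3, r4, s1,
        s2, s3, s4, s5, s6, t1, t2, t3, t4, t5, t6, mul_neg, neg_mul, neg_neg, mul_one]
      module
    rw [e] at this
    simp only [add_mul, smul_mul_assoc, Matrix.trace_add, Matrix.trace_smul, smul_eq_mul] at this
    linear_combination -this / 2
  have f1 : y 0 * s12 + y 1 * s20 = 0 := by
    have := key _ (a 2) h01
    have e : (y 0 • a 1 - y 1 • a 0 - t • (a 0 * a 1)) * (a 2) -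
        (a 2) * (y 0 • a 1 - y 1 • a 0 - t • (a 0 * a 1)) =
        (2 * y 0) • (a 1 * a 2) + (2 * y 1) • (a 2 * a 0) := by
      simp only [sub_mul, mul_sub, smul_mul_assoc, mul_smul_comm, mul_assoc, r1, r2, r3, r4, s1,
        s2, s3, s4, s5, s6, t1, t2, t3, t4, t5, t6, mul_neg, neg_mul, neg_neg, mul_one]
      module
    rw [e] at this
    simp only [add_mul, smul_mul_assoc, Matrix.trace_add, Matrix.trace_smul, smul_eq_mul] at this
    linear_combination this / 2
  have f2 : y 1 * s20 + y 2 * s01 = 0 := by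
    have := key _ (a 0) h12
    have e : (y 1 • a 2 - y 2 • a 1 - t • (a 1 * a 2)) * (a 0) -
        (a 0) * (y 1 • a 2 - y 2 • a 1 - t • (a 1 * a 2)) =
        (2 * y 1) • (a 2 * a 0) + (2 * y 2) • (a 0 * a 1) := by
      simp only [sub_mul, mul_sub, smul_mul_assoc, mul_smul_comm, mul_assoc, r1, r2, r3, r4, s1,
        s2, s3, s4, s5, s6, t1, t2, t3, t4, t5, t6, mul_neg, neg_mul, neg_neg, mul_one]
      module
    rw [e] at this
    simp only [add_mul, smul_mul_assoc, Matrix.trace_add, Matrix.trace_smul, smul_eq_mul] at this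
    linear_combination this / 2
  have f3 : y 2 * s01 + y 0 * s12 = 0 := by
    have := key _ (a 1) h20
    have e : (y 2 • a 0 - y 0 • a 2 - t • (a 2 * a 0)) * (a 1) -
        (a 1) * (y 2 • a 0 - y 0 • a 2 - t • (a 2 * a 0)) =
        (2 * y 2) • (a 0 * a 1) + (2 * y 0) • (a 1 * a 2) := by
      simp only [sub_mul, mul_sub, smul_mul_assoc, mul_smul_comm, mul_assoc, r1, r2, r3, r4, s1,
        s2, s3, s4, s5, s6, t1, t2, t3, t4, t5, t6, mul_neg, neg_mul, neg_neg, mul_one]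
      module
    rw [e] at this
    simp only [add_mul, smul_mul_assoc, Matrix.trace_add, Matrix.trace_smul, smul_eq_mul] at this
    linear_combination this / 2
  -- The rotation about y yields that y × u and y × (s₁₂, s₂₀, s₀₁) vanish.
  have cross : ∀ N P Q : Mat4, ∀ p q : ℂ,
      (y 0 • (a 1 * a 2) + y 1 • (a 2 * a 0) + y 2 • (a 0 * a 1)) * N -
        N * (y 0 • (a 1 * a 2) + y 1 • (a 2 * a 0) + y 2 • (a 0 * a 1)) =
        (2 * p) • P - (2 * q) • Q → p * (P * C).trace = q * (Q * C).trace := by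
    intro N P Q p q e
    have := key _ N hR
    rw [e] at this
    simp only [sub_mul, smul_mul_assoc, Matrix.trace_sub, Matrix.trace_smul, smul_eq_mul] at this
    linear_combination this / 2
  have g0 : y 1 * u 2 = y 2 * u 1 := by
    refine (cross (a 0) (a 2) (a 1) _ _ ?_)
    simp only [sub_mul, mul_sub, add_mul, mul_add, smul_mul_assoc, mul_smul_comm, mul_assoc, r1, r2,
      r3, r4, s1, s2, s3, s4, s5, s6, t1, t2, t3, t4, t5, t6, mul_neg, neg_mul, neg_neg, mul_one]
    module
  have g1 : y 2 * u 0 = y 0 * u 2 := by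
    refine (cross (a 1) (a 0) (a 2) _ _ ?_)
    simp only [sub_mul, mul_sub, add_mul, mul_add, smul_mul_assoc, mul_smul_comm, mul_assoc, r1, r2,
      r3, r4, s1, s2, s3, s4, s5, s6, t1, t2, t3, t4, t5, t6, mul_neg, neg_mul, neg_neg, mul_one]
    module
  have g2 : y 0 * u 1 = y 1 * u 0 := by
    refine (cross (a 2) (a 1) (a 0) _ _ ?_)
    simp only [sub_mul, mul_sub, add_mul, mul_add, smul_mul_assoc, mul_smul_comm, mul_assoc, r1, r2,
      r3, r4, s1, s2, s3, s4, s5, s6, t1, t2, t3, t4, t5, t6, mul_neg, neg_mul, neg_neg, mul_one]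
    module
  have k0 : y 1 * s01 = y 2 * s20 := by
    refine (cross (a 1 * a 2) (a 0 * a 1) (a 2 * a 0) _ _ ?_)
    simp only [sub_mul, mul_sub, add_mul, mul_add, smul_mul_assoc, mul_smul_comm, mul_assoc, r1, r2,
      r3, r4, s1, s2, s3, s4, s5, s6, t1, t2, t3, t4, t5, t6, mul_neg, neg_mul, neg_neg, mul_one]
    module
  have k1 : y 2 * s12 = y 0 * s01 := by
    refine (cross (a 2 * a 0) (a 1 * a 2) (a 0 * a 1) _ _ ?_)
    simp only [sub_mul, mul_sub, add_mul, mul_add, smul_mul_assoc, mul_smul_comm, mul_assoc, r1, r2,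
      r3, r4, s1, s2, s3, s4, s5, s6, t1, t2, t3, t4, t5, t6, mul_neg, neg_mul, neg_neg, mul_one]
    module
  have k2 : y 0 * s20 = y 1 * s12 := by
    refine (cross (a 0 * a 1) (a 2 * a 0) (a 1 * a 2) _ _ ?_)
    simp only [sub_mul, mul_sub, add_mul, mul_add, smul_mul_assoc, mul_smul_comm, mul_assoc, r1, r2,
      r3, r4, s1, s2, s3, s4, s5, s6, t1, t2, t3, t4, t5, t6, mul_neg, neg_mul, neg_neg, mul_one]
    module
  -- The pairwise sums make each product of corresponding components vanish separately, so the
  -- argument does not need y · y ≠ 0, which may fail for complex y. A nonzero component of y then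
  -- kills one unknown, and the cross product the other two.
  have solve : ∀ p q r : ℂ, y 0 * p + y 1 * q = 0 → y 1 * q + y 2 * r = 0 →
      y 2 * r + y 0 * p = 0 → y 1 * r = y 2 * q → y 2 * p = y 0 * r → y 0 * q = y 1 * p →
      p = 0 ∧ q = 0 ∧ r = 0 := by
    intro p q r c1 c2 c3 d0 d1 d2
    have p0 : y 0 * p = 0 := by linear_combination (c1 - c2 + c3) / 2
    have q0 : y 1 * q = 0 := by linear_combination (c1 + c2 - c3) / 2
    have r0 : y 2 * r = 0 := by linear_combination (-c1 + c2 + c3) / 2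
    obtain ⟨j, hj⟩ := Function.ne_iff.mp hy
    fin_cases j
    · have hj : y 0 ≠ 0 := hj
      have : p = 0 := by simpa [hj] using p0
      subst this
      exact ⟨rfl, by simpa [hj] using d2, by simpa [hj] using d1.symm⟩
    · have hj : y 1 ≠ 0 := hj
      have : q = 0 := by simpa [hj] using q0
      subst this
      exact ⟨by simpa [hj] using d2.symm, rfl, by simpa [hj] using d0⟩
    · have hj : y 2 ≠ 0 := hj
      have : r = 0 := by simpa [hj] using r0
      subst this
      exact ⟨by simpa [hj] using d1, by simpa [hj] using d0.symm, rfl⟩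
  obtain ⟨u0, u1, u2⟩ := solve _ _ _ e1 e2 e3 g0 g1 g2
  obtain ⟨v0, v1, v2⟩ := solve _ _ _ f1 f2 f3 k0 k1 k2
  -- The ωαᵢ are the dual bivectors αⱼαₖ, whose traces against C are the second triple of unknowns.
  have w0 : chirality a * a 0 = a 1 * a 2 := by
    simp [chirality, mul_assoc, r1, r2, r3, r4, s1, s2, s3, s4, s5, s6, t1, t2, t3, t4, t5, t6]
  have w1 : chirality a * a 1 = a 2 * a 0 := by
    simp [chirality, mul_assoc, r1, r2, r3, r4, s1, s2, s3, s4, s5, s6, t1, t2, t3, t4, t5, t6]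
  have w2 : chirality a * a 2 = a 0 * a 1 := by
    simp [chirality, mul_assoc, r1, r2, r3, r4, s1, s2, s3, s4, s5, s6, t1, t2, t3, t4, t5, t6]
  fin_cases i
  · exact ⟨u0, by rw [← v0]; exact congrArg (fun M => (M * C).trace) w0⟩
  · exact ⟨u1, by rw [← v1]; exact congrArg (fun M => (M * C).trace) w1⟩
  · exact ⟨u2, by rw [← v2]; exact congrArg (fun M => (M * C).trace) w2⟩

end IsDiracFrame

-- The bivector component of the compatibility condition.

attribute [local instance] Matrix.linftyOpNormedRing Matrix.linftyOpNormedAlgebra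

namespace IsDiracFrame

variable {b : Mat4} {a : Fin 3 → Mat4}

theorem trace_alpha (h : IsDiracFrame b a) (i : Fin 3) : (a i).trace = 0 :=
  trace_eq_zero_of_anticommute h.sq_beta (by rw [h.anti_beta, neg_neg])

theorem trace_chirality (h : IsDiracFrame b a) : (chirality a).trace = 0 :=
  trace_eq_zero_of_anticommute h.sq_beta h.beta_mul_chirality

theorem trace_alpha_mul_chirality (h : IsDiracFrame b a) (i : Fin 3) :
    (a i * chirality a).trace = 0 := by
  obtain ⟨j, hj⟩ : ∃ j, j ≠ i := exists_ne i
  refine trace_eq_zero_of_anticommute (h.sq_alpha j) ?_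
  rw [← mul_assoc, h.anti_alpha j i hj, neg_mul, mul_assoc, mul_assoc, h.alpha_mul_chirality j]

theorem trace_alpha_mul_alpha (h : IsDiracFrame b a) (i j : Fin 3) :
    (a i * a j).trace = if i = j then 4 else 0 := by
  split_ifs with hij
  · subst hij; rw [h.sq_alpha]; simp
  · refine trace_eq_zero_of_anticommute (h.sq_alpha i) ?_
    rw [mul_assoc, h.anti_alpha j i (Ne.symm hij), mul_neg, neg_neg]

theorem trace_alpha_mul_alpha_mul_chirality (h : IsDiracFrame b a) (i j : Fin 3) :
    (a i * a j * chirality a).trace = 0 := by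
  refine trace_eq_zero_of_anticommute h.sq_beta ?_
  have hb : ∀ i, b * a i = -(a i * b) := fun i => by rw [h.anti_beta, neg_neg]
  calc b * (a i * a j * chirality a) = (b * a i) * a j * chirality a := by noncomm_ring
    _ = -(a i * (b * a j) * chirality a) := by rw [hb i]; noncomm_ring
    _ = a i * a j * (b * chirality a) := by rw [hb j]; noncomm_ring
    _ = _ := by rw [h.beta_mul_chirality]; noncomm_ring

/-- The component along `N` in the first tensor factor of the compatibility condition for the
potentials `C ⊗ 1 + D ⊗ ω` and `1 ⊗ A + ω ⊗ B`. -/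
theorem sum_trace_smul_eq_zero {A B C D N : Mat4}
    {A' B' C' D' : Fin 4 → Mat4} {m₁ m₂ κ : ℂ}
    (hN : N * chirality a = chirality a * N) (hN1 : N.trace = 0)
    (hNω : (N * chirality a).trace = 0)
    (hC' : ∀ μ, (N * C' μ).trace = 0) (hD' : ∀ μ, (N * D' μ).trace = 0)
    (hD : (N * D).trace = 0) (hωD : (N * (chirality a * D)).trace = 0)
    (heq : Complex.I • (((1 : Mat4) ⊗ₖ A' 0 + chirality a ⊗ₖ B' 0) +
        ∑ i : Fin 3, (a i ⊗ₖ (1 : Mat4)) * ((1 : Mat4) ⊗ₖ A' i.succ + chirality a ⊗ₖ B' i.succ) +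
        ((C' 0 ⊗ₖ (1 : Mat4) + D' 0 ⊗ₖ chirality a) +
        ∑ i : Fin 3, ((1 : Mat4) ⊗ₖ a i) *
          (C' i.succ ⊗ₖ (1 : Mat4) + D' i.succ ⊗ₖ chirality a))) =
      κ • ((m₁ • (b ⊗ₖ (1 : Mat4)) + (C ⊗ₖ (1 : Mat4) + D ⊗ₖ chirality a)) *
          (m₂ • ((1 : Mat4) ⊗ₖ b) + ((1 : Mat4) ⊗ₖ A + chirality a ⊗ₖ B)) -
        (m₂ • ((1 : Mat4) ⊗ₖ b) + ((1 : Mat4) ⊗ₖ A + chirality a ⊗ₖ B)) *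
          (m₁ • (b ⊗ₖ (1 : Mat4)) + (C ⊗ₖ (1 : Mat4) + D ⊗ₖ chirality a)))) :
    ∑ j : Fin 3, ((N * a j).trace • A' j.succ + (N * (a j * chirality a)).trace • B' j.succ) =
      0 := by
  have hDω : (N * (D * chirality a)).trace = 0 := by
    rw [← mul_assoc, Matrix.trace_mul_comm, ← mul_assoc, ← hN, mul_assoc, hωD]
  have hc : ∀ X : Mat4, (N * (X * chirality a)).trace = (N * (chirality a * X)).trace := by
    intro X
    rw [← mul_assoc, Matrix.trace_mul_comm, ← mul_assoc, ← mul_assoc, hN]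
  -- As N commutes with ω, tr(N X ω) = tr(N ω X), so the commutators of b and C with ω drop out.
  -- Every other term on the right cancels or carries a vanishing trace of D; on the left C' and D'
  -- disappear, as do A' 0 and B' 0.
  have h1 := congrArg (partialTrace N) heq
  simp only [mul_add, add_mul, smul_mul_assoc, mul_smul_comm, ← Matrix.mul_kronecker_mul, map_add,
    map_sub, map_smul, map_sum, partialTrace_kronecker, one_mul, mul_one, hN1, hNω, hC', hD', hD,
    hωD, hDω, hc, zero_smul, smul_zero, add_zero, zero_add, Finset.sum_const_zero] at h1
  have h3 : (Complex.I • ∑ j : Fin 3, ((N * a j).trace • A' j.succ +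
      (N * (a j * chirality a)).trace • B' j.succ)) = 0 := by
    simp only [hc]
    rw [h1]
    module
  exact (smul_eq_zero.mp h3).resolve_left Complex.I_ne_zero

/-- The bivectors N = αᵢ and N = ωαᵢ isolate the i-th spatial derivative of A and of B, since the
Dirac matrices are orthogonal for the trace form. The factor κ allows for the sign of the commutator
under exchange of the particles. -/
theorem spatial_derivatives_eq_zero (h : IsDiracFrame b a) {A B C D : Mat4}
    {A' B' C' D' : Fin 4 → Mat4} {m₁ m₂ κ : ℂ}
    (hC' : ∀ i μ, (a i * C' μ).trace = 0 ∧ (chirality a * a i * C' μ).trace = 0)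
    (hD' : ∀ i μ, (a i * D' μ).trace = 0 ∧ (chirality a * a i * D' μ).trace = 0)
    (hD : ∀ i, (a i * D).trace = 0 ∧ (chirality a * a i * D).trace = 0)
    (heq : Complex.I • (((1 : Mat4) ⊗ₖ A' 0 + chirality a ⊗ₖ B' 0) +
        ∑ i : Fin 3, (a i ⊗ₖ (1 : Mat4)) * ((1 : Mat4) ⊗ₖ A' i.succ + chirality a ⊗ₖ B' i.succ) +
        ((C' 0 ⊗ₖ (1 : Mat4) + D' 0 ⊗ₖ chirality a) +
        ∑ i : Fin 3, ((1 : Mat4) ⊗ₖ a i) *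
          (C' i.succ ⊗ₖ (1 : Mat4) + D' i.succ ⊗ₖ chirality a))) =
      κ • ((m₁ • (b ⊗ₖ (1 : Mat4)) + (C ⊗ₖ (1 : Mat4) + D ⊗ₖ chirality a)) *
          (m₂ • ((1 : Mat4) ⊗ₖ b) + ((1 : Mat4) ⊗ₖ A + chirality a ⊗ₖ B)) -
        (m₂ • ((1 : Mat4) ⊗ₖ b) + ((1 : Mat4) ⊗ₖ A + chirality a ⊗ₖ B)) *
          (m₁ • (b ⊗ₖ (1 : Mat4)) + (C ⊗ₖ (1 : Mat4) + D ⊗ₖ chirality a)))) (i : Fin 3) :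
    A' i.succ = 0 ∧ B' i.succ = 0 := by
  constructor
  · have h1 := sum_trace_smul_eq_zero (N := a i) (h.alpha_mul_chirality i) (h.trace_alpha i)
      (h.trace_alpha_mul_chirality i) (fun μ => (hC' i μ).1) (fun μ => (hD' i μ).1) (hD i).1
      (by rw [← mul_assoc, h.alpha_mul_chirality, (hD i).2]) heq
    simp only [← mul_assoc, h.trace_alpha_mul_alpha, h.trace_alpha_mul_alpha_mul_chirality,
      zero_smul, add_zero, ite_smul, Finset.sum_ite_eq, Finset.mem_univ, if_true] at h1
    exact (smul_eq_zero.mp h1).resolve_left (by norm_num)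
  · have h1 := sum_trace_smul_eq_zero (N := chirality a * a i)
      (by rw [mul_assoc, h.alpha_mul_chirality])
      (by rw [← h.alpha_mul_chirality, h.trace_alpha_mul_chirality])
      (by rw [mul_assoc, h.alpha_mul_chirality, ← mul_assoc, h.chirality_sq, neg_mul, one_mul,
        Matrix.trace_neg, h.trace_alpha, neg_zero]) (fun μ => (hC' i μ).2) (fun μ => (hD' i μ).2)
      (hD i).2
      (by rw [← mul_assoc, mul_assoc (chirality a), h.alpha_mul_chirality, ← mul_assoc,
        h.chirality_sq, neg_mul, neg_mul, one_mul, Matrix.trace_neg, (hD i).1, neg_zero]) heq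
    have e1 : ∀ j, (chirality a * a i * a j).trace = 0 := fun j => by
      rw [mul_assoc, Matrix.trace_mul_comm, h.trace_alpha_mul_alpha_mul_chirality]
    have e2 : ∀ j, (chirality a * a i * (a j * chirality a)).trace = if i = j then -4 else 0 :=
      fun j => by
      rw [← mul_assoc, Matrix.trace_mul_comm, ← mul_assoc, ← mul_assoc, h.chirality_sq, neg_mul,
        one_mul, neg_mul, Matrix.trace_neg, h.trace_alpha_mul_alpha]
      split_ifs <;> simp
    simp only [e1, e2, zero_smul, zero_add, ite_smul, Finset.sum_ite_eq, Finset.mem_univ,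
      if_true] at h1
    exact (smul_eq_zero.mp h1).resolve_left (by norm_num)

end IsDiracFrame

/-! ### Lorentz covariant matrix fields. -/

/-- The unit vectors of space-time. -/
abbrev unitVec (μ : Fin 4) : SpaceTime := Pi.single μ 1

/-- The vector field generating the boosts in direction `i`. -/
def boostVec (x : SpaceTime) (i : Fin 3) : SpaceTime :=
  x i.succ • unitVec 0 + x 0 • unitVec i.succ

/-- The vector field generating the rotations in the plane of `i` and `j`. -/
def rotVec (x : SpaceTime) (i j : Fin 3) : SpaceTime :=
  x j.succ • unitVec i.succ - x i.succ • unitVec j.succ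

/-- Infinitesimal Lorentz covariance of a matrix field, the spin transformations being
generated by `αᵢ` and `αᵢ αⱼ` in the representation `ρ`. -/
def IsLorentzCovariantOn {n : Type*} [Fintype n] [DecidableEq n] (a : Fin 3 → Mat4)
    (ρ : Mat4 → Matrix n n ℂ) (O : Set SpaceTime) (f : SpaceTime → Matrix n n ℂ) : Prop :=
  ∀ x ∈ O, (∀ i, fderiv ℝ f x (boostVec x i) =
      (1 / 2 : ℂ) • (ρ (a i) * f x - f x * ρ (a i))) ∧
    ∀ i j, i ≠ j → fderiv ℝ f x (rotVec x i j) =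
      (1 / 2 : ℂ) • (ρ (a i * a j) * f x - f x * ρ (a i * a j))

namespace IsDiracFrame

variable {b : Mat4} {a : Fin 3 → Mat4} {O : Set SpaceTime} {f : SpaceTime → Mat4}

/-- Certain combinations of boosts and rotations have a vector field vanishing at x. By covariance
`f x` commutes with their spin generators, which is the situation of
`trace_eq_zero_of_commute_stabilizer`. -/
theorem trace_eq_zero_of_spatial_ne_zero (h : IsDiracFrame b a)
    (hf : IsLorentzCovariantOn a id O f) {x : SpaceTime} (hx : x ∈ O)
    (hx0 : (fun i : Fin 3 => x i.succ) ≠ 0) (i : Fin 3) :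
    (a i * f x).trace = 0 ∧ (chirality a * a i * f x).trace = 0 := by
  obtain ⟨hb, hr⟩ := hf x hx
  simp only [id] at hb hr
  have two : ∀ X Y : Mat4, (1 / 2 : ℂ) • (X - Y) = 0 → X = Y := fun X Y hXY =>
    sub_eq_zero.mp ((smul_eq_zero.mp hXY).resolve_left (by norm_num))
  have stab : ∀ i j, i ≠ j → Commute (((x i.succ : ℝ) : ℂ) • a j - ((x j.succ : ℝ) : ℂ) • a i -
      (-(x 0 : ℝ) : ℂ) • (a i * a j)) (f x) := by
    intro i j hij
    refine two _ _ ?_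
    have e : x i.succ • boostVec x j - x j.succ • boostVec x i + x 0 • rotVec x i j = 0 := by
      simp only [boostVec, rotVec]; module
    have e2 := congrArg (fderiv ℝ f x) e
    simp only [map_add, map_sub, map_smul, map_zero, hb, hr i j hij] at e2
    rw [← e2]
    simp only [sub_mul, mul_sub, smul_mul_assoc, mul_smul_comm, ← Complex.coe_smul]
    module
  refine h.trace_eq_zero_of_commute_stabilizer (t := (-(x 0 : ℝ) : ℂ))
    (y := fun i => ((x i.succ : ℝ) : ℂ)) ?_ (stab 0 1 (by decide)) (stab 1 2 (by decide))
    (stab 2 0 (by decide)) ?_ i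
  · intro h0
    exact hx0 (funext fun i => by simpa using congrFun h0 i)
  · refine two _ _ ?_
    have e : x (Fin.succ 0) • rotVec x 1 2 + x (Fin.succ 1) • rotVec x 2 0 +
        x (Fin.succ 2) • rotVec x 0 1 = 0 := by
      simp only [rotVec]; module
    have e2 := congrArg (fderiv ℝ f x) e
    simp only [map_add, map_smul, map_zero, hr 1 2 (by decide), hr 2 0 (by decide),
      hr 0 1 (by decide)] at e2
    rw [← e2]
    simp only [add_mul, mul_add, smul_mul_assoc, mul_smul_comm, ← Complex.coe_smul]
    module

/-- A covariant matrix field has no bivector component. -/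
theorem trace_eq_zero_of_covariant (h : IsDiracFrame b a) (hO : IsOpen O)
    (hf : IsLorentzCovariantOn a id O f) (hc : ContinuousOn f O) {x : SpaceTime} (hx : x ∈ O)
    (i : Fin 3) :
    (a i * f x).trace = 0 ∧ (chirality a * a i * f x).trace = 0 := by
  by_cases hx0 : (fun i : Fin 3 => x i.succ) = 0
  swap
  · exact h.trace_eq_zero_of_spatial_ne_zero hf hx hx0 i
  -- A point of the time axis is approached along the first spatial axis, where the spatial part is
  -- nonzero.
  have hcx := hc.continuousAt (hO.mem_nhds hx)
  have hline : Filter.Tendsto (fun s : ℝ => x + s • unitVec 1) (nhdsWithin 0 {0}ᶜ) (nhds x) := by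
    have : Continuous fun s : ℝ => x + s • unitVec 1 := by fun_prop
    have h2 := this.tendsto 0
    simp only [zero_smul, add_zero] at h2
    exact h2.mono_left nhdsWithin_le_nhds
  have hev : ∀ᶠ s : ℝ in nhdsWithin 0 {0}ᶜ, x + s • unitVec 1 ∈ O ∧ s ≠ 0 :=
    (hline.eventually (hO.mem_nhds hx)).and self_mem_nhdsWithin
  have hev2 : ∀ᶠ s : ℝ in nhdsWithin 0 {0}ᶜ, (a i * f (x + s • unitVec 1)).trace = 0 ∧
      (chirality a * a i * f (x + s • unitVec 1)).trace = 0 := by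
    filter_upwards [hev] with s hs
    refine h.trace_eq_zero_of_spatial_ne_zero hf hs.1 ?_ i
    intro h0
    have h1 := congrFun h0 0
    have h2 := congrFun hx0 0
    simp only [Fin.succ_zero_eq_one, Pi.zero_apply, Pi.add_apply, Pi.smul_apply, Pi.single_eq_same,
      smul_eq_mul, mul_one] at h1 h2
    rw [h2, zero_add] at h1
    exact hs.2 h1
  have lim : ∀ M : Mat4, (∀ᶠ s : ℝ in nhdsWithin 0 {0}ᶜ, (M * f (x + s • unitVec 1)).trace = 0) →
      (M * f x).trace = 0 := by
    intro M hM
    have hcont : Continuous fun X : Mat4 => (M * X).trace := by fun_prop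
    have h1 := (hcont.tendsto (f x)).comp (hcx.tendsto.comp hline)
    exact tendsto_nhds_unique (h1.congr' hM) tendsto_const_nhds
  exact ⟨lim _ (hev2.mono fun s hs => hs.1), lim _ (hev2.mono fun s hs => hs.2)⟩

end IsDiracFrame

/-- A function with vanishing partial derivative in direction `e` is invariant under small
translations in this direction. -/
theorem eventually_translation_eq {E F : Type*} [NormedAddCommGroup E] [NormedSpace ℝ E]
    [NormedAddCommGroup F] [NormedSpace ℝ F] {O : Set E} (hO : IsOpen O) {f : E → F}
    (hf : DifferentiableOn ℝ f O) {e : E} (he : ∀ x ∈ O, fderiv ℝ f x e = 0) {x : E}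
    (hx : x ∈ O) :
    ∀ᶠ s : ℝ in nhds 0, ∀ᶠ y in nhds x, f (y + s • e) = f y := by
  obtain ⟨r, hr, hball⟩ := Metric.isOpen_iff.mp hO x hx
  have h1 : ∀ᶠ s : ℝ in nhds 0, |s| * ‖e‖ < r / 2 := by
    have hc : Continuous fun s : ℝ => |s| * ‖e‖ := by fun_prop
    exact (hc.tendsto 0).eventually (gt_mem_nhds (by simpa using hr))
  filter_upwards [h1] with s hs
  filter_upwards [Metric.ball_mem_nhds x (half_pos hr)] with y hy
  have hmem : ∀ t ∈ Set.Icc (0 : ℝ) 1, y + (t * s) • e ∈ O := by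
    intro t ht
    refine hball ?_
    rw [Metric.mem_ball, dist_eq_norm] at hy ⊢
    calc ‖y + (t * s) • e - x‖ = ‖(y - x) + (t * s) • e‖ := by congr 1; abel
      _ ≤ ‖y - x‖ + |t * s| * ‖e‖ := (norm_add_le _ _).trans (by rw [norm_smul, Real.norm_eq_abs])
      _ ≤ ‖y - x‖ + |s| * ‖e‖ := by
        have : |t * s| ≤ |s| := by
          rw [abs_mul, abs_of_nonneg ht.1]
          exact mul_le_of_le_one_left (abs_nonneg _) ht.2
        gcongr
      _ < r := by linarith
  have hder : ∀ t ∈ Set.Icc (0 : ℝ) 1, HasDerivAt (fun t : ℝ => f (y + (t * s) • e)) 0 t := by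
    intro t ht
    have hf1 := ((hf _ (hmem t ht)).differentiableAt (hO.mem_nhds (hmem t ht))).hasFDerivAt
    have hl : HasDerivAt (fun t : ℝ => y + (t * s) • e) (s • e) t := by
      have := (((hasDerivAt_id t).mul_const s).smul_const e).const_add y
      simpa using this
    have := hf1.comp_hasDerivAt t hl
    rwa [map_smul, he _ (hmem t ht), smul_zero] at this
  have := constant_of_has_deriv_right_zero (f := fun t : ℝ => f (y + (t * s) • e)) (a := 0) (b := 1)
    (fun t ht => (hder t ht).continuousAt.continuousWithinAt)
    (fun t ht => (hder t ⟨ht.1, ht.2.le⟩).hasDerivWithinAt) 1 (by simp)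
  simpa using this

theorem fderiv_eq_zero_of_unitVec {F : Type*} [NormedAddCommGroup F] [NormedSpace ℝ F]
    {L : SpaceTime →L[ℝ] F} (h0 : L (unitVec 0) = 0) (hs : ∀ i : Fin 3, L (unitVec i.succ) = 0) :
    L = 0 := by
  ext x
  rw [show x = ∑ μ, x μ • unitVec μ from by
    simpa [Pi.basisFun_apply] using ((Pi.basisFun ℝ (Fin 4)).sum_repr x).symm]
  rw [Fin.sum_univ_succ, map_add, map_sum]
  simp [h0, hs]

/-- A covariant matrix field that is constant in space is constant. -/
theorem IsLorentzCovariantOn.fderiv_eq_zero {a : Fin 3 → Mat4} {O : Set SpaceTime}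
    {f : SpaceTime → Mat4} (hcov : IsLorentzCovariantOn a id O f) (hO : IsOpen O)
    (hf : DifferentiableOn ℝ f O) (hs : ∀ x ∈ O, ∀ i : Fin 3, fderiv ℝ f x (unitVec i.succ) = 0)
    {x : SpaceTime} (hx : x ∈ O) : fderiv ℝ f x = 0 := by
  refine fderiv_eq_zero_of_unitVec ?_ (hs x hx)
  have hev := eventually_translation_eq hO hf (e := unitVec (Fin.succ 0))
    (fun y hy => hs y hy 0) hx
  have hev2 : ∀ᶠ s : ℝ in nhds 0, x + s • unitVec (Fin.succ 0) ∈ O := by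
    have : Continuous fun s : ℝ => x + s • unitVec (Fin.succ 0) := by fun_prop
    have h2 := this.tendsto 0
    simp only [zero_smul, add_zero] at h2
    exact h2.eventually (hO.mem_nhds hx)
  obtain ⟨s, ⟨hs1, hs2⟩, hs0⟩ := (((hev.and hev2).filter_mono nhdsWithin_le_nhds).and
    (self_mem_nhdsWithin (a := (0 : ℝ)) (s := {0}ᶜ))).exists
  have hs0 : s ≠ 0 := hs0
  set z := x + s • unitVec (Fin.succ 0) with hz
  have hfz : f z = f x := hs1.self_of_nhds
  have hd : fderiv ℝ f z = fderiv ℝ f x := by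
    have := Filter.EventuallyEq.fderiv_eq (𝕜 := ℝ) (f₁ := fun y => f (y + s • unitVec (Fin.succ 0)))
      (f := f) hs1
    exact (fderiv_comp_add_right _).symm.trans this
  -- Since f is constant in space, the boost gives x₁ ∂₀f = ½[α₁, f] at x, and the same with x₁ + s
  -- in place of x₁ at z, where f and ∂₀f are unchanged. Subtraction leaves s ∂₀f = 0.
  have b1 := (hcov x hx).1 0
  have b2 := (hcov z hs2).1 0
  have hz0 : z 0 = x 0 := by simp [hz]
  have hz1 : z (Fin.succ 0) = x (Fin.succ 0) + s := by simp [hz]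
  simp only [boostVec, map_add, map_smul, hs x hx, smul_zero, add_zero] at b1
  rw [hd, hfz, boostVec, hz0, hz1, map_add, map_smul, map_smul, hs x hx, smul_zero, add_zero,
    ← b1, add_smul, add_eq_left] at b2
  exact (smul_eq_zero.mp b2).resolve_left hs0

/-! ### Compatible covariant potentials are locally constant. -/

/-- The action of a spin generator on the spins of both particles. -/
def totalSpin (M : Mat4) : SpinMatrix := M ⊗ₖ (1 : Mat4) + (1 : Mat4) ⊗ₖ M

theorem swapSpin_totalSpin (M : Mat4) : swapSpin (totalSpin M) = totalSpin M := by
  rw [totalSpin, map_add, swapSpin_kronecker, swapSpin_kronecker, add_comm]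

/-- A real-linear map between matrix spaces commutes with differentiation. -/
theorem fderiv_linearMap_comp {E F G : Type*} [NormedAddCommGroup E] [NormedSpace ℝ E]
    [NormedAddCommGroup F] [NormedSpace ℝ F] [FiniteDimensional ℝ F]
    [NormedAddCommGroup G] [NormedSpace ℝ G] (L : F →ₗ[ℝ] G) {f : E → F} {x : E}
    (hf : DifferentiableAt ℝ f x) (d : E) :
    fderiv ℝ (fun y => L (f y)) x d = L (fderiv ℝ f x d) := by
  have := ((LinearMap.toContinuousLinearMap L).hasFDerivAt.comp x hf.hasFDerivAt).fderiv
  exact congrArg (fun T => T d) this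

theorem contDiffOn_linearMap_comp {E F G : Type*} [NormedAddCommGroup E] [NormedSpace ℝ E]
    [NormedAddCommGroup F] [NormedSpace ℝ F] [FiniteDimensional ℝ F]
    [NormedAddCommGroup G] [NormedSpace ℝ G] (L : F →ₗ[ℝ] G) {f : E → F} {s : Set E} {n : ℕ∞ω}
    (hf : ContDiffOn ℝ n f s) : ContDiffOn ℝ n (fun y => L (f y)) s :=
  (LinearMap.toContinuousLinearMap L).contDiff.comp_contDiffOn hf

theorem fderiv_matrixMap_comp {n m : Type*} [Fintype n] [DecidableEq n] [Fintype m]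
    [DecidableEq m] (L : Matrix n n ℂ →ₗ[ℝ] Matrix m m ℂ) {f : SpaceTime → Matrix n n ℂ}
    {x : SpaceTime} (hf : DifferentiableAt ℝ f x) (d : SpaceTime) :
    fderiv ℝ (fun y => L (f y)) x d = L (fderiv ℝ f x d) :=
  fderiv_linearMap_comp L hf d

theorem fderiv_matrix_add {n : Type*} [Fintype n] [DecidableEq n] {E : Type*}
    [NormedAddCommGroup E] [NormedSpace ℝ E] {f g : E → Matrix n n ℂ}
    {x : E} (hf : DifferentiableAt ℝ f x) (hg : DifferentiableAt ℝ g x) (d : E) :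
    fderiv ℝ (fun y => f y + g y) x d = fderiv ℝ f x d + fderiv ℝ g x d :=
  congrArg (fun T => T d) (fderiv_fun_add hf hg)

/-- `X ↦ N ⊗ X` as a linear map. -/
def kroneckerLeft (N : Mat4) : Mat4 →ₗ[ℝ] SpinMatrix where
  toFun X := N ⊗ₖ X
  map_add' _ _ := Matrix.kronecker_add _ _ _
  map_smul' _ _ := Matrix.kronecker_smul _ _ _

namespace IsDiracFrame

variable {b : Mat4} {a : Fin 3 → Mat4} {O : Set SpaceTime}

/-- A covariant field with values in the commutant of the `αᵢ ⊗ 1` has covariant components. -/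
theorem exists_fields (h : IsDiracFrame b a) (hO : IsOpen O) {w : SpaceTime → SpinMatrix}
    (hw : ContDiffOn ℝ 1 w O) (hc : ∀ x ∈ O, ∀ i, Commute (w x) (a i ⊗ₖ (1 : Mat4)))
    (hcov : IsLorentzCovariantOn a totalSpin O w) :
    ∃ A B : SpaceTime → Mat4, (ContDiffOn ℝ 1 A O ∧ ContDiffOn ℝ 1 B O) ∧
      (IsLorentzCovariantOn a id O A ∧ IsLorentzCovariantOn a id O B) ∧
      ∀ x ∈ O, w x = (1 : Mat4) ⊗ₖ A x + chirality a ⊗ₖ B x ∧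
        ∀ d, fderiv ℝ w x d = (1 : Mat4) ⊗ₖ fderiv ℝ A x d + chirality a ⊗ₖ fderiv ℝ B x d := by
  -- As tr 1 = 4, tr ω = 0 and tr ω² = -4, these partial traces read off the components A and B.
  set LA : SpinMatrix →ₗ[ℝ] Mat4 := ((1 / 4 : ℂ) • partialTrace 1).restrictScalars ℝ with hLA
  set LB : SpinMatrix →ₗ[ℝ] Mat4 :=
    ((-(1 / 4) : ℂ) • partialTrace (chirality a)).restrictScalars ℝ with hLB
  have eA : ∀ X Y : Mat4, LA ((1 : Mat4) ⊗ₖ X + chirality a ⊗ₖ Y) = X := by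
    intro X Y
    simp only [hLA, LinearMap.restrictScalars_apply, LinearMap.smul_apply, map_add,
      partialTrace_kronecker, one_mul, h.trace_chirality, zero_smul, add_zero, Matrix.trace_one,
      Fintype.card_fin, smul_smul]
    norm_num
  have eB : ∀ X Y : Mat4, LB ((1 : Mat4) ⊗ₖ X + chirality a ⊗ₖ Y) = Y := by
    intro X Y
    simp only [hLB, LinearMap.restrictScalars_apply, LinearMap.smul_apply, map_add,
      partialTrace_kronecker, mul_one, h.trace_chirality, zero_smul, zero_add, h.chirality_sq,
      Matrix.trace_neg, Matrix.trace_one, Fintype.card_fin, smul_smul]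
    norm_num
  have hdec : ∀ x ∈ O, w x = (1 : Mat4) ⊗ₖ LA (w x) + chirality a ⊗ₖ LB (w x) := by
    intro x hx
    obtain ⟨X, Y, hXY⟩ := h.exists_decomposition (hc x hx)
    rw [hXY, eA, eB]
  have hdiff : ∀ x ∈ O, DifferentiableAt ℝ w x := fun x hx =>
    (hw.differentiableOn one_ne_zero).differentiableAt (hO.mem_nhds hx)
  have dA := fun x (hx : x ∈ O) d => fderiv_matrixMap_comp LA (hdiff x hx) d
  have dB := fun x (hx : x ∈ O) d => fderiv_matrixMap_comp LB (hdiff x hx) d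
  have hcA := contDiffOn_linearMap_comp LA hw
  have hcB := contDiffOn_linearMap_comp LB hw
  -- Spin generators commute with ω, so their action on the first spin drops out of the commutator
  -- and only the action on A and B remains.
  have hgen : ∀ M X Y : Mat4, M * chirality a = chirality a * M →
      (1 / 2 : ℂ) • (totalSpin M * ((1 : Mat4) ⊗ₖ X + chirality a ⊗ₖ Y) -
        ((1 : Mat4) ⊗ₖ X + chirality a ⊗ₖ Y) * totalSpin M) =
      (1 : Mat4) ⊗ₖ ((1 / 2 : ℂ) • (M * X - X * M)) +
        chirality a ⊗ₖ ((1 / 2 : ℂ) • (M * Y - Y * M)) := by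
    intro M X Y hM
    have ks : ∀ N X Y : Mat4, N ⊗ₖ (X - Y) = N ⊗ₖ X - N ⊗ₖ Y := fun N X Y =>
      map_sub (kroneckerLeft N) X Y
    simp only [totalSpin, add_mul, mul_add, ← Matrix.mul_kronecker_mul, one_mul, mul_one, hM,
      Matrix.kronecker_smul, ks]
    module
  have hsig : ∀ i j, a i * a j * chirality a = chirality a * (a i * a j) := fun i j => by
    rw [mul_assoc, h.alpha_mul_chirality, ← mul_assoc, h.alpha_mul_chirality, mul_assoc]
  refine ⟨fun x => LA (w x), fun x => LB (w x), ⟨hcA, hcB⟩, ⟨?_, ?_⟩, fun x hx => ⟨hdec x hx, ?_⟩⟩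
  · intro x hx
    obtain ⟨h1, h2⟩ := hcov x hx
    refine ⟨fun i => ?_, fun i j hij => ?_⟩
    · rw [dA x hx, h1, hdec x hx, hgen _ _ _ (h.alpha_mul_chirality i), eA]; rfl
    · rw [dA x hx, h2 i j hij, hdec x hx, hgen _ _ _ (hsig i j), eA]; rfl
  · intro x hx
    obtain ⟨h1, h2⟩ := hcov x hx
    refine ⟨fun i => ?_, fun i j hij => ?_⟩
    · rw [dB x hx, h1, hdec x hx, hgen _ _ _ (h.alpha_mul_chirality i), eB]; rfl
    · rw [dB x hx, h2 i j hij, hdec x hx, hgen _ _ _ (hsig i j), eB]; rfl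
  · intro d
    have hA' := (hcA.differentiableOn one_ne_zero).differentiableAt (hO.mem_nhds hx)
    have hB' := (hcB.differentiableOn one_ne_zero).differentiableAt (hO.mem_nhds hx)
    have hev : w =ᶠ[nhds x] fun y =>
        kroneckerLeft 1 (LA (w y)) + kroneckerLeft (chirality a) (LB (w y)) := by
      filter_upwards [hO.mem_nhds hx] with y hy using hdec y hy
    have k1 := contDiffOn_linearMap_comp (kroneckerLeft 1) hcA
    have k2 := contDiffOn_linearMap_comp (kroneckerLeft (chirality a)) hcB
    rw [hev.fderiv_eq, fderiv_matrix_add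
      ((k1.differentiableOn one_ne_zero).differentiableAt (hO.mem_nhds hx))
      ((k2.differentiableOn one_ne_zero).differentiableAt (hO.mem_nhds hx)),
      fderiv_matrixMap_comp _ hA', fderiv_matrixMap_comp _ hB']
    rfl

/-- The vanishing of bivector components is a linear condition on an open set and hence passes to
derivatives. -/
theorem fderiv_trace_eq_zero (h : IsDiracFrame b a) (hO : IsOpen O) {f : SpaceTime → Mat4}
    (hf : ContDiffOn ℝ 1 f O) (hcov : IsLorentzCovariantOn a id O f) {x : SpaceTime} (hx : x ∈ O)
    (i : Fin 3) (d : SpaceTime) :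
    (a i * fderiv ℝ f x d).trace = 0 ∧ (chirality a * a i * fderiv ℝ f x d).trace = 0 := by
  have hd := (hf.differentiableOn one_ne_zero).differentiableAt (hO.mem_nhds hx)
  have key : ∀ M : Mat4, (∀ y ∈ O, (M * f y).trace = 0) → (M * fderiv ℝ f x d).trace = 0 := by
    intro M hM
    let L : Mat4 →ₗ[ℝ] ℂ :=
      { toFun := fun X => (M * X).trace
        map_add' := fun X Y => by rw [mul_add, Matrix.trace_add]
        map_smul' := fun c X => by rw [mul_smul_comm, Matrix.trace_smul]; rfl }
    have h1 := fderiv_linearMap_comp L hd d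
    have h2 : (fun y => L (f y)) =ᶠ[nhds x] fun _ => 0 := by
      filter_upwards [hO.mem_nhds hx] with y hy using hM y hy
    rw [h2.fderiv_eq] at h1
    exact h1.symm.trans (by simp)
  exact ⟨key _ fun y hy => (h.trace_eq_zero_of_covariant hO hcov hf.continuousOn hy i).1,
    key _ fun y hy => (h.trace_eq_zero_of_covariant hO hcov hf.continuousOn hy i).2⟩

/-- Compatible, covariant potentials are locally constant. -/
theorem fderiv_eq_zero_of_compatible (h : IsDiracFrame b a) (hO : IsOpen O)
    {v w : SpaceTime → SpinMatrix} (hv : ContDiffOn ℝ 1 v O) (hw : ContDiffOn ℝ 1 w O)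
    (cv : ∀ x ∈ O, ∀ i, Commute (v x) ((1 : Mat4) ⊗ₖ a i))
    (cw : ∀ x ∈ O, ∀ i, Commute (w x) (a i ⊗ₖ (1 : Mat4)))
    (lv : IsLorentzCovariantOn a totalSpin O v) (lw : IsLorentzCovariantOn a totalSpin O w)
    {m₁ m₂ : ℂ}
    (heq : ∀ x ∈ O, Complex.I • (fderiv ℝ w x (unitVec 0) +
        ∑ i : Fin 3, (a i ⊗ₖ (1 : Mat4)) * fderiv ℝ w x (unitVec i.succ) +
        (fderiv ℝ v x (unitVec 0) +
        ∑ i : Fin 3, ((1 : Mat4) ⊗ₖ a i) * fderiv ℝ v x (unitVec i.succ))) =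
      (m₁ • (b ⊗ₖ (1 : Mat4)) + v x) * (m₂ • ((1 : Mat4) ⊗ₖ b) + w x) -
        (m₂ • ((1 : Mat4) ⊗ₖ b) + w x) * (m₁ • (b ⊗ₖ (1 : Mat4)) + v x))
    {x : SpaceTime} (hx : x ∈ O) : fderiv ℝ v x = 0 ∧ fderiv ℝ w x = 0 := by
  set sw : SpinMatrix →ₗ[ℝ] SpinMatrix := swapSpin.toLinearMap.restrictScalars ℝ with hsw
  have swa : ∀ X, sw X = swapSpin X := fun _ => rfl
  have hdv : ∀ y ∈ O, DifferentiableAt ℝ v y := fun y hy =>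
    (hv.differentiableOn one_ne_zero).differentiableAt (hO.mem_nhds hy)
  obtain ⟨A, B, ⟨hA, hB⟩, ⟨lA, lB⟩, hAB⟩ := h.exists_fields hO hw cw lw
  -- Exchanging the spin factors makes v a field of the same type as w, because `totalSpin` is
  -- symmetric.
  obtain ⟨C, D, ⟨hC, hD⟩, ⟨lC, lD⟩, hCD⟩ := h.exists_fields hO
    (w := fun y => sw (v y)) (contDiffOn_linearMap_comp sw hv)
    (fun y hy i => by
      have := (cv y hy i).map swapSpin
      rwa [swapSpin_kronecker] at this)
    (by
      intro y hy
      obtain ⟨h1, h2⟩ := lv y hy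
      refine ⟨fun i => ?_, fun i j hij => ?_⟩
      · rw [fderiv_matrixMap_comp sw (hdv y hy), h1, swa, map_smul, map_sub, map_mul, map_mul,
          swapSpin_totalSpin]; rfl
      · rw [fderiv_matrixMap_comp sw (hdv y hy), h2 i j hij, swa, map_smul, map_sub, map_mul,
          map_mul, swapSpin_totalSpin]; rfl)
  have swsw : ∀ X, swapSpin (swapSpin X) = X := fun X => by
    ext ⟨i, j⟩ ⟨k, l⟩; simp [swapSpin]
  have hv' : ∀ y ∈ O, v y = C y ⊗ₖ (1 : Mat4) + D y ⊗ₖ chirality a := by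
    intro y hy
    have := congrArg swapSpin (hCD y hy).1
    rwa [swa, swsw, map_add, swapSpin_kronecker, swapSpin_kronecker] at this
  have dv' : ∀ y ∈ O, ∀ d, fderiv ℝ v y d =
      fderiv ℝ C y d ⊗ₖ (1 : Mat4) + fderiv ℝ D y d ⊗ₖ chirality a := by
    intro y hy d
    have := congrArg swapSpin ((hCD y hy).2 d)
    rwa [fderiv_matrixMap_comp sw (hdv y hy), swa, swsw, map_add, swapSpin_kronecker,
      swapSpin_kronecker] at this
  have hspace1 : ∀ y ∈ O, ∀ i : Fin 3,
      fderiv ℝ A y (unitVec i.succ) = 0 ∧ fderiv ℝ B y (unitVec i.succ) = 0 := by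
    intro y hy i
    refine h.spatial_derivatives_eq_zero (A := A y) (B := B y) (C := C y) (D := D y)
      (A' := fun μ => fderiv ℝ A y (unitVec μ)) (B' := fun μ => fderiv ℝ B y (unitVec μ))
      (C' := fun μ => fderiv ℝ C y (unitVec μ)) (D' := fun μ => fderiv ℝ D y (unitVec μ))
      (m₁ := m₁) (m₂ := m₂) (κ := 1)
      (fun i μ => h.fderiv_trace_eq_zero hO hC lC hy i _)
      (fun i μ => h.fderiv_trace_eq_zero hO hD lD hy i _)
      (fun i => h.trace_eq_zero_of_covariant hO lD hD.continuousOn hy i) ?_ i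
    have := heq y hy
    simp only [(hAB y hy).2, dv' y hy, (hAB y hy).1, hv' y hy] at this
    rw [one_smul]
    exact this
  have hspace2 : ∀ y ∈ O, ∀ i : Fin 3,
      fderiv ℝ C y (unitVec i.succ) = 0 ∧ fderiv ℝ D y (unitVec i.succ) = 0 := by
    intro y hy i
    -- The exchange of the particles interchanges the masses and reverses the commutator, whence κ =
    -- -1.
    refine h.spatial_derivatives_eq_zero (A := C y) (B := D y) (C := A y) (D := B y)
      (A' := fun μ => fderiv ℝ C y (unitVec μ)) (B' := fun μ => fderiv ℝ D y (unitVec μ))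
      (C' := fun μ => fderiv ℝ A y (unitVec μ)) (D' := fun μ => fderiv ℝ B y (unitVec μ))
      (m₁ := m₂) (m₂ := m₁) (κ := -1)
      (fun i μ => h.fderiv_trace_eq_zero hO hA lA hy i _)
      (fun i μ => h.fderiv_trace_eq_zero hO hB lB hy i _)
      (fun i => h.trace_eq_zero_of_covariant hO lB hB.continuousOn hy i) ?_ i
    have := congrArg swapSpin (heq y hy)
    simp only [(hAB y hy).2, dv' y hy, (hAB y hy).1, hv' y hy, map_smul, map_add, map_sub, map_mul,
      map_sum, swapSpin_kronecker] at this
    rw [neg_one_smul, neg_sub, ← this]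
    module
  have fA := lA.fderiv_eq_zero hO (hA.differentiableOn one_ne_zero) (fun y hy i => (hspace1 y hy i).1) hx
  have fB := lB.fderiv_eq_zero hO (hB.differentiableOn one_ne_zero) (fun y hy i => (hspace1 y hy i).2) hx
  have fC := lC.fderiv_eq_zero hO (hC.differentiableOn one_ne_zero) (fun y hy i => (hspace2 y hy i).1) hx
  have fD := lD.fderiv_eq_zero hO (hD.differentiableOn one_ne_zero) (fun y hy i => (hspace2 y hy i).2) hx
  constructor
  · ext1 d
    rw [dv' x hx, fC, fD]
    simp
  · ext1 d
    rw [(hAB x hx).2, fA, fB]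
    simp

end IsDiracFrame

/-! ### Poincaré invariance and its infinitesimal form. -/

theorem slash_add (γ : Fin 4 → Mat4) (v w : SpaceTime) :
    slash γ (v + w) = slash γ v + slash γ w := by
  simp only [slash, Pi.add_apply, mul_add, Complex.ofReal_add, add_smul, Finset.sum_add_distrib]

theorem slash_smul (γ : Fin 4 → Mat4) (r : ℝ) (v : SpaceTime) :
    slash γ (r • v) = (r : ℂ) • slash γ v := by
  simp only [slash, Pi.smul_apply, smul_eq_mul, Finset.smul_sum, smul_smul]
  refine Finset.sum_congr rfl fun μ _ => ?_
  push_cast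
  congr 1
  ring

theorem slash_eq (γ : Fin 4 → Mat4) (v : SpaceTime) :
    slash γ v = ((v 0 : ℝ) : ℂ) • γ 0 - ∑ i : Fin 3, ((v i.succ : ℝ) : ℂ) • γ i.succ := by
  have h2 : ∀ i : Fin 3, ((![1, -1, -1, -1] : Fin 4 → ℝ) i.succ) = -1 := fun i => by
    fin_cases i <;> rfl
  rw [slash, Fin.sum_univ_succ, sub_eq_add_neg, ← Finset.sum_neg_distrib]
  simp [minkowski, h2]

theorem IsGammaRep.slash_eq_beta_mul {γ : Fin 4 → Mat4} (hγ : IsGammaRep γ) (v : SpaceTime) :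
    slash γ v = ((v 0 : ℝ) : ℂ) • γ 0 -
      ∑ i : Fin 3, ((v i.succ : ℝ) : ℂ) • (γ 0 * (γ 0 * γ i.succ)) := by
  simp only [slash_eq, ← mul_assoc, hγ.isDiracFrame.sq_beta, one_mul]

/-- A Poincaré invariant potential is covariant for each matrix that intertwines the `γ^μ`. -/
theorem IsPoincareInvariant.mul_kronecker {γ : Fin 4 → Mat4} (hγ : IsGammaRep γ)
    {Ω : Set Config} {W : Config → SpinMatrix} (hW : IsPoincareInvariant γ Ω W)
    {Λ : Matrix (Fin 4) (Fin 4) ℝ} (hΛ : IsProperLorentz Λ) {T T' : Mat4} (h1 : T * T' = 1)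
    (h2 : T' * T = 1) (hT : ∀ v, T * slash γ v = slash γ (Λ.mulVec v) * T) (c : SpaceTime)
    {X : Config} (hX : X ∈ Ω) :
    W X * (T ⊗ₖ T) = (T ⊗ₖ T) * W (fun k => Λ⁻¹.mulVec (X k - c)) := by
  obtain ⟨S, hS, hWS⟩ := hW Λ hΛ
  have hS2 : ∀ v, (S : Mat4) * slash γ v = slash γ (Λ.mulVec v) * S := fun v => by
    rw [← hS v, mul_assoc, Units.inv_mul, mul_one]
  have hcomm : ∀ v, Commute (T' * (S : Mat4)) (slash γ v) := fun v => by
    have e : T' * slash γ (Λ.mulVec v) = slash γ v * T' := by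
      have := congrArg (fun M => T' * M * T') (hT v)
      simp only [mul_assoc, h1, mul_one] at this
      rw [← mul_assoc T' T, h2, one_mul] at this
      exact this.symm
    change T' * (S : Mat4) * slash γ v = slash γ v * (T' * S)
    rw [mul_assoc, hS2, ← mul_assoc, e, mul_assoc]
  have hγc : ∀ μ, Commute (T' * (S : Mat4)) (γ μ) := by
    intro μ
    refine Fin.cases ?_ (fun i => ?_) μ
    · have := hcomm (unitVec 0)
      rw [slash_eq] at this
      simpa [Pi.single_apply, Fin.succ_ne_zero] using this
    · have := hcomm (unitVec i.succ)
      rw [slash_eq] at this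
      simpa [Pi.single_apply, Fin.succ_ne_zero, (Fin.succ_ne_zero _).symm] using this
  -- T⁻¹S commutes with all γ^μ, so by Schur's lemma S = zT; the factor z² then cancels from the
  -- covariance relation.
  obtain ⟨z, hz⟩ := hγ.isDiracFrame.eq_smul_one (hγc 0) (fun i => (hγc 0).mul_right (hγc i.succ))
  have hSz : (S : Mat4) = z • T := by
    rw [← one_mul (S : Mat4), ← h1, mul_assoc, hz, mul_smul_comm, mul_one]
  have hz0 : z ≠ 0 := by
    rintro rfl
    rw [zero_smul] at hSz
    have := S.mul_inv
    rw [hSz, zero_mul] at this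
    exact zero_ne_one this
  have hinv : (((S⁻¹ : Mat4ˣ) : Mat4) ⊗ₖ ((S⁻¹ : Mat4ˣ) : Mat4)) * ((S : Mat4) ⊗ₖ (S : Mat4)) =
      1 := by
    rw [← Matrix.mul_kronecker_mul, Units.inv_mul, Matrix.one_kronecker_one]
  have := congrArg (fun M => M * ((S : Mat4) ⊗ₖ (S : Mat4))) (hWS c X hX)
  simp only [mul_assoc, hinv, mul_one] at this
  rw [hSz, Matrix.smul_kronecker, Matrix.kronecker_smul, smul_smul, mul_smul_comm,
    smul_mul_assoc] at this
  exact smul_right_injective _ (mul_ne_zero hz0 hz0) this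

theorem isProperLorentz_one : IsProperLorentz 1 :=
  ⟨by simp, by simp, by simp⟩

theorem IsPoincareInvariant.translation {γ : Fin 4 → Mat4} (hγ : IsGammaRep γ)
    {Ω : Set Config} {W : Config → SpinMatrix} (hW : IsPoincareInvariant γ Ω W)
    (c : SpaceTime) {X : Config} (hX : X ∈ Ω) : W X = W (fun k => X k - c) := by
  have := hW.mul_kronecker hγ isProperLorentz_one (T := 1) (T' := 1) (by simp) (by simp)
    (by simp) c hX
  simpa using this

/-- The Cayley transform `(1 + τ G) (1 - τ G)⁻¹` for `G³ = σ G`. -/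
def cayley (σ : ℝ) (G : Matrix (Fin 4) (Fin 4) ℝ) (τ : ℝ) : Matrix (Fin 4) (Fin 4) ℝ :=
  1 + (2 * τ / (1 - σ * τ ^ 2)) • G + (τ * (2 * τ / (1 - σ * τ ^ 2))) • (G * G)

/-- Moving the metric past the transpose replaces G by -G. The transposed Cayley transform thus
becomes the one with parameter -τ, the inverse. -/
theorem cayley_isometry {σ : ℝ} {G : Matrix (Fin 4) (Fin 4) ℝ} (hG : G * (G * G) = σ • G)
    (hη : G.transpose * minkowski = -(minkowski * G)) {τ : ℝ} (hτ : 1 - σ * τ ^ 2 ≠ 0) :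
    (cayley σ G τ).transpose * minkowski * cayley σ G τ = minkowski := by
  set s := 2 * τ / (1 - σ * τ ^ 2) with hs
  have hs2 : s * (1 - σ * τ ^ 2) = 2 * τ := div_mul_cancel₀ _ hτ
  have h1 : (cayley σ G τ).transpose * minkowski =
      minkowski * (1 - s • G + (τ * s) • (G * G)) := by
    simp only [cayley, ← hs, Matrix.transpose_add, Matrix.transpose_smul, Matrix.transpose_mul,
      Matrix.transpose_one, add_mul, smul_mul_assoc, one_mul, mul_assoc, hη, mul_neg]
    rw [← mul_assoc G.transpose, hη]
    simp only [mul_add, mul_sub, mul_smul_comm, mul_one, neg_mul, neg_neg, smul_neg, mul_assoc]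
    module
  rw [h1, mul_assoc]
  have h2 : (1 - s • G + (τ * s) • (G * G)) * cayley σ G τ = 1 := by
    simp only [cayley, ← hs, mul_add, add_mul, sub_mul, mul_sub, smul_mul_assoc, mul_smul_comm,
      one_mul, mul_one, mul_assoc, hG]
    match_scalars
    · ring
    · ring
    · linear_combination (-s) * hs2
  rw [h2, mul_one]

theorem continuousAt_cayley (σ : ℝ) (G : Matrix (Fin 4) (Fin 4) ℝ) :
    ContinuousAt (cayley σ G) 0 := by
  unfold cayley
  have h : ContinuousAt (fun τ : ℝ => 2 * τ / (1 - σ * τ ^ 2)) 0 :=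
    ContinuousAt.div (by fun_prop) (by fun_prop) (by simp)
  have h2 : ContinuousAt (fun τ : ℝ => τ * (2 * τ / (1 - σ * τ ^ 2))) 0 := continuousAt_id.mul h
  exact (continuousAt_const.add (h.smul continuousAt_const)).add (h2.smul continuousAt_const)

theorem eventually_ne_zero_cayley (σ : ℝ) : ∀ᶠ τ : ℝ in nhds 0, 1 - σ * τ ^ 2 ≠ 0 := by
  have h : ContinuousAt (fun τ : ℝ => 1 - σ * τ ^ 2) 0 := by fun_prop
  exact h.eventually_ne (by simp)

/-- An isometry has determinant ±1. Near τ = 0 continuity from the identity selects the sign + and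
keeps the time component positive. -/
theorem eventually_isProperLorentz_cayley {σ : ℝ} {G : Matrix (Fin 4) (Fin 4) ℝ}
    (hG : G * (G * G) = σ • G) (hη : G.transpose * minkowski = -(minkowski * G)) :
    ∀ᶠ τ : ℝ in nhds 0, IsProperLorentz (cayley σ G τ) := by
  have hc := continuousAt_cayley σ G
  have h0 : cayley σ G 0 = 1 := by simp [cayley]
  have hdet : ContinuousAt (fun τ => (cayley σ G τ).det) 0 :=
    (Continuous.matrix_det continuous_id).continuousAt.comp hc
  have h00 : ContinuousAt (fun τ => cayley σ G τ 0 0) 0 :=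
    (Continuous.matrix_elem continuous_id 0 0).continuousAt.comp hc
  filter_upwards [eventually_ne_zero_cayley σ,
    hdet.eventually (lt_mem_nhds (show (0 : ℝ) < (cayley σ G 0).det by rw [h0]; simp)),
    h00.eventually (lt_mem_nhds (show (0 : ℝ) < cayley σ G 0 0 0 by rw [h0]; simp))] with τ h1 h2 h3
  have hiso := cayley_isometry hG hη h1
  refine ⟨hiso, ?_, h3⟩
  have hd := congrArg Matrix.det hiso
  have hm : minkowski.det ≠ 0 := by
    simp [minkowski, Matrix.det_diagonal, Fin.prod_univ_succ]
  rw [Matrix.det_mul, Matrix.det_mul, Matrix.det_transpose] at hd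
  have h4 : (cayley σ G τ).det ^ 2 = 1 := by
    apply mul_left_cancel₀ hm
    linear_combination hd
  nlinarith

/-- The spin transformation `1 + τ g` of the Lorentz transformation `cayley σ G τ`. -/
theorem cayley_intertwines {γ : Fin 4 → Mat4} {σ : ℝ} {G : Matrix (Fin 4) (Fin 4) ℝ} {g : Mat4}
    (hg : g * g = (σ : ℂ) • (1 : Mat4))
    (hgG : ∀ v, g * slash γ v - slash γ v * g = (2 : ℂ) • slash γ (G.mulVec v)) {τ : ℝ}
    (hτ : 1 - σ * τ ^ 2 ≠ 0) (v : SpaceTime) :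
    (1 + (τ : ℂ) • g) * slash γ v = slash γ ((cayley σ G τ).mulVec v) * (1 + (τ : ℂ) • g) := by
  set s := 2 * τ / (1 - σ * τ ^ 2) with hs
  have hs2 : s * (1 - σ * τ ^ 2) = 2 * τ := div_mul_cancel₀ _ hτ
  have hs3 : (s : ℂ) * (1 - σ * τ ^ 2) = 2 * τ := by exact_mod_cast hs2
  -- The commutator with g represents 2G. Everything is thereby expressed through g, and g² = σ
  -- reduces the claim to scalar identities for s and τ.
  have half : ∀ v, slash γ (G.mulVec v) = (1 / 2 : ℂ) • (g * slash γ v - slash γ v * g) :=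
    fun v => by rw [hgG]; module
  have hΛ : slash γ ((cayley σ G τ).mulVec v) = slash γ v + (s : ℂ) • slash γ (G.mulVec v) +
      ((τ * s : ℝ) : ℂ) • slash γ (G.mulVec (G.mulVec v)) := by
    rw [cayley, Matrix.add_mulVec, Matrix.add_mulVec, Matrix.one_mulVec, Matrix.smul_mulVec,
      Matrix.smul_mulVec, slash_add, slash_add, slash_smul, slash_smul, ← Matrix.mulVec_mulVec]
  have hgx : ∀ x, g * (g * x) = (σ : ℂ) • x := fun x => by
    rw [← mul_assoc, hg, smul_mul_assoc, one_mul]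
  rw [hΛ, half (G.mulVec v), half v]
  simp only [mul_add, add_mul, mul_sub, sub_mul, smul_mul_assoc, mul_smul_comm, one_mul, mul_one,
    mul_assoc, hg, hgx]
  push_cast
  match_scalars
  · ring
  · linear_combination (-(1 / 2) : ℂ) * hs3
  · linear_combination (1 / 2 : ℂ) * hs3
  · ring

theorem hasDerivAt_cayley (σ : ℝ) (G : Matrix (Fin 4) (Fin 4) ℝ) (x : SpaceTime) :
    HasDerivAt (fun τ => (cayley σ G τ).mulVec x) ((2 : ℝ) • G.mulVec x) 0 := by
  have h1 : HasDerivAt (fun τ : ℝ => 2 * τ / (1 - σ * τ ^ 2)) 2 0 := by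
    have hn : HasDerivAt (fun τ : ℝ => 2 * τ) 2 0 := by
      simpa using (hasDerivAt_id (0 : ℝ)).const_mul 2
    have hd : HasDerivAt (fun τ : ℝ => 1 - σ * τ ^ 2) 0 0 := by
      have := ((hasDerivAt_pow 2 (0 : ℝ)).const_mul σ).const_sub 1
      simpa using this
    have := hn.fun_div hd (by simp)
    simpa using this
  have h2 : HasDerivAt (fun τ : ℝ => τ * (2 * τ / (1 - σ * τ ^ 2))) 0 0 := by
    have := (hasDerivAt_id (0 : ℝ)).fun_mul h1
    simpa using this
  have h3 := ((h1.smul_const (G.mulVec x)).const_add x).add (h2.smul_const ((G * G).mulVec x))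
  rw [zero_smul, add_zero] at h3
  refine h3.congr_of_eventuallyEq (Filter.Eventually.of_forall fun τ => ?_)
  simp only [cayley, Matrix.add_mulVec, Matrix.one_mulVec, Matrix.smul_mulVec, Pi.add_apply]

/-- The infinitesimal form of the Lorentz covariance of a potential. -/
theorem IsPoincareInvariant.fderiv_generator {γ : Fin 4 → Mat4} (hγ : IsGammaRep γ)
    {Ω : Set Config} {W : Config → SpinMatrix} (hW : IsPoincareInvariant γ Ω W)
    {D : Set SpaceTime} (hD : IsOpen D) (hDΩ : ∀ x ∈ D, ![x, 0] ∈ Ω)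
    {x : SpaceTime} (hx : x ∈ D) (hd : DifferentiableAt ℝ (fun y => W ![y, 0]) x)
    {σ : ℝ} {G : Matrix (Fin 4) (Fin 4) ℝ} {g : Mat4}
    (hG : G * (G * G) = σ • G) (hη : G.transpose * minkowski = -(minkowski * G))
    (hg : g * g = (σ : ℂ) • (1 : Mat4))
    (hgG : ∀ v, g * slash γ v - slash γ v * g = (2 : ℂ) • slash γ (G.mulVec v)) :
    fderiv ℝ (fun y => W ![y, 0]) x (G.mulVec x) =
      (1 / 2 : ℂ) • (totalSpin g * W ![x, 0] - W ![x, 0] * totalSpin g) := by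
  set w : SpaceTime → SpinMatrix := fun y => W ![y, 0] with hw
  have hc := hasDerivAt_cayley σ G x
  have h0 : (cayley σ G 0).mulVec x = x := by simp [cayley]
  have hev : ∀ᶠ τ : ℝ in nhds 0, w ((cayley σ G τ).mulVec x) *
      ((1 + (τ : ℂ) • g) ⊗ₖ (1 + (τ : ℂ) • g)) =
      ((1 + (τ : ℂ) • g) ⊗ₖ (1 + (τ : ℂ) • g)) * w x := by
    have hmem := hc.continuousAt.eventually (hD.mem_nhds (show (cayley σ G 0).mulVec x ∈ D by rw [h0]; exact hx))
    filter_upwards [hmem, eventually_isProperLorentz_cayley hG hη, eventually_ne_zero_cayley σ]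
      with τ h1 h2 h3
    have h3' : (1 - σ * τ ^ 2 : ℂ) ≠ 0 := by exact_mod_cast h3
    have hinv : (1 - (τ : ℂ) • g) * (1 + (τ : ℂ) • g) = (1 - σ * τ ^ 2 : ℂ) • (1 : Mat4) := by
      simp only [mul_add, sub_mul, smul_mul_assoc, mul_smul_comm, one_mul, mul_one, hg]
      module
    have hinv2 : (1 + (τ : ℂ) • g) * (1 - (τ : ℂ) • g) = (1 - σ * τ ^ 2 : ℂ) • (1 : Mat4) := by
      simp only [mul_sub, add_mul, smul_mul_assoc, mul_smul_comm, one_mul, mul_one, hg]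
      module
    have := hW.mul_kronecker hγ h2 (T := 1 + (τ : ℂ) • g)
      (T' := (1 - σ * τ ^ 2 : ℂ)⁻¹ • (1 - (τ : ℂ) • g))
      (by rw [mul_smul_comm, hinv2, smul_smul, inv_mul_cancel₀ h3', one_smul])
      (by rw [smul_mul_assoc, hinv, smul_smul, inv_mul_cancel₀ h3', one_smul])
      (cayley_intertwines hg hgG h3) 0 (hDΩ _ h1)
    refine this.trans ?_
    congr 2
    funext k
    have hdet : IsUnit (cayley σ G τ).det := by rw [h2.det_eq_one]; exact isUnit_one
    fin_cases k
    · simp [Matrix.mulVec_mulVec, Matrix.nonsing_inv_mul _ hdet]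
    · simp
  have hR : HasDerivAt (fun τ : ℝ => (1 + (τ : ℂ) • g) ⊗ₖ (1 + (τ : ℂ) • g)) (totalSpin g) 0 := by
    have e : (fun τ : ℝ => (1 + (τ : ℂ) • g) ⊗ₖ (1 + (τ : ℂ) • g)) =
        fun τ : ℝ => 1 + τ • totalSpin g + (τ ^ 2) • (g ⊗ₖ g) := by
      funext τ
      simp only [Matrix.add_kronecker, Matrix.kronecker_add, Matrix.smul_kronecker,
        Matrix.kronecker_smul, Matrix.one_kronecker_one, totalSpin, ← Complex.coe_smul]
      push_cast
      module
    rw [e]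
    have h1 := ((hasDerivAt_id (0 : ℝ)).smul_const (totalSpin g)).const_add (1 : SpinMatrix)
    have h2 := (hasDerivAt_pow 2 (0 : ℝ)).smul_const (g ⊗ₖ g)
    have := h1.add h2
    have e2 : (1 : ℝ) • totalSpin g + ((2 : ℕ) * (0 : ℝ) ^ (2 - 1)) • (g ⊗ₖ g) = totalSpin g := by
      simp
    rw [e2] at this
    exact this
  have hwx : HasDerivAt (fun τ => w ((cayley σ G τ).mulVec x))
      (fderiv ℝ w x ((2 : ℝ) • G.mulVec x)) 0 := by
    have hd' : HasFDerivAt w (fderiv ℝ w x) ((cayley σ G 0).mulVec x) := by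
      rw [h0]; exact hd.hasFDerivAt
    exact hd'.comp_hasDerivAt 0 hc
  -- Both sides of `hev` are differentiated at τ = 0. The curve of points has velocity 2Gx and the
  -- spin side has velocity `totalSpin g`; hence the factor ½.
  have hl := hwx.mul hR
  have hr := hR.mul_const (w x)
  have heq := (hl.congr_of_eventuallyEq (Filter.EventuallyEq.symm hev)).unique hr
  have e0 : ((1 + ((0 : ℝ) : ℂ) • g) ⊗ₖ (1 + ((0 : ℝ) : ℂ) • g)) = (1 : SpinMatrix) := by simp
  rw [h0, e0, mul_one, map_smul] at heq
  have : (2 : ℝ) • fderiv ℝ w x (G.mulVec x) =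
      totalSpin g * w x - w x * totalSpin g := eq_sub_of_add_eq heq
  rw [← this, ← Complex.coe_smul, smul_smul]
  norm_num

/-- The generator of the boosts in direction `i`. -/
def boostGen (i : Fin 3) : Matrix (Fin 4) (Fin 4) ℝ :=
  Matrix.single 0 i.succ 1 + Matrix.single i.succ 0 1

/-- The generator of the rotations in the plane of `i` and `j`. -/
def rotGen (i j : Fin 3) : Matrix (Fin 4) (Fin 4) ℝ :=
  Matrix.single i.succ j.succ 1 - Matrix.single j.succ i.succ 1

theorem boostGen_mulVec (i : Fin 3) (x : SpaceTime) :
    (boostGen i).mulVec x = boostVec x i := by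
  ext p
  simp [boostGen, boostVec, Matrix.add_mulVec, Matrix.single_mulVec, Function.update_apply,
    Pi.single_apply]

theorem rotGen_mulVec (i j : Fin 3) (x : SpaceTime) :
    (rotGen i j).mulVec x = rotVec x i j := by
  ext p
  simp [rotGen, rotVec, Matrix.sub_mulVec, Matrix.single_mulVec, Function.update_apply,
    Pi.single_apply]

/-- This identifies αᵢ as the spin generator of the boost in direction i, with bαₖ in the role of
γᵏ. The next lemma does the same for αᵢαⱼ and the rotations. -/
theorem commutator_alpha {b : Mat4} {a : Fin 3 → Mat4} (h : IsDiracFrame b a) (c₀ : ℂ)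
    (c : Fin 3 → ℂ) (i : Fin 3) :
    a i * (c₀ • b - ∑ k, c k • (b * a k)) - (c₀ • b - ∑ k, c k • (b * a k)) * a i =
      (2 : ℂ) • (c i • b - c₀ • (b * a i)) := by
  obtain ⟨⟨r1, r2, r3, r4⟩, ⟨s1, s2, s3, s4, s5, s6⟩, t1, t2, t3, t4, t5, t6⟩ := h.rules
  rw [Fin.sum_univ_three]
  fin_cases i <;>
  · simp only [Fin.zero_eta, Fin.mk_one, Fin.reduceFinMk, mul_sub, sub_mul, mul_add, add_mul,
      smul_mul_assoc, mul_smul_comm, mul_assoc, r1, r2, r3, r4, s1, s2, s3, s4, s5, s6, t1, t2,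
      t3, t4, t5, t6, mul_neg, neg_mul, neg_neg, mul_one]
    module

theorem commutator_alpha_mul_alpha {b : Mat4} {a : Fin 3 → Mat4} (h : IsDiracFrame b a) (c₀ : ℂ)
    (c : Fin 3 → ℂ) (i j : Fin 3) (hij : i ≠ j) :
    a i * a j * (c₀ • b - ∑ k, c k • (b * a k)) - (c₀ • b - ∑ k, c k • (b * a k)) * (a i * a j) =
      (2 : ℂ) • (c i • (b * a j) - c j • (b * a i)) := by
  obtain ⟨⟨r1, r2, r3, r4⟩, ⟨s1, s2, s3, s4, s5, s6⟩, t1, t2, t3, t4, t5, t6⟩ := h.rules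
  rw [Fin.sum_univ_three]
  fin_cases i <;> fin_cases j <;> first
  | exact absurd rfl hij
  | simp only [Fin.zero_eta, Fin.mk_one, Fin.reduceFinMk, mul_sub, sub_mul, mul_add, add_mul,
      smul_mul_assoc, mul_smul_comm, mul_assoc, r1, r2, r3, r4, s1, s2, s3, s4, s5, s6, t1, t2,
      t3, t4, t5, t6, mul_neg, neg_mul, neg_neg, mul_one]
    module

/-- The reduced potential `x ↦ W (x, 0)` of a Poincaré invariant potential is Lorentz
covariant. -/
theorem IsPoincareInvariant.isLorentzCovariantOn {γ : Fin 4 → Mat4} (hγ : IsGammaRep γ)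
    {Ω : Set Config} {W : Config → SpinMatrix} (hW : IsPoincareInvariant γ Ω W)
    {D : Set SpaceTime} (hD : IsOpen D) (hDΩ : ∀ x ∈ D, ![x, 0] ∈ Ω)
    (hd : DifferentiableOn ℝ (fun y => W ![y, 0]) D) :
    IsLorentzCovariantOn (fun i => γ 0 * γ i.succ) totalSpin D (fun y => W ![y, 0]) := by
  have hf := hγ.isDiracFrame
  obtain ⟨⟨r1, r2, r3, r4⟩, ⟨s1, s2, s3, s4, s5, s6⟩, t1, t2, t3, t4, t5, t6⟩ := hf.rules
  intro x hx
  have hdx := (hd x hx).differentiableAt (hD.mem_nhds hx)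
  have sq : ∀ i j : Fin 3, i ≠ j →
      γ 0 * γ i.succ * (γ 0 * γ j.succ) * (γ 0 * γ i.succ * (γ 0 * γ j.succ)) = -1 := by
    intro i j hij
    have h1 := hf.anti_alpha j i hij.symm
    have h2 := hf.sq_alpha i
    have h3 := hf.sq_alpha j
    generalize γ 0 * γ i.succ = p at *
    generalize γ 0 * γ j.succ = q at *
    calc p * q * (p * q) = p * (q * p) * q := by noncomm_ring
      _ = -((p * p) * (q * q)) := by rw [h1]; noncomm_ring
      _ = -1 := by rw [h2, h3, one_mul]
  refine ⟨fun i => ?_, fun i j hij => ?_⟩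
  · rw [← boostGen_mulVec]
    refine hW.fderiv_generator hγ hD hDΩ hx hdx (σ := 1) ?_ ?_ ?_ ?_
    · ext p q
      fin_cases i <;> fin_cases p <;> fin_cases q <;>
        simp [boostGen, add_mul, mul_add]
    · ext p q
      fin_cases i <;> fin_cases p <;> fin_cases q <;>
        simp [boostGen, minkowski, add_mul, mul_add]
    · rw [hf.sq_alpha i]; simp
    · intro v
      rw [boostGen_mulVec, hγ.slash_eq_beta_mul, hγ.slash_eq_beta_mul]
      have := commutator_alpha hf (((v 0 : ℝ) : ℂ)) (fun i => ((v i.succ : ℝ) : ℂ)) i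
      refine this.trans ?_
      congr 1
      fin_cases i <;> simp [boostVec, Fin.sum_univ_three, Pi.single_apply]
  · rw [← rotGen_mulVec]
    refine hW.fderiv_generator hγ hD hDΩ hx hdx (σ := -1) ?_ ?_ ?_ ?_
    · have hij' : j.succ ≠ i.succ := fun h => hij (Fin.succ_injective _ h).symm
      simp only [rotGen, sub_mul, mul_sub, Matrix.single_mul_single_same,
        Matrix.single_mul_single_of_ne _ _ _ _ hij',
        Matrix.single_mul_single_of_ne _ _ _ _ hij'.symm]
      simp [neg_add_eq_sub]
    · ext p q
      fin_cases i <;> fin_cases j <;> fin_cases p <;> fin_cases q <;>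
        simp [rotGen, minkowski, sub_mul, mul_sub]
    · rw [sq i j hij]; simp
    · intro v
      rw [rotGen_mulVec, hγ.slash_eq_beta_mul, hγ.slash_eq_beta_mul]
      have := commutator_alpha_mul_alpha hf (((v 0 : ℝ) : ℂ)) (fun i => ((v i.succ : ℝ) : ℂ)) i j
        hij
      refine this.trans ?_
      congr 1
      clear this
      fin_cases i <;> fin_cases j <;>
        simp [rotVec, Fin.sum_univ_three, Pi.single_apply] at hij ⊢ <;> try abel

/-! ### The commutator of two evolution equations. -/

/-- Multiplication of vectors by matrices as a continuous bilinear map. -/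
def mulVecBilin : SpinMatrix →L[ℝ] Spinor →L[ℝ] Spinor :=
  LinearMap.mkContinuous₂
    (LinearMap.mk₂ ℝ (fun (M : SpinMatrix) (v : Spinor) => M.mulVec v)
      (fun _ _ _ => Matrix.add_mulVec _ _ _) (fun _ _ _ => Matrix.smul_mulVec _ _ _)
      (fun _ _ _ => Matrix.mulVec_add _ _ _) (fun _ _ _ => Matrix.mulVec_smul _ _ _)) 1
    (fun M v => by simpa using Matrix.linfty_opNorm_mulVec M v)

section Calculus

variable {E : Type*} [NormedAddCommGroup E] [NormedSpace ℝ E]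

theorem fderiv_mulVec {M : E → SpinMatrix} {ψ : E → Spinor} {X : E}
    (hM : DifferentiableAt ℝ M X) (hψ : DifferentiableAt ℝ ψ X) (d : E) :
    fderiv ℝ (fun Y => (M Y).mulVec (ψ Y)) X d =
      (fderiv ℝ M X d).mulVec (ψ X) + (M X).mulVec (fderiv ℝ ψ X d) := by
  have := (mulVecBilin.hasFDerivAt_of_bilinear hM.hasFDerivAt hψ.hasFDerivAt).fderiv
  have h2 := congrArg (fun T => T d) this
  refine h2.trans ?_
  rw [add_comm]
  rfl

theorem differentiableAt_mulVec {M : E → SpinMatrix} {ψ : E → Spinor} {X : E}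
    (hM : DifferentiableAt ℝ M X) (hψ : DifferentiableAt ℝ ψ X) :
    DifferentiableAt ℝ (fun Y => (M Y).mulVec (ψ Y)) X :=
  (mulVecBilin.hasFDerivAt_of_bilinear hM.hasFDerivAt hψ.hasFDerivAt).differentiableAt

theorem fderiv_const_mulVec (M : SpinMatrix) {ψ : E → Spinor} {X : E}
    (hψ : DifferentiableAt ℝ ψ X) (d : E) :
    fderiv ℝ (fun Y => M.mulVec (ψ Y)) X d = M.mulVec (fderiv ℝ ψ X d) := by
  have h := fderiv_mulVec (M := fun _ => M) (differentiableAt_const M) hψ d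
  rw [h]
  simp

/-- The derivative of a first order evolution equation. -/
theorem fderiv_evolution {ψ : E → Spinor} {X e₀ : E} {e : Fin 3 → E} {α : Fin 3 → SpinMatrix}
    {B : E → SpinMatrix} (hψ : ContDiffAt ℝ 2 ψ X) (hB : DifferentiableAt ℝ B X)
    (heq : ∀ᶠ Y in nhds X, fderiv ℝ ψ Y e₀ =
      -∑ i, (α i).mulVec (fderiv ℝ ψ Y (e i)) - Complex.I • (B Y).mulVec (ψ Y)) (f : E) :
    fderiv ℝ (fun Y => fderiv ℝ ψ Y e₀) X f =
      -∑ i, (α i).mulVec (fderiv ℝ (fun Y => fderiv ℝ ψ Y (e i)) X f) -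
        Complex.I • ((fderiv ℝ B X f).mulVec (ψ X) + (B X).mulVec (fderiv ℝ ψ X f)) := by
  have hd : DifferentiableAt ℝ ψ X := hψ.differentiableAt two_ne_zero
  have hd2 : DifferentiableAt ℝ (fderiv ℝ ψ) X :=
    (hψ.fderiv_right (m := 1) (by norm_num)).differentiableAt one_ne_zero
  have hd3 : ∀ v, DifferentiableAt ℝ (fun Y => fderiv ℝ ψ Y v) X := fun v =>
    hd2.clm_apply (differentiableAt_const v)
  have hd4 : ∀ i, DifferentiableAt ℝ (fun Y => (α i).mulVec (fderiv ℝ ψ Y (e i))) X := fun i =>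
    differentiableAt_mulVec (differentiableAt_const (α i)) (hd3 (e i))
  have hd5 := differentiableAt_mulVec hB hd
  rw [Filter.EventuallyEq.fderiv_eq heq]
  have hsum : DifferentiableAt ℝ (fun Y => ∑ i, (α i).mulVec (fderiv ℝ ψ Y (e i))) X :=
    DifferentiableAt.fun_sum fun i _ => hd4 i
  rw [fderiv_fun_sub hsum.fun_neg (hd5.fun_const_smul Complex.I), fderiv_fun_neg,
    fderiv_fun_sum fun i _ => hd4 i, fderiv_fun_const_smul hd5]
  simp only [_root_.sub_apply, _root_.neg_apply,
    sum_apply, _root_.smul_apply, fderiv_mulVec hB hd]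
  congr 2
  exact Finset.sum_congr rfl fun i _ => fderiv_const_mulVec (α i) (hd3 (e i)) f

/-- Two evolution equations in different time variables with a common solution: the commutator
of the two operators vanishes on it. -/
theorem commutator_evolution {ψ : E → Spinor} {X e₀ f₀ : E} {e f : Fin 3 → E}
    {α α' : Fin 3 → SpinMatrix} {B B' : E → SpinMatrix}
    (hψ : ContDiffAt ℝ 2 ψ X) (hB : DifferentiableAt ℝ B X) (hB' : DifferentiableAt ℝ B' X)
    (hα : ∀ i j, α i * α' j = α' j * α i)
    (heq : ∀ᶠ Y in nhds X, fderiv ℝ ψ Y e₀ =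
      -∑ i, (α i).mulVec (fderiv ℝ ψ Y (e i)) - Complex.I • (B Y).mulVec (ψ Y))
    (heq' : ∀ᶠ Y in nhds X, fderiv ℝ ψ Y f₀ =
      -∑ i, (α' i).mulVec (fderiv ℝ ψ Y (f i)) - Complex.I • (B' Y).mulVec (ψ Y)) :
    Complex.I • ∑ i, (α i * B' X - B' X * α i).mulVec (fderiv ℝ ψ X (e i)) +
      Complex.I • ∑ i, (B X * α' i - α' i * B X).mulVec (fderiv ℝ ψ X (f i)) +
      (Complex.I • (fderiv ℝ B' X e₀ + ∑ i, α i * fderiv ℝ B' X (e i) -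
        (fderiv ℝ B X f₀ + ∑ i, α' i * fderiv ℝ B X (f i))) -
        (B X * B' X - B' X * B X)).mulVec (ψ X) = 0 := by
  have hsymm : ∀ u v : E, fderiv ℝ (fun Y => fderiv ℝ ψ Y u) X v =
      fderiv ℝ (fun Y => fderiv ℝ ψ Y v) X u := by
    have hd2 : DifferentiableAt ℝ (fderiv ℝ ψ) X :=
      (hψ.fderiv_right (m := 1) (by norm_num)).differentiableAt one_ne_zero
    intro u v
    have hs : IsSymmSndFDerivAt ℝ ψ X := hψ.isSymmSndFDerivAt (by simp)
    have e1 : ∀ u v, fderiv ℝ (fun Y => fderiv ℝ ψ Y u) X v = fderiv ℝ (fderiv ℝ ψ) X v u := by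
      intro u v
      rw [fderiv_clm_apply hd2 (differentiableAt_const u)]
      simp
    rw [e1, e1]
    exact hs v u
  have h1 := fderiv_evolution hψ hB heq f₀
  have h2 := fderiv_evolution hψ hB' heq' e₀
  -- By symmetry of second derivatives, the time derivative of a spatial derivative is obtained by
  -- differentiating the other evolution equation in space.
  have h1' : ∀ i, fderiv ℝ (fun Y => fderiv ℝ ψ Y (e i)) X f₀ = _ := fun i =>
    (hsymm _ _).trans (fderiv_evolution hψ hB' heq' (e i))
  have h2' : ∀ i, fderiv ℝ (fun Y => fderiv ℝ ψ Y (f i)) X e₀ = _ := fun i =>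
    (hsymm _ _).trans (fderiv_evolution hψ hB heq (f i))
  have hX := heq.self_of_nhds
  have hX' := heq'.self_of_nhds
  have h := h1.symm.trans ((hsymm _ _).trans h2)
  simp only [h1', h2', hX, hX'] at h
  -- The second order terms of the two computations agree because α and α' commute. What is left
  -- involves only ψ and its spatial first derivatives.
  have hdouble : ∑ i, ∑ j, (α i * α' j).mulVec
      (fderiv ℝ (fun Y => fderiv ℝ ψ Y (f j)) X (e i)) =
      ∑ j, ∑ i, (α' j * α i).mulVec
      (fderiv ℝ (fun Y => fderiv ℝ ψ Y (e i)) X (f j)) := by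
    rw [Finset.sum_comm]
    refine Finset.sum_congr rfl fun j _ => Finset.sum_congr rfl fun i _ => ?_
    rw [hα, hsymm]
  simp only [Matrix.mulVec_sub, Matrix.mulVec_neg, Matrix.mulVec_sum, Matrix.mulVec_smul,
    Matrix.mulVec_add, Finset.sum_sub_distrib, Finset.sum_neg_distrib, Finset.sum_add_distrib,
    ← Finset.smul_sum, smul_sub, smul_add, smul_neg, smul_smul, Complex.I_mul_I,
    Matrix.mulVec_mulVec] at h
  rw [hdouble] at h
  simp only [Matrix.sub_mulVec, Matrix.add_mulVec, Matrix.smul_mulVec, Matrix.sum_mulVec,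
    Finset.sum_sub_distrib, smul_sub, smul_add]
  rw [← sub_eq_zero] at h
  rw [← h]
  module

end Calculus

/-! ### Cutoffs, integration by parts and quadratic forms. -/

/-- Smooth cutoff functions. -/
theorem exists_contDiff_bump {E : Type*} [NormedAddCommGroup E] [NormedSpace ℝ E]
    [FiniteDimensional ℝ E] {K N : Set E} (hK : IsCompact K) (hN : IsOpen N) (hKN : K ⊆ N) :
    ∃ ρ : E → ℝ, ContDiff ℝ ∞ ρ ∧ HasCompactSupport ρ ∧ tsupport ρ ⊆ N ∧
      ∀ x ∈ K, ∀ᶠ y in nhds x, ρ y = 1 := by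
  obtain ⟨L, hL, hKL, hLN⟩ := exists_compact_between hK hN hKN
  obtain ⟨ρ, h1, h0, -⟩ := exists_contMDiffMap_one_nhds_of_subset_interior (n := (⊤ : ℕ∞))
    (modelWithCornersSelf ℝ E) hK.isClosed hKL
  have hsupp : tsupport ρ ⊆ L :=
    closure_minimal (fun x hx => by_contra fun hxL => hx (h0 x hxL)) hL.isClosed
  refine ⟨ρ, ρ.contMDiff.contDiff, HasCompactSupport.of_support_subset_isCompact hL
    (subset_closure.trans hsupp), hsupp.trans hLN, fun x hx => ?_⟩
  exact Filter.Eventually.filter_mono (nhds_le_nhdsSet hx) h1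

theorem integral_fderiv_eq_zero_of_hasCompactSupport {F : SpaceTime → ℝ}
    {F' : SpaceTime → SpaceTime →L[ℝ] ℝ} (hF : ∀ y, HasFDerivAt F (F' y) y)
    (hc : HasCompactSupport F) (v : SpaceTime) (hv : Continuous fun y => F' y v) :
    ∫ y, F' y v = 0 := by
  have e : ∀ y, fderiv ℝ F y = F' y := fun y => (hF y).fderiv
  have hFc : Continuous F := continuous_iff_continuousAt.mpr fun y => (hF y).continuousAt
  have hc' : HasCompactSupport fun y => F' y v := by
    have := hc.fderiv_apply (𝕜 := ℝ) v
    simpa only [e] using this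
  have := integral_mul_fderiv_eq_neg_fderiv_mul_of_integrable (μ := MeasureTheory.volume)
    (f := fun _ : SpaceTime => (1 : ℝ)) (g := F) (v := v) (by simp)
    (by simpa only [e, one_mul] using hv.integrable_of_hasCompactSupport hc')
    (by simpa using hFc.integrable_of_hasCompactSupport hc)
    (fun x _ => differentiableAt_const _) (fun x _ => (hF x).differentiableAt)
  simpa [e] using this

/-- The real part of the sesquilinear form `⟨u, H v⟩`. -/
def reForm (H : SpinMatrix) : Spinor →L[ℝ] Spinor →L[ℝ] ℝ :=
  LinearMap.toContinuousBilinearMap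
    (LinearMap.mk₂ ℝ (fun (u v : Spinor) => (star u ⬝ᵥ H.mulVec v).re)
      (fun _ _ _ => by simp [add_dotProduct])
      (fun _ _ _ => by simp [smul_dotProduct])
      (fun _ _ _ => by simp [Matrix.mulVec_add, dotProduct_add])
      (fun _ _ _ => by simp [Matrix.mulVec_smul, dotProduct_smul]))

theorem reForm_apply (H : SpinMatrix) (u v : Spinor) :
    reForm H u v = (star u ⬝ᵥ H.mulVec v).re := rfl

theorem reForm_comm {H : SpinMatrix} (hH : H.conjTranspose = H) (u v : Spinor) :
    reForm H u v = reForm H v u := by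
  rw [reForm_apply, reForm_apply, ← Complex.conj_re]
  congr 1
  change star (star u ⬝ᵥ H.mulVec v) = _
  rw [← Matrix.star_dotProduct_star, star_star, Matrix.star_mulVec, hH, ← Matrix.dotProduct_mulVec]

theorem reForm_one_self (u : Spinor) : reForm 1 u u = ∑ i, Complex.normSq (u i) := by
  rw [reForm_apply, Matrix.one_mulVec, dotProduct, Complex.re_sum]
  refine Finset.sum_congr rfl fun i _ => ?_
  simp [Complex.normSq_apply]

/-- The norm of `Spinor` is the supremum norm, which the euclidean norm dominates. -/
theorem norm_sq_le_reForm (u : Spinor) : ‖u‖ ^ 2 ≤ reForm 1 u u := by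
  rw [reForm_one_self]
  have hpos : 0 ≤ ∑ i, Complex.normSq (u i) := Finset.sum_nonneg fun i _ => Complex.normSq_nonneg _
  have : ‖u‖ ≤ Real.sqrt (∑ i, Complex.normSq (u i)) := by
    refine (pi_norm_le_iff_of_nonneg (Real.sqrt_nonneg _)).mpr fun i => ?_
    refine Real.le_sqrt_of_sq_le ?_
    rw [← Complex.normSq_eq_norm_sq]
    exact Finset.single_le_sum (f := fun i => Complex.normSq (u i))
      (fun i _ => Complex.normSq_nonneg _) (Finset.mem_univ i)
  calc ‖u‖ ^ 2 ≤ Real.sqrt (∑ i, Complex.normSq (u i)) ^ 2 := by gcongr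
    _ = _ := Real.sq_sqrt hpos

theorem reForm_mul_apply (H M : SpinMatrix) (u v : Spinor) :
    reForm H u (M.mulVec v) = reForm (H * M) u v := by
  rw [reForm_apply, reForm_apply, Matrix.mulVec_mulVec]

/-- M need not be anti-hermitian, since the potentials are not assumed hermitian. The energy may
therefore grow, at a rate controlled by C. -/
theorem exists_reForm_le (M : SpinMatrix) :
    ∃ C : ℝ, 0 ≤ C ∧ ∀ u, reForm 1 u (M.mulVec u) ≤ C * reForm 1 u u := by
  refine ⟨‖reForm M‖, by positivity, fun u => ?_⟩
  rw [reForm_mul_apply, one_mul]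
  calc reForm M u u ≤ ‖reForm M u u‖ := le_abs_self _
    _ ≤ ‖reForm M‖ * ‖u‖ * ‖u‖ := (reForm M).le_opNorm₂ u u
    _ = ‖reForm M‖ * ‖u‖ ^ 2 := by ring
    _ ≤ _ := mul_le_mul_of_nonneg_left (norm_sq_le_reForm u) (by positivity)

/-! ### The energy estimate in a light cone. -/

/-- Hermitian, pairwise anticommuting matrices with squares `1`. -/
structure IsHermitianClifford (A : Fin 3 → SpinMatrix) : Prop where
  hermitian : ∀ i, (A i).conjTranspose = A i
  sq : ∀ i, A i * A i = 1
  anti : ∀ i j, i ≠ j → A i * A j = -(A j * A i)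

/-- The velocity operator is bounded by the velocity of light. -/
theorem IsHermitianClifford.sum_reForm_le {A : Fin 3 → SpinMatrix} (hA : IsHermitianClifford A)
    {n : Fin 3 → ℝ} (hn : ∑ i, n i ^ 2 ≤ 1) (u : Spinor) :
    -reForm 1 u u - ∑ i, n i * reForm (A i) u u ≤ 0 := by
  set S : Spinor := ∑ i, n i • (A i).mulVec u with hS
  have h1 : reForm 1 u S = ∑ i, n i * reForm (A i) u u := by
    rw [hS, map_sum]
    refine Finset.sum_congr rfl fun i _ => ?_
    rw [map_smul, smul_eq_mul, reForm_mul_apply, one_mul]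
  have h11 : ((1 : SpinMatrix).conjTranspose) = 1 := Matrix.conjTranspose_one
  have hij : ∀ i j, reForm 1 ((A i).mulVec u) ((A j).mulVec u) = reForm (A i * A j) u u := by
    intro i j
    rw [reForm_apply, reForm_apply, Matrix.one_mulVec, Matrix.star_mulVec, hA.hermitian,
      ← Matrix.mulVec_mulVec, Matrix.dotProduct_mulVec (star u)]
  have hne : ∀ i j, i ≠ j → reForm (A i * A j) u u = -reForm (A j * A i) u u := by
    intro i j h
    rw [hA.anti i j h, reForm_apply, reForm_apply, Matrix.neg_mulVec, dotProduct_neg,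
      Complex.neg_re]
  -- Anticommutation cancels the mixed terms of (∑ nᵢAᵢ)².
  have h2 : reForm 1 S S = (∑ i, n i ^ 2) * reForm 1 u u := by
    have e01 := hne 0 1 (by decide)
    have e02 := hne 0 2 (by decide)
    have e12 := hne 1 2 (by decide)
    rw [hS]
    simp only [Fin.sum_univ_three, map_add, map_smul, add_apply,
      smul_apply, smul_eq_mul, hij, hA.sq, e01, e02, e12]
    ring
  -- Expanding 0 ≤ |u + S|² and using |S|² ≤ |u|² gives the bound.
  have h3 : 0 ≤ reForm 1 (u + S) (u + S) := (sq_nonneg _).trans (norm_sq_le_reForm _)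
  have h4 : reForm 1 (u + S) (u + S) = reForm 1 u u + 2 * reForm 1 u S + reForm 1 S S := by
    simp only [map_add, add_apply]
    rw [reForm_comm h11 S u]
    ring
  have h5 : 0 ≤ reForm 1 u u := (sq_nonneg _).trans (norm_sq_le_reForm _)
  rw [h4, h2, h1] at h3
  nlinarith

/-- The part of `u` in the future of the initial hypersurface. -/
def futurePart (u : SpaceTime → Spinor) (y : SpaceTime) : Spinor := if y 0 ≤ 0 then 0 else u y

theorem continuous_futurePart {u : SpaceTime → Spinor} (hu : Continuous u)
    (h0 : ∀ y, y 0 = 0 → u y = 0) : Continuous (futurePart u) :=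
  Continuous.if_le continuous_const hu (continuous_apply 0) continuous_const
    (fun y hy => (h0 y hy).symm)

theorem norm_futurePart_le (u : SpaceTime → Spinor) (y : SpaceTime) :
    ‖futurePart u y‖ ≤ ‖u y‖ := by
  unfold futurePart
  split_ifs <;> simp

/-- The truncation at time zero may destroy the differentiability of u. As u vanishes there, a
quadratic form in it vanishes to second order and stays differentiable. The energy balance can then
be integrated over the whole space-time without boundary terms. -/
theorem hasFDerivAt_reForm_futurePart {u : SpaceTime → Spinor} (hu : Differentiable ℝ u)
    (h0 : ∀ y, y 0 = 0 → u y = 0) {H : SpinMatrix} (hH : H.conjTranspose = H) (y : SpaceTime) :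
    HasFDerivAt (fun z => reForm H (futurePart u z) (futurePart u z))
      ((2 : ℝ) • (reForm H (futurePart u y)).comp (fderiv ℝ u y)) y := by
  rcases lt_trichotomy (y 0) 0 with h | h | h
  · have e : futurePart u y = 0 := if_pos h.le
    rw [e, map_zero, ContinuousLinearMap.zero_comp, smul_zero]
    refine (hasFDerivAt_const (0 : ℝ) y).congr_of_eventuallyEq ?_
    filter_upwards [(continuous_apply 0).continuousAt.eventually (gt_mem_nhds h)] with z hz
    have : futurePart u z = 0 := if_pos (le_of_lt hz)
    simp [this]
  · have e : futurePart u y = 0 := if_pos h.le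
    have huy := h0 y h
    rw [e, map_zero, ContinuousLinearMap.zero_comp, smul_zero]
    have hO : u =O[nhds y] fun z => z - y := by
      simpa [huy] using (hu y).hasFDerivAt.isBigO_sub
    have hO2 : futurePart u =O[nhds y] fun z => ‖z - y‖ :=
      (Asymptotics.IsBigO.trans (Asymptotics.isBigO_of_le _ (norm_futurePart_le u)) hO).norm_right
    refine Asymptotics.IsBigO.hasFDerivAt (n := 2) ?_ (by norm_num)
    have h1 : (fun z => reForm H (futurePart u z) (futurePart u z)) =O[nhds y]
        fun z => ‖futurePart u z‖ * ‖futurePart u z‖ := by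
      refine Asymptotics.IsBigO.of_bound ‖reForm H‖ (Filter.Eventually.of_forall fun z => ?_)
      rw [Real.norm_of_nonneg (mul_self_nonneg _), ← mul_assoc]
      exact (reForm H).le_opNorm₂ _ _
    refine h1.trans ?_
    simp only [pow_two]
    exact hO2.norm_left.mul hO2.norm_left
  · have e : futurePart u =ᶠ[nhds y] u := by
      filter_upwards [(continuous_apply 0).continuousAt.eventually (lt_mem_nhds h)] with z hz
      exact if_neg (not_le.mpr hz)
    have hd := ((reForm H).hasFDerivAt_of_bilinear (hu y).hasFDerivAt (hu y).hasFDerivAt)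
    rw [e.self_of_nhds]
    have hee : (fun z => reForm H (futurePart u z) (futurePart u z)) =ᶠ[nhds y]
        fun z => reForm H (u z) (u z) := by
      filter_upwards [e] with z hz
      rw [hz]
    have := HasFDerivAt.congr_of_eventuallyEq hd hee
    refine this.congr_fderiv ?_
    ext v
    simp [ContinuousLinearMap.precompR, ContinuousLinearMap.precompL,
      reForm_comm hH (fderiv ℝ u y v) (u y), two_mul]

/-- `r ↦ max(0, r)²` -/
def posSq (r : ℝ) : ℝ := (max 0 r) ^ 2

theorem hasDerivAt_posSq (r : ℝ) : HasDerivAt posSq (2 * max 0 r) r := by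
  rcases lt_trichotomy r 0 with h | h | h
  · rw [max_eq_left h.le, mul_zero]
    refine (hasDerivAt_const r (0 : ℝ)).congr_of_eventuallyEq ?_
    filter_upwards [gt_mem_nhds h] with s hs
    simp [posSq, max_eq_left (le_of_lt hs)]
  · subst h
    rw [max_self, mul_zero, hasDerivAt_iff_hasFDerivAt]
    have : posSq =O[nhds 0] fun x => ‖x - 0‖ ^ 2 := by
      refine Asymptotics.IsBigO.of_bound 1 (Filter.Eventually.of_forall fun s => ?_)
      simp only [posSq, sub_zero, one_mul, Real.norm_eq_abs, abs_pow, abs_abs]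
      rw [abs_of_nonneg (le_max_left _ _)]
      exact pow_le_pow_left₀ (le_max_left _ _) (max_le (abs_nonneg _) (le_abs_self _)) 2
    simpa using this.hasFDerivAt (by norm_num)
  · rw [max_eq_right h.le]
    have := hasDerivAt_pow 2 r
    refine (this.congr_of_eventuallyEq ?_).congr_deriv (by norm_num)
    filter_upwards [lt_mem_nhds h] with s hs
    simp [posSq, max_eq_right (le_of_lt hs)]

/-- A regularised euclidean distance of the spatial part of `y` from `c`. -/
def coneDist (ε : ℝ) (c : Fin 3 → ℝ) (y : SpaceTime) : ℝ :=
  √(ε ^ 2 + ∑ i : Fin 3, (y i.succ - c i) ^ 2)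

theorem coneDist_pos {ε : ℝ} (hε : 0 < ε) (c : Fin 3 → ℝ) (y : SpaceTime) :
    0 < coneDist ε c y :=
  Real.sqrt_pos.mpr (add_pos_of_pos_of_nonneg (by positivity)
    (Finset.sum_nonneg fun i _ => sq_nonneg _))

theorem coneDist_sq (ε : ℝ) (c : Fin 3 → ℝ) (y : SpaceTime) :
    coneDist ε c y ^ 2 = ε ^ 2 + ∑ i : Fin 3, (y i.succ - c i) ^ 2 :=
  Real.sq_sqrt (add_nonneg (by positivity) (Finset.sum_nonneg fun i _ => sq_nonneg _))

theorem continuous_coneDist (ε : ℝ) (c : Fin 3 → ℝ) : Continuous (coneDist ε c) := by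
  unfold coneDist
  fun_prop

theorem hasFDerivAt_coneDist {ε : ℝ} (hε : 0 < ε) (c : Fin 3 → ℝ) (y : SpaceTime) :
    HasFDerivAt (coneDist ε c)
      (∑ i : Fin 3, ((y i.succ - c i) / coneDist ε c y) •
        (ContinuousLinearMap.proj i.succ : SpaceTime →L[ℝ] ℝ)) y := by
  have h1 : ∀ i : Fin 3, HasFDerivAt (fun y : SpaceTime => (y i.succ - c i) ^ 2)
      ((2 * (y i.succ - c i)) • (ContinuousLinearMap.proj i.succ : SpaceTime →L[ℝ] ℝ)) y := by
    intro i
    have := (((ContinuousLinearMap.proj i.succ : SpaceTime →L[ℝ] ℝ).hasFDerivAt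
      (x := y)).sub_const (c i)).pow 2
    simpa using this
  have h2 := ((HasFDerivAt.fun_sum (u := Finset.univ) fun i _ => h1 i).const_add (ε ^ 2)).sqrt
    (Real.sqrt_ne_zero'.mp (coneDist_pos hε c y).ne').ne'
  refine h2.congr_fderiv ?_
  ext v
  have hp := (coneDist_pos hε c y).ne'
  simp only [_root_.smul_apply, sum_apply, ContinuousLinearMap.proj_apply,
    smul_eq_mul, Finset.mul_sum]
  refine Finset.sum_congr rfl fun i _ => ?_
  change 1 / (2 * coneDist ε c y) * _ = _
  field_simp

theorem sum_coneDist_normal_sq_le {ε : ℝ} (hε : 0 < ε) (c : Fin 3 → ℝ) (y : SpaceTime) :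
    ∑ i : Fin 3, ((y i.succ - c i) / coneDist ε c y) ^ 2 ≤ 1 := by
  have h := coneDist_pos hε c y
  simp_rw [div_pow]
  rw [← Finset.sum_div, div_le_one (by positivity), coneDist_sq]
  nlinarith

theorem sum_le_coneDist_sq (ε : ℝ) (c : Fin 3 → ℝ) (y : SpaceTime) :
    ∑ i : Fin 3, (y i.succ - c i) ^ 2 ≤ coneDist ε c y ^ 2 := by
  rw [coneDist_sq]
  nlinarith [sq_nonneg ε]

theorem abs_le_coneDist (ε : ℝ) (c : Fin 3 → ℝ) (y : SpaceTime) (i : Fin 3) :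
    |y i.succ - c i| ≤ coneDist ε c y := by
  refine abs_le_of_sq_le_sq ?_ (Real.sqrt_nonneg _)
  exact (Finset.single_le_sum (f := fun i : Fin 3 => (y i.succ - c i) ^ 2)
    (fun i _ => sq_nonneg _) (Finset.mem_univ i)).trans (sum_le_coneDist_sq ε c y)

/-- The weight of the energy estimate. -/
def coneWeight (k ε t : ℝ) (c : Fin 3 → ℝ) (y : SpaceTime) : ℝ :=
  posSq (t - y 0 - coneDist ε c y) * Real.exp (-k * y 0)

theorem coneWeight_nonneg (k ε t : ℝ) (c : Fin 3 → ℝ) (y : SpaceTime) :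
    0 ≤ coneWeight k ε t c y :=
  mul_nonneg (sq_nonneg _) (Real.exp_pos _).le

theorem coneWeight_eq_zero (k : ℝ) {ε t : ℝ} {c : Fin 3 → ℝ} {y : SpaceTime}
    (h : t - y 0 - coneDist ε c y ≤ 0) : coneWeight k ε t c y = 0 := by
  simp [coneWeight, posSq, max_eq_left h]

theorem coneWeight_pos (k : ℝ) {ε t : ℝ} {c : Fin 3 → ℝ} {y : SpaceTime}
    (h : 0 < t - y 0 - coneDist ε c y) : 0 < coneWeight k ε t c y := by
  unfold coneWeight posSq
  rw [max_eq_right h.le]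
  positivity

/-- The derivative of the weight. -/
def coneWeightDeriv (k ε t : ℝ) (c : Fin 3 → ℝ) (y : SpaceTime) : SpaceTime →L[ℝ] ℝ :=
  (2 * max 0 (t - y 0 - coneDist ε c y) * Real.exp (-k * y 0)) •
      (-(ContinuousLinearMap.proj 0 : SpaceTime →L[ℝ] ℝ) -
        ∑ i : Fin 3, ((y i.succ - c i) / coneDist ε c y) •
          (ContinuousLinearMap.proj i.succ : SpaceTime →L[ℝ] ℝ)) -
    (k * coneWeight k ε t c y) • (ContinuousLinearMap.proj 0 : SpaceTime →L[ℝ] ℝ)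

theorem hasFDerivAt_coneWeight (k : ℝ) {ε : ℝ} (hε : 0 < ε) (t : ℝ) (c : Fin 3 → ℝ)
    (y : SpaceTime) :
    HasFDerivAt (coneWeight k ε t c) (coneWeightDeriv k ε t c y) y := by
  have hp : HasFDerivAt (fun y : SpaceTime => y 0)
      (ContinuousLinearMap.proj 0 : SpaceTime →L[ℝ] ℝ) y :=
    (ContinuousLinearMap.proj 0 : SpaceTime →L[ℝ] ℝ).hasFDerivAt
  have h1 := (hasDerivAt_posSq _).comp_hasFDerivAt y
    ((hp.const_sub t).sub (hasFDerivAt_coneDist hε c y))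
  have h2 := (hp.const_mul (-k)).exp
  refine (h1.mul h2).congr_fderiv ?_
  ext v
  simp [coneWeightDeriv, coneWeight, Function.comp_apply]
  ring

theorem coneWeightDeriv_zero (k ε t : ℝ) (c : Fin 3 → ℝ) (y : SpaceTime) :
    coneWeightDeriv k ε t c y (unitVec 0) =
      -(2 * max 0 (t - y 0 - coneDist ε c y) * Real.exp (-k * y 0)) -
        k * coneWeight k ε t c y := by
  simp [coneWeightDeriv, unitVec, Fin.succ_ne_zero]

theorem coneWeightDeriv_succ (k ε t : ℝ) (c : Fin 3 → ℝ) (y : SpaceTime) (i : Fin 3) :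
    coneWeightDeriv k ε t c y (unitVec i.succ) =
      -(2 * max 0 (t - y 0 - coneDist ε c y) * Real.exp (-k * y 0)) *
        ((y i.succ - c i) / coneDist ε c y) := by
  simp [coneWeightDeriv, unitVec, Pi.single_apply, Fin.succ_ne_zero, (Fin.succ_ne_zero i).symm]

theorem continuous_coneWeight (k : ℝ) {ε : ℝ} (hε : 0 < ε) (t : ℝ) (c : Fin 3 → ℝ) :
    Continuous (coneWeight k ε t c) :=
  continuous_iff_continuousAt.mpr fun y => (hasFDerivAt_coneWeight k hε t c y).continuousAt

theorem continuous_coneWeightDeriv (k : ℝ) {ε : ℝ} (hε : 0 < ε) (t : ℝ) (c : Fin 3 → ℝ) :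
    Continuous (coneWeightDeriv k ε t c) := by
  have h1 := continuous_coneWeight k hε t c
  have h2 := continuous_coneDist ε c
  have h3 : ∀ y, coneDist ε c y ≠ 0 := fun y => (coneDist_pos hε c y).ne'
  unfold coneWeightDeriv
  fun_prop (disch := exact h3 _)

/-- The matrices of the conserved current. -/
def currentMatrix (A : Fin 3 → SpinMatrix) : Fin 4 → SpinMatrix := Fin.cons 1 A

theorem IsHermitianClifford.currentMatrix_hermitian {A : Fin 3 → SpinMatrix}
    (hA : IsHermitianClifford A) (μ : Fin 4) :
    (currentMatrix A μ).conjTranspose = currentMatrix A μ := by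
  refine Fin.cases ?_ (fun i => ?_) μ
  · exact Matrix.conjTranspose_one
  · exact hA.hermitian i

/-- Energy estimate in the interior of a backward light cone. -/
theorem IsHermitianClifford.futurePart_eq_zero {A : Fin 3 → SpinMatrix}
    (hA : IsHermitianClifford A) (M : SpinMatrix) {u : SpaceTime → Spinor} (hu : ContDiff ℝ 1 u)
    (h0 : ∀ y, y 0 = 0 → u y = 0) {t : ℝ} {c : Fin 3 → ℝ}
    (heq : ∀ y : SpaceTime, 0 ≤ y 0 → y 0 ≤ t → ∑ i : Fin 3, (y i.succ - c i) ^ 2 ≤ (t - y 0) ^ 2 →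
      fderiv ℝ u y (unitVec 0) =
        -∑ i, (A i).mulVec (fderiv ℝ u y (unitVec i.succ)) + M.mulVec (u y))
    {ε : ℝ} (hε : 0 < ε) {y : SpaceTime} (hy : 0 < t - y 0 - coneDist ε c y) :
    futurePart u y = 0 := by
  obtain ⟨C, hC0, hC⟩ := exists_reForm_le M
  -- The exponential decay of the weight compensates the growth rate 2C; the additional 1 leaves the
  -- negative term -w J₀.
  set k : ℝ := 2 * C + 1 with hk
  set J : Fin 4 → SpaceTime → ℝ := fun μ y =>
    reForm (currentMatrix A μ) (futurePart u y) (futurePart u y) with hJ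
  set J' : Fin 4 → SpaceTime → SpaceTime →L[ℝ] ℝ := fun μ y =>
    (2 : ℝ) • (reForm (currentMatrix A μ) (futurePart u y)).comp (fderiv ℝ u y) with hJ'
  have hud := hu.differentiable one_ne_zero
  have hfc := continuous_futurePart hu.continuous h0
  have hfd := hu.continuous_fderiv one_ne_zero
  have hJd : ∀ μ y, HasFDerivAt (J μ) (J' μ y) y := fun μ y =>
    hasFDerivAt_reForm_futurePart hud h0 (hA.currentMatrix_hermitian μ) y
  have hJc : ∀ μ, Continuous (J μ) := fun μ =>
    continuous_iff_continuousAt.mpr fun y => (hJd μ y).continuousAt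
  have hJ'c : ∀ μ (v : SpaceTime), Continuous fun y => J' μ y v := by
    intro μ v
    simp only [hJ', _root_.smul_apply, ContinuousLinearMap.comp_apply]
    fun_prop
  set w := coneWeight k ε t c with hw
  set w' := coneWeightDeriv k ε t c with hw'
  have hwc : Continuous w := continuous_coneWeight k hε t c
  have hw'c : Continuous w' := continuous_coneWeightDeriv k hε t c
  have hvan : ∀ μ y, ¬ (0 ≤ y 0 ∧ 0 ≤ t - y 0 - coneDist ε c y) → w y * J μ y = 0 := by
    intro μ y hn
    by_cases h1 : 0 ≤ y 0
    · have : w y = 0 := coneWeight_eq_zero k (not_le.mp fun h => hn ⟨h1, h⟩).le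
      rw [this, zero_mul]
    · have : futurePart u y = 0 := if_pos (not_le.mp h1).le
      simp [hJ, this]
  have hFd : ∀ μ y, HasFDerivAt (fun z => w z * J μ z) (w y • J' μ y + J μ y • w' y) y :=
    fun μ y => (hasFDerivAt_coneWeight k hε t c y).mul (hJd μ y)
  have hFs : ∀ μ, HasCompactSupport fun z => w z * J μ z := by
    intro μ
    refine HasCompactSupport.intro (K := Set.Icc (Fin.cons 0 fun i => c i - t : SpaceTime)
      (Fin.cons t fun i => c i + t : SpaceTime)) isCompact_Icc fun y hyK => hvan μ y fun hn => hyK ?_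
    have hd := (coneDist_pos hε c y).le
    have ha := fun i => abs_le.mp (abs_le_coneDist ε c y i)
    refine ⟨fun j => ?_, fun j => ?_⟩
    · refine Fin.cases ?_ (fun i => ?_) j
      · exact hn.1
      · simp only [Fin.cons_succ]; linarith [ha i]
    · refine Fin.cases ?_ (fun i => ?_) j
      · simp only [Fin.cons_zero]; linarith
      · simp only [Fin.cons_succ]; linarith [ha i]
  set G : Fin 4 → SpaceTime → ℝ := fun μ y =>
    (w y • J' μ y + J μ y • w' y) (unitVec μ) with hG
  have hGc : ∀ μ, Continuous (G μ) := by
    intro μ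
    have h1 := hJ'c μ (unitVec μ)
    have h2 := hJc μ
    simp only [hG, _root_.add_apply, _root_.smul_apply, smul_eq_mul]
    fun_prop
  have hGs : ∀ μ, HasCompactSupport (G μ) := by
    intro μ
    have := (hFs μ).fderiv_apply (𝕜 := ℝ) (unitVec μ)
    simpa only [fun y => (hFd μ y).fderiv] using this
  have hGi : ∀ μ, ∫ y, G μ y = 0 := fun μ =>
    integral_fderiv_eq_zero_of_hasCompactSupport (hFd μ) (hFs μ) (unitVec μ) (hGc μ)
  -- The left side is the divergence of the weighted current. The gradient of the truncated distance
  -- contributes with a favourable sign, because the current is not faster than light.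
  have key : ∀ y, ∑ μ, G μ y ≤ -(w y * J 0 y) := by
    intro y
    by_cases hn : 0 ≤ y 0 ∧ 0 ≤ t - y 0 - coneDist ε c y
    · have hd := (coneDist_pos hε c y).le
      have hle : ∑ i : Fin 3, (y i.succ - c i) ^ 2 ≤ (t - y 0) ^ 2 :=
        (sum_le_coneDist_sq ε c y).trans (pow_le_pow_left₀ hd (by linarith [hn.2]) 2)
      have e := heq y hn.1 (by linarith [hn.2]) hle
      have hdiv : ∑ μ, J' μ y (unitVec μ) ≤ 2 * C * J 0 y := by
        have hF : J 0 y = reForm 1 (futurePart u y) (futurePart u y) := rfl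
        have : ∑ μ, J' μ y (unitVec μ) = 2 * reForm 1 (futurePart u y) (M.mulVec (u y)) := by
          have hM : M.mulVec (u y) = fderiv ℝ u y (unitVec 0) +
              ∑ i, (A i).mulVec (fderiv ℝ u y (unitVec i.succ)) := by rw [e]; abel
          rw [hM, map_add, map_sum, Fin.sum_univ_succ]
          simp only [reForm_mul_apply, one_mul, mul_add, Finset.mul_sum]
          rfl
        rw [this, hF]
        by_cases h : y 0 ≤ 0
        · have : futurePart u y = 0 := if_pos h
          simp [this]
        · have : futurePart u y = u y := if_neg h
          rw [this]
          linarith [hC (u y)]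
      have hsum : ∑ μ, G μ y = w y * ∑ μ, J' μ y (unitVec μ) +
          ((2 * max 0 (t - y 0 - coneDist ε c y) * Real.exp (-k * y 0)) *
            (-J 0 y - ∑ i : Fin 3, ((y i.succ - c i) / coneDist ε c y) * J i.succ y) -
              k * w y * J 0 y) := by
        simp only [hG, _root_.add_apply, _root_.smul_apply, smul_eq_mul, Finset.sum_add_distrib,
          Finset.mul_sum]
        congr 1
        rw [Fin.sum_univ_succ, hw', coneWeightDeriv_zero]
        simp only [coneWeightDeriv_succ, Fin.sum_univ_three]
        rw [← hw]
        ring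
      have hcur := hA.sum_reForm_le (sum_coneDist_normal_sq_le hε c y) (futurePart u y)
      have hpos : 0 ≤ 2 * max 0 (t - y 0 - coneDist ε c y) * Real.exp (-k * y 0) := by positivity
      have h1 := mul_le_mul_of_nonneg_left hdiv (coneWeight_nonneg k ε t c y)
      have h2 := mul_nonpos_of_nonneg_of_nonpos hpos hcur
      change _ * (-J 0 y - ∑ i : Fin 3, ((y i.succ - c i) / coneDist ε c y) * J i.succ y) ≤ 0 at h2
      rw [hsum]
      have h3 : k * w y * J 0 y = w y * (2 * C * J 0 y) + w y * J 0 y := by rw [hk]; ring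
      linarith
    · rw [hvan 0 y hn, neg_zero]
      refine (Finset.sum_eq_zero fun μ _ => ?_).le
      by_cases h1 : 0 ≤ y 0
      · have h2 : t - y 0 - coneDist ε c y ≤ 0 := (not_le.mp fun h => hn ⟨h1, h⟩).le
        have h3 : w y = 0 := coneWeight_eq_zero k h2
        have h4 : w' y = 0 := by
          simp only [hw', coneWeightDeriv, max_eq_left h2]
          rw [← hw, h3]
          simp
        simp [hG, h3, h4]
      · have : futurePart u y = 0 := if_pos (not_le.mp h1).le
        simp [hG, hJ, hJ', this]
  have hJ0 : ∀ y, 0 ≤ J 0 y := fun y => (sq_nonneg _).trans (norm_sq_le_reForm (futurePart u y))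
  have hwJ : ∀ y, 0 ≤ w y * J 0 y := fun y => mul_nonneg (coneWeight_nonneg k ε t c y) (hJ0 y)
  -- The divergence has integral zero, so the integral of the continuous nonnegative function w J₀
  -- is at most zero.
  have hzero : w y * J 0 y = 0 := by
    by_contra hne
    have hI : ∫ z, ∑ μ, G μ z = 0 := by
      rw [MeasureTheory.integral_finsetSum _ fun μ _ =>
        (hGc μ).integrable_of_hasCompactSupport (hGs μ)]
      exact Finset.sum_eq_zero fun μ _ => hGi μ
    have hint : MeasureTheory.Integrable (fun z => ∑ μ, G μ z) :=
      MeasureTheory.integrable_finsetSum _ fun μ _ =>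
        (hGc μ).integrable_of_hasCompactSupport (hGs μ)
    have hpos : 0 < ∫ z, w z * J 0 z :=
      (hwc.mul (hJc 0)).integral_pos_of_hasCompactSupport_nonneg_nonzero (hFs 0) hwJ hne
    have hle : ∫ z, ∑ μ, G μ z ≤ ∫ z, -(w z * J 0 z) :=
      MeasureTheory.integral_mono hint
        ((hwc.mul (hJc 0)).integrable_of_hasCompactSupport (hFs 0)).neg key
    rw [hI, MeasureTheory.integral_neg] at hle
    linarith
  have : J 0 y = 0 := (mul_eq_zero.mp hzero).resolve_left (coneWeight_pos k hy).ne'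
  have h := (norm_sq_le_reForm (futurePart u y)).trans_eq this
  exact norm_eq_zero.mp (pow_eq_zero_iff two_ne_zero |>.mp (le_antisymm h (sq_nonneg _)))

/-! ### Uniqueness in light cones. -/

/-- The part between the initial hypersurface and the apex of the light cone with apex
`(s t, c)`, `s = ±1`. -/
def lightCone (s t : ℝ) (c : Fin 3 → ℝ) : Set SpaceTime :=
  {y | 0 ≤ s * y 0 ∧ s * y 0 ≤ t ∧ ∑ i : Fin 3, (y i.succ - c i) ^ 2 ≤ (t - s * y 0) ^ 2}

theorem isClosed_lightCone (s t : ℝ) (c : Fin 3 → ℝ) : IsClosed (lightCone s t c) := by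
  have h0 : IsClosed {y : SpaceTime | 0 ≤ s * y 0} := isClosed_le (by fun_prop) (by fun_prop)
  have h1 : IsClosed {y : SpaceTime | s * y 0 ≤ t} := isClosed_le (by fun_prop) (by fun_prop)
  have h2 : IsClosed {y : SpaceTime | ∑ i : Fin 3, (y i.succ - c i) ^ 2 ≤ (t - s * y 0) ^ 2} :=
    isClosed_le (by fun_prop) (by fun_prop)
  exact h0.inter (h1.inter h2)

theorem isCompact_lightCone {s : ℝ} (hs : s * s = 1) (t : ℝ) (c : Fin 3 → ℝ) :
    IsCompact (lightCone s t c) := by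
  refine (isCompact_Icc (a := (Fin.cons (-t) fun i => c i - t : SpaceTime))
    (b := (Fin.cons t fun i => c i + t : SpaceTime))).of_isClosed_subset
    (isClosed_lightCone s t c) ?_
  rintro y ⟨h1, h2, h3⟩
  have h0 : |y 0| ≤ t := by
    have : |s| = 1 := by
      have := abs_mul_abs_self s
      rw [hs] at this
      nlinarith [abs_nonneg s]
    calc |y 0| = |s * y 0| := by rw [abs_mul, this, one_mul]
      _ ≤ t := by rw [abs_of_nonneg h1]; exact h2
  have h4 : ∀ i : Fin 3, |y i.succ - c i| ≤ t := by
    intro i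
    have h5 := (Finset.single_le_sum (f := fun i : Fin 3 => (y i.succ - c i) ^ 2)
      (fun i _ => sq_nonneg _) (Finset.mem_univ i)).trans h3
    exact (abs_le_of_sq_le_sq h5 (by linarith)).trans (by linarith)
  refine ⟨fun j => ?_, fun j => ?_⟩
  · refine Fin.cases ?_ (fun i => ?_) j
    · exact (abs_le.mp h0).1
    · simp only [Fin.cons_succ]; linarith [(abs_le.mp (h4 i)).1]
  · refine Fin.cases ?_ (fun i => ?_) j
    · exact (abs_le.mp h0).2
    · simp only [Fin.cons_succ]; linarith [(abs_le.mp (h4 i)).2]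

theorem contDiff_smul_of_tsupport_subset {E F : Type*} [NormedAddCommGroup E] [NormedSpace ℝ E]
    [NormedAddCommGroup F] [NormedSpace ℝ F] {ρ : E → ℝ} {u : E → F} {N : Set E} {n : ℕ∞}
    (hρ : ContDiff ℝ ∞ ρ) (hN : IsOpen N) (hρN : tsupport ρ ⊆ N) (hu : ContDiffOn ℝ n u N) :
    ContDiff ℝ n fun y => ρ y • u y := by
  refine contDiff_iff_contDiffAt.mpr fun y => ?_
  by_cases hy : y ∈ N
  · exact ((hρ.of_le (by exact_mod_cast le_top)).contDiffAt).smul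
      (hu.contDiffAt (hN.mem_nhds hy))
  · have h := notMem_tsupport_iff_eventuallyEq.mp fun h => hy (hρN h)
    refine (contDiffAt_const (c := (0 : F))).congr_of_eventuallyEq ?_
    filter_upwards [h] with z hz
    rw [hz]
    exact zero_smul _ _

/-- Uniqueness for the Cauchy problem in a light cone, for globally defined functions. -/
theorem IsHermitianClifford.eq_zero_of_contDiff {A : Fin 3 → SpinMatrix}
    (hA : IsHermitianClifford A) (M : SpinMatrix) {u : SpaceTime → Spinor} (hu : ContDiff ℝ 1 u)
    (h0 : ∀ y, y 0 = 0 → u y = 0) {t : ℝ} {c : Fin 3 → ℝ}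
    (heq : ∀ y ∈ lightCone 1 t c, fderiv ℝ u y (unitVec 0) =
        -∑ i, (A i).mulVec (fderiv ℝ u y (unitVec i.succ)) + M.mulVec (u y))
    {y : SpaceTime} (hy : y ∈ lightCone 1 t c) : u y = 0 := by
  obtain ⟨h1, h2, h3⟩ := hy
  rw [one_mul] at h1 h2 h3
  have interior : ∀ z : SpaceTime, 0 < z 0 → z 0 < t →
      ∑ i : Fin 3, (z i.succ - c i) ^ 2 < (t - z 0) ^ 2 → u z = 0 := by
    intro z hz0 hzt hz
    set S := ∑ i : Fin 3, (z i.succ - c i) ^ 2 with hS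
    -- Using half of the gap keeps the regularised distance of z below t - z₀.
    set ε := √(((t - z 0) ^ 2 - S) / 2) with hε
    have hε2 : ε ^ 2 = ((t - z 0) ^ 2 - S) / 2 := Real.sq_sqrt (by linarith)
    have hpos : 0 < ε := Real.sqrt_pos.mpr (by linarith)
    have hd : 0 < t - z 0 - coneDist ε c z := by
      have : coneDist ε c z ^ 2 < (t - z 0) ^ 2 := by
        rw [coneDist_sq, hε2, ← hS]; linarith
      linarith [lt_of_pow_lt_pow_left₀ 2 (by linarith) this]
    have h := hA.futurePart_eq_zero M hu h0 (t := t) (c := c)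
      (fun y a b d => heq y ⟨by simpa using a, by simpa using b, by simpa using d⟩) hpos hd
    rwa [futurePart, if_neg (not_le.mpr hz0)] at h
  rcases h1.eq_or_lt with h | h
  · exact h0 y h.symm
  -- Boundary points of the cone are limits of interior points, reached by going back in time.
  have htend : Filter.Tendsto (fun δ : ℝ => u (y - δ • unitVec 0)) (nhdsWithin 0 (Set.Ioi 0))
      (nhds (u y)) := by
    have : Continuous fun δ : ℝ => u (y - δ • unitVec 0) := by
      have := hu.continuous
      fun_prop
    simpa using (this.tendsto 0).mono_left nhdsWithin_le_nhds
  refine tendsto_nhds_unique htend (tendsto_const_nhds.congr' ?_)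
  filter_upwards [Ioo_mem_nhdsGT h] with δ hδ
  refine (interior _ ?_ ?_ ?_).symm
  · simpa using hδ.2
  · simp only [Pi.sub_apply, Pi.smul_apply, Pi.single_eq_same, smul_eq_mul, mul_one]
    linarith [hδ.1]
  · have : ∀ i : Fin 3, (y - δ • unitVec 0) i.succ = y i.succ := by
      intro i
      simp [Fin.succ_ne_zero]
    simp only [this]
    refine h3.trans_lt (pow_lt_pow_left₀ ?_ (by linarith) two_ne_zero)
    simp only [Pi.sub_apply, Pi.smul_apply, Pi.single_eq_same, smul_eq_mul, mul_one]
    linarith [hδ.1]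

/-- The rescaling of the time by the factor `s`. -/
def timeScale (s : ℝ) : SpaceTime →L[ℝ] SpaceTime :=
  ContinuousLinearMap.pi (Fin.cons (s • ContinuousLinearMap.proj 0)
    fun i => ContinuousLinearMap.proj i.succ)

theorem timeScale_zero (s : ℝ) (y : SpaceTime) : timeScale s y 0 = s * y 0 := rfl

theorem timeScale_succ (s : ℝ) (y : SpaceTime) (i : Fin 3) : timeScale s y i.succ = y i.succ := rfl

theorem timeScale_timeScale {s : ℝ} (hs : s * s = 1) (y : SpaceTime) :
    timeScale s (timeScale s y) = y := by
  funext j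
  refine Fin.cases ?_ (fun i => ?_) j
  · rw [timeScale_zero, timeScale_zero, ← mul_assoc, hs, one_mul]
  · rw [timeScale_succ, timeScale_succ]

theorem timeScale_unitVec_zero (s : ℝ) : timeScale s (unitVec 0) = s • unitVec 0 := by
  funext j
  refine Fin.cases ?_ (fun i => ?_) j
  · simp [timeScale_zero]
  · simp [timeScale_succ, Fin.succ_ne_zero]

theorem timeScale_unitVec_succ (s : ℝ) (i : Fin 3) :
    timeScale s (unitVec i.succ) = unitVec i.succ := by
  funext j
  refine Fin.cases ?_ (fun k => ?_) j
  · simp [timeScale_zero, (Fin.succ_ne_zero i).symm]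
  · simp [timeScale_succ]

theorem IsHermitianClifford.smul {A : Fin 3 → SpinMatrix} (hA : IsHermitianClifford A) {s : ℝ}
    (hs : s * s = 1) : IsHermitianClifford fun i => s • A i where
  hermitian i := by rw [Matrix.conjTranspose_smul, hA.hermitian, star_trivial]
  sq i := by simp only [smul_mul_smul_comm, hs, one_smul, hA.sq]
  anti i j h := by simp only [smul_mul_smul_comm, hs, one_smul, hA.anti i j h]

/-- Uniqueness for the Cauchy problem in a light cone. -/
theorem IsHermitianClifford.eq_zero_on_lightCone {A : Fin 3 → SpinMatrix}
    (hA : IsHermitianClifford A) (M : SpinMatrix) {N : Set SpaceTime} (hN : IsOpen N)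
    {u : SpaceTime → Spinor} (hu : ContDiffOn ℝ 1 u N) (h0 : ∀ y ∈ N, y 0 = 0 → u y = 0)
    {s t : ℝ} (hs : s * s = 1) {c : Fin 3 → ℝ} (hKN : lightCone s t c ⊆ N)
    (heq : ∀ y ∈ lightCone s t c, fderiv ℝ u y (unitVec 0) =
        -∑ i, (A i).mulVec (fderiv ℝ u y (unitVec i.succ)) + M.mulVec (u y))
    {y : SpaceTime} (hy : y ∈ lightCone s t c) : u y = 0 := by
  -- A cutoff equal to 1 near the cone extends u to a global C¹ function without altering it where
  -- the equation is used.
  obtain ⟨ρ, hρ, -, hρN, hρK⟩ := exists_contDiff_bump (isCompact_lightCone hs t c) hN hKN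
  set f : SpaceTime → Spinor := fun y => ρ y • u y with hf
  have hfd : ContDiff ℝ 1 f := by
    have := contDiff_smul_of_tsupport_subset (n := 1) hρ hN hρN (by exact_mod_cast hu)
    exact_mod_cast this
  have hfu : ∀ y ∈ lightCone s t c, f =ᶠ[nhds y] u := fun y hy => by
    filter_upwards [hρK y hy] with z hz
    rw [hf]
    simp only [hz, one_smul]
  have hf0 : ∀ y, y 0 = 0 → f y = 0 := by
    intro y hy
    by_cases hyN : y ∈ N
    · simp [hf, h0 y hyN hy]
    · have : ρ y = 0 := by
        by_contra h
        exact hyN (hρN (subset_tsupport _ h))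
      simp [hf, this]
  -- Time reflection reduces s = -1 to s = 1: it multiplies the Aᵢ and M by s, which preserves the
  -- Clifford relations.
  set v : SpaceTime → Spinor := fun y => f (timeScale s y) with hv
  have hmem : ∀ y ∈ lightCone 1 t c, timeScale s y ∈ lightCone s t c := by
    rintro y ⟨h1, h2, h3⟩
    refine ⟨?_, ?_, ?_⟩ <;> simp only [timeScale_zero, timeScale_succ, ← mul_assoc, hs] <;>
      assumption
  have hvd : ∀ y d, fderiv ℝ v y d = fderiv ℝ f (timeScale s y) (timeScale s d) := by
    intro y d
    have h1 : HasFDerivAt v ((fderiv ℝ f (timeScale s y)).comp (timeScale s)) y :=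
      ((hfd.differentiable one_ne_zero _).hasFDerivAt).comp y (timeScale s).hasFDerivAt
    rw [h1.fderiv]
    rfl
  have hvc : ContDiff ℝ 1 v := hfd.comp (timeScale s).contDiff
  have key : ∀ y ∈ lightCone 1 t c, fderiv ℝ v y (unitVec 0) =
      -∑ i, (s • A i).mulVec (fderiv ℝ v y (unitVec i.succ)) + (s • M).mulVec (v y) := by
    intro y hy
    have h1 := hmem y hy
    have h2 := heq _ h1
    simp only [hvd, timeScale_unitVec_zero, timeScale_unitVec_succ, map_smul]
    rw [(hfu _ h1).fderiv_eq, h2]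
    have h3 : v y = u (timeScale s y) := (hfu _ h1).self_of_nhds
    rw [h3]
    simp only [Matrix.smul_mulVec, smul_add, smul_neg, Finset.smul_sum]
  have hy' : timeScale s y ∈ lightCone 1 t c := by
    obtain ⟨h1, h2, h3⟩ := hy
    refine ⟨?_, ?_, ?_⟩ <;> simp only [timeScale_zero, timeScale_succ, one_mul] <;> assumption
  have h := (hA.smul hs).eq_zero_of_contDiff (s • M) hvc
    (fun y hy => hf0 _ (by rw [timeScale_zero, hy, mul_zero])) key hy'
  rw [hv] at h
  simp only [timeScale_timeScale hs] at h
  rw [← h]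
  exact (hfu y hy).self_of_nhds.symm

/-! ### Exponential solutions and prescribed jets at the apex of a cone. -/

theorem onParticle_mul (k : Fin 2) (A B : Mat4) :
    onParticle k (A * B) = onParticle k A * onParticle k B := by
  unfold onParticle
  split_ifs <;> simp [← Matrix.mul_kronecker_mul]

theorem onParticle_neg (k : Fin 2) (A : Mat4) : onParticle k (-A) = -onParticle k A := by
  unfold onParticle
  split_ifs <;> ext <;> simp [Matrix.kroneckerMap_apply]

/-- The potential together with the mass term. -/
def massPotential (γ : Fin 4 → Mat4) (m : Fin 2 → ℝ) (k : Fin 2) (W : SpinMatrix) : SpinMatrix :=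
  (m k : ℂ) • onParticle k (γ 0) + W

theorem satisfiesDiracAt_iff (γ : Fin 4 → Mat4) (m : Fin 2 → ℝ) (k : Fin 2)
    (W : Config → SpinMatrix) (ψ : Config → Spinor) (X : Config) :
    SatisfiesDiracAt γ m k W ψ X ↔ fderiv ℝ ψ X (Pi.single k (unitVec 0)) =
      -∑ i : Fin 3, (onParticle k (γ 0 * γ i.succ)).mulVec
          (fderiv ℝ ψ X (Pi.single k (unitVec i.succ))) -
        Complex.I • (massPotential γ m k (W X)).mulVec (ψ X) := by
  unfold SatisfiesDiracAt freeDirac partialD massPotential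
  simp only [← onParticle_mul, Matrix.add_mulVec, Matrix.smul_mulVec]
  have hI : ∀ a b : Spinor, Complex.I • a = b ↔ a = -Complex.I • b := by
    intro a b
    constructor
    · rintro rfl
      rw [smul_smul, neg_mul, Complex.I_mul_I, neg_neg, one_smul]
    · rintro rfl
      rw [smul_smul, mul_neg, Complex.I_mul_I, neg_neg, one_smul]
  rw [hI]
  have e : -Complex.I • (-Complex.I • ∑ i : Fin 3, (onParticle k (γ 0 * γ i.succ)).mulVec
          (fderiv ℝ ψ X (Pi.single k (unitVec i.succ)))) =
      -∑ i : Fin 3, (onParticle k (γ 0 * γ i.succ)).mulVec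
          (fderiv ℝ ψ X (Pi.single k (unitVec i.succ))) := by
    rw [smul_smul, neg_mul_neg, Complex.I_mul_I, neg_one_smul]
  rw [smul_add, smul_add, e]
  constructor <;> intro h <;> rw [h] <;> module

theorem IsGammaRep.isHermitianClifford {γ : Fin 4 → Mat4} (hγ : IsGammaRep γ) (k : Fin 2) :
    IsHermitianClifford fun i => onParticle k (γ 0 * γ i.succ) where
  hermitian i := by
    unfold onParticle
    split_ifs <;> simp only [Matrix.conjTranspose_kronecker, hγ.alpha_isHermitian,
      Matrix.conjTranspose_one]
  sq i := by
    rw [← onParticle_mul, hγ.isDiracFrame.sq_alpha]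
    unfold onParticle
    split_ifs <;> simp
  anti i j h := by
    rw [← onParticle_mul, ← onParticle_mul, hγ.isDiracFrame.anti_alpha i j h, onParticle_neg]

/-- A derivative in the direction of a ray on which the function vanishes. -/
theorem fderiv_eq_zero_of_ray {E F : Type*} [NormedAddCommGroup E] [NormedSpace ℝ E]
    [NormedAddCommGroup F] [NormedSpace ℝ F] {u : E → F} {x d : E}
    (hu : DifferentiableAt ℝ u x) (hx : u x = 0)
    (h : ∀ᶠ r in nhdsWithin (0 : ℝ) (Set.Ioi 0), u (x + r • d) = 0) : fderiv ℝ u x d = 0 := by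
  have h1 : HasDerivAt (fun r : ℝ => u (x + r • d)) (fderiv ℝ u x d) 0 := by
    have h2 : HasDerivAt (fun r : ℝ => x + r • d) d 0 := by
      simpa using ((hasDerivAt_id (0 : ℝ)).smul_const d).const_add x
    have h3 : HasFDerivAt u (fderiv ℝ u x) (x + (0 : ℝ) • d) := by
      simpa using hu.hasFDerivAt
    exact h3.comp_hasDerivAt (0 : ℝ) h2
  refine (uniqueDiffWithinAt_Ioi (0 : ℝ)).eq_deriv _ h1.hasDerivWithinAt ?_
  refine (hasDerivWithinAt_const (0 : ℝ) _ (0 : F)).congr_of_eventuallyEq h ?_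
  simp [hx]

/-- The spatial derivatives at the apex of a light cone on which the function vanishes. -/
theorem fderiv_eq_zero_at_apex {u : SpaceTime → Spinor} {x : SpaceTime}
    (hu : DifferentiableAt ℝ u x) {s t : ℝ} (hs : s * s = 1) (ht : 0 ≤ t) (hx : x 0 = s * t)
    (hcone : ∀ y ∈ lightCone s t (fun i => x i.succ), u y = 0)
    (hbase : ∀ᶠ y in nhds x, y 0 = 0 → u y = 0) (a : Fin 3) :
    fderiv ℝ u x (unitVec a.succ) = 0 := by
  have hsx : s * x 0 = t := by rw [hx, ← mul_assoc, hs, one_mul]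
  have hux : u x = 0 := hcone x ⟨by rw [hsx]; exact ht, hsx.le, by simp [hsx]⟩
  rcases ht.eq_or_lt with h0 | h0
  -- For t = 0 the cone is only a point, and the vanishing on the initial surface near x has to be
  -- used instead.
  · refine fderiv_eq_zero_of_ray hu hux ?_
    have hc : Filter.Tendsto (fun r : ℝ => x + r • unitVec a.succ) (nhds 0) (nhds x) := by
      have : Continuous fun r : ℝ => x + r • unitVec a.succ := by fun_prop
      simpa using this.tendsto 0
    filter_upwards [nhdsWithin_le_nhds (hc.eventually hbase)] with r hr
    refine hr ?_
    simp [hx, ← h0, (Fin.succ_ne_zero a).symm]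
  -- Rays from the apex with velocity at most 1 stay in the cone for a short time. The spatial
  -- direction is the difference of a lightlike one (b = 1) and the time axis (b = 0).
  · have hray : ∀ b : ℝ, b * b ≤ 1 → fderiv ℝ u x (-s • unitVec 0 + b • unitVec a.succ) = 0 := by
      intro b hb
      refine fderiv_eq_zero_of_ray hu hux ?_
      filter_upwards [Ioo_mem_nhdsGT h0] with r hr
      have e0 : s * (x + r • (-s • unitVec 0 + b • unitVec a.succ)) 0 = t - r := by
        simp only [Pi.add_apply, Pi.smul_apply, smul_eq_mul, Pi.single_eq_same,
          Pi.single_eq_of_ne (Fin.succ_ne_zero a).symm, mul_add, hsx]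
        linear_combination (-r) * hs
      have e1 : ∀ i : Fin 3, (x + r • (-s • unitVec 0 + b • unitVec a.succ)) i.succ - x i.succ =
          if i = a then r * b else 0 := by
        intro i
        simp [Pi.single_apply, Fin.succ_ne_zero]
      refine hcone _ ⟨by rw [e0]; linarith [hr.2], by rw [e0]; linarith [hr.1], ?_⟩
      simp only [e1, e0]
      simp only [ite_pow, Finset.sum_ite_eq', Finset.sum_ite_eq, Finset.mem_univ, if_true, ne_eq,
        OfNat.ofNat_ne_zero, not_false_eq_true, zero_pow]
      nlinarith [mul_nonneg (sq_nonneg r) (sub_nonneg.mpr hb)]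
    have h1 := hray 0 (by norm_num)
    have h2 := hray 1 (by norm_num)
    rw [map_add, map_smul, map_smul] at h1 h2
    simpa [zero_smul] using h2.trans h1.symm

/-- The spatial coordinates of a configuration. -/
def spatialCoord : Fin 3 ⊕ Fin 3 → Config →L[ℝ] ℝ :=
  Sum.elim (fun i => (ContinuousLinearMap.proj i.succ : SpaceTime →L[ℝ] ℝ).comp
      (ContinuousLinearMap.proj 0))
    fun i => (ContinuousLinearMap.proj i.succ : SpaceTime →L[ℝ] ℝ).comp
      (ContinuousLinearMap.proj 1)

/-- The spatial coordinate vectors of the configuration space. -/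
def spatialVec : Fin 3 ⊕ Fin 3 → Config :=
  Sum.elim (fun i => Pi.single 0 (unitVec i.succ)) fun i => Pi.single 1 (unitVec i.succ)

theorem spatialCoord_spatialVec (l l' : Fin 3 ⊕ Fin 3) :
    spatialCoord l (spatialVec l') = if l = l' then 1 else 0 := by
  rcases l with i | i <;> rcases l' with j | j <;>
    simp [spatialCoord, spatialVec, Pi.single_apply]

theorem spatialCoord_time (l : Fin 3 ⊕ Fin 3) (k : Fin 2) :
    spatialCoord l (Pi.single k (unitVec 0)) = 0 := by
  rcases l with i | i <;> fin_cases k <;> simp [spatialCoord, Fin.succ_ne_zero]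

/-- The solution of `g' = P g` with the initial value `w`. -/
def expFlow (P : SpinMatrix) (w : Spinor) (r : ℝ) : Spinor :=
  NormedSpace.exp (r • mulVecBilin P) w

theorem expFlow_zero (P : SpinMatrix) (w : Spinor) : expFlow P w 0 = w := by
  rw [expFlow, zero_smul ℝ (mulVecBilin P), NormedSpace.exp_zero]
  rfl

theorem hasDerivAt_expFlow (P : SpinMatrix) (w : Spinor) (r : ℝ) :
    HasDerivAt (expFlow P w) (P.mulVec (expFlow P w r)) r := by
  have := (hasDerivAt_exp_smul_const' (mulVecBilin P) r).clm_apply (hasDerivAt_const r w)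
  refine HasDerivAt.congr_deriv this ?_
  rw [map_zero, add_zero]
  rfl

/-- A plane wave with complex momenta: exponential in the positions, with a time dependence on the
first particle generated by `P`. -/
def planeWave (q : Fin 3 ⊕ Fin 3 → ℝ) (P : SpinMatrix) (X₀ : Config) (w : Spinor)
    (X : Config) : Spinor :=
  Real.exp (∑ l, q l * spatialCoord l (X - X₀)) •
    expFlow P w (X 0 0 - X₀ 0 0)

theorem planeWave_self (q : Fin 3 ⊕ Fin 3 → ℝ) (P : SpinMatrix) (X₀ : Config) (w : Spinor) :
    planeWave q P X₀ w X₀ = w := by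
  simp [planeWave, expFlow_zero]

theorem hasFDerivAt_planeWave (q : Fin 3 ⊕ Fin 3 → ℝ) (P : SpinMatrix) (X₀ : Config) (w : Spinor)
    (X : Config) :
    HasFDerivAt (planeWave q P X₀ w)
      ((∑ l, q l • spatialCoord l).smulRight (planeWave q P X₀ w X) +
        ((ContinuousLinearMap.proj 0 : SpaceTime →L[ℝ] ℝ).comp
          (ContinuousLinearMap.proj 0 : Config →L[ℝ] SpaceTime)).smulRight
            (P.mulVec (planeWave q P X₀ w X))) X := by
  have h1 : HasFDerivAt (fun X : Config => ∑ l, q l * spatialCoord l (X - X₀))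
      (∑ l, q l • spatialCoord l) X := by
    refine HasFDerivAt.fun_sum fun l _ => HasFDerivAt.const_mul ?_ (q l)
    exact (spatialCoord l).hasFDerivAt.comp X (hasFDerivAt_sub_const X₀)
  have h3 : HasFDerivAt (fun X : Config => X 0 0 - X₀ 0 0)
      ((ContinuousLinearMap.proj 0 : SpaceTime →L[ℝ] ℝ).comp
          (ContinuousLinearMap.proj 0 : Config →L[ℝ] SpaceTime)) X :=
    (((ContinuousLinearMap.proj 0 : SpaceTime →L[ℝ] ℝ).comp
          (ContinuousLinearMap.proj 0 : Config →L[ℝ] SpaceTime)).hasFDerivAt).sub_const _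
  have h4 := h1.exp.smul
    (HasFDerivAt.comp X (hasDerivAt_expFlow P w (X 0 0 - X₀ 0 0)).hasFDerivAt h3)
  refine h4.congr_fderiv ?_
  ext1 v
  simp [planeWave, Matrix.mulVec_smul, smul_smul]
  module

theorem contDiff_planeWave (q : Fin 3 ⊕ Fin 3 → ℝ) (P : SpinMatrix) (X₀ : Config) (w : Spinor) :
    ContDiff ℝ 1 (planeWave q P X₀ w) := by
  have hc : Continuous (planeWave q P X₀ w) :=
    continuous_iff_continuousAt.mpr fun X => (hasFDerivAt_planeWave q P X₀ w X).continuousAt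
  refine contDiff_one_iff_fderiv.mpr
    ⟨fun X => (hasFDerivAt_planeWave q P X₀ w X).differentiableAt, ?_⟩
  rw [funext fun X => (hasFDerivAt_planeWave q P X₀ w X).fderiv]
  have h2 : Continuous fun X => P.mulVec (planeWave q P X₀ w X) :=
    (mulVecBilin P).continuous.comp hc
  fun_prop

theorem fderiv_planeWave_spatial (q : Fin 3 ⊕ Fin 3 → ℝ) (P : SpinMatrix) (X₀ : Config)
    (w : Spinor) (X : Config) (l : Fin 3 ⊕ Fin 3) :
    fderiv ℝ (planeWave q P X₀ w) X (spatialVec l) = q l • planeWave q P X₀ w X := by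
  rw [(hasFDerivAt_planeWave q P X₀ w X).fderiv]
  have : (spatialVec l : Config) 0 0 = 0 := by
    rcases l with i | i <;> simp [spatialVec, (Fin.succ_ne_zero i).symm]
  simp only [_root_.add_apply, ContinuousLinearMap.smulRight_apply, sum_apply, _root_.smul_apply,
    spatialCoord_spatialVec, ContinuousLinearMap.comp_apply, ContinuousLinearMap.proj_apply, this,
    zero_smul, add_zero, smul_eq_mul, mul_ite, mul_one, mul_zero, Finset.sum_ite_eq',
    Finset.mem_univ, if_true]

theorem fderiv_planeWave_time (q : Fin 3 ⊕ Fin 3 → ℝ) (P : SpinMatrix) (X₀ : Config)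
    (w : Spinor) (X : Config) :
    fderiv ℝ (planeWave q P X₀ w) X (Pi.single 0 (unitVec 0)) =
      P.mulVec (planeWave q P X₀ w X) := by
  rw [(hasFDerivAt_planeWave q P X₀ w X).fderiv]
  simp [spatialCoord_time]

/-- The configurations whose difference lies in `D`. -/
def diffConfig (D : Set SpaceTime) : Set Config := {X | X 0 - X 1 ∈ D}

theorem isOpen_diffConfig {D : Set SpaceTime} (hD : IsOpen D) : IsOpen (diffConfig D) :=
  hD.preimage ((continuous_apply 0).sub (continuous_apply 1))

/-- Points of space as space-time points at time `0`. -/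
def spatialEmb : (Fin 3 → ℝ) →L[ℝ] SpaceTime :=
  ContinuousLinearMap.pi (Fin.cons 0 fun i => ContinuousLinearMap.proj i)

/-- The spatial part of a space-time point. -/
def spatialPart : SpaceTime →L[ℝ] (Fin 3 → ℝ) :=
  ContinuousLinearMap.pi fun i => ContinuousLinearMap.proj i.succ

theorem spatialPart_apply (y : SpaceTime) (i : Fin 3) : spatialPart y i = y i.succ := rfl

theorem spatialEmb_zero (z : Fin 3 → ℝ) : spatialEmb z 0 = 0 := rfl

theorem spatialEmb_succ (z : Fin 3 → ℝ) (i : Fin 3) : spatialEmb z i.succ = z i := rfl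

theorem spatialEmb_spatialPart {y : SpaceTime} (hy : y 0 = 0) : spatialEmb (spatialPart y) = y := by
  funext j
  refine Fin.cases ?_ (fun i => ?_) j
  · rw [spatialEmb_zero, hy]
  · rw [spatialEmb_succ, spatialPart_apply]

theorem spatialEmb_single (b : Fin 3) : spatialEmb (Pi.single b 1) = unitVec b.succ := by
  funext j
  refine Fin.cases ?_ (fun i => ?_) j
  · rw [spatialEmb_zero]
    exact (Pi.single_eq_of_ne (M := fun _ : Fin 4 => ℝ) (Fin.succ_ne_zero b).symm 1).symm
  · rw [spatialEmb_succ]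
    simp [Pi.single_apply]

/-- `atTimeZero` as a linear map. -/
def atTimeZeroL : (Fin 2 → Fin 3 → ℝ) →L[ℝ] Config :=
  ContinuousLinearMap.pi fun k => spatialEmb.comp (ContinuousLinearMap.proj k)

theorem atTimeZero_eq (q : Fin 2 → Fin 3 → ℝ) : atTimeZero q = atTimeZeroL q := by
  funext k j
  refine Fin.cases ?_ (fun i => ?_) j <;> rfl

/-- The translate by `v` of the configuration `(y, 0)`. -/
def shiftConfig (v y : SpaceTime) : Config := Pi.single 0 y + fun _ => v

theorem shiftConfig_zero (v y : SpaceTime) : shiftConfig v y 0 = y + v := by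
  simp [shiftConfig]

theorem shiftConfig_one (v y : SpaceTime) : shiftConfig v y 1 = v := by
  simp [shiftConfig]

theorem shiftConfig_sub (v y : SpaceTime) : shiftConfig v y 0 - shiftConfig v y 1 = y := by
  rw [shiftConfig_zero, shiftConfig_one, add_sub_cancel_right]

theorem hasFDerivAt_shiftConfig (v y : SpaceTime) :
    HasFDerivAt (shiftConfig v) (ContinuousLinearMap.single ℝ (fun _ : Fin 2 => SpaceTime) 0) y :=
  ((ContinuousLinearMap.single ℝ (fun _ : Fin 2 => SpaceTime) 0).hasFDerivAt (x := y)).add_const _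

theorem contDiff_shiftConfig (v : SpaceTime) : ContDiff ℝ 1 (shiftConfig v) :=
  (ContinuousLinearMap.single ℝ (fun _ : Fin 2 => SpaceTime) 0).contDiff.add contDiff_const

theorem contDiff_planeWave_atTimeZero (q : Fin 3 ⊕ Fin 3 → ℝ) (P : SpinMatrix) (X₀ : Config)
    (w : Spinor) : ContDiff ℝ ∞ fun z => planeWave q P X₀ w (atTimeZero z) := by
  have h1 : ∀ l, ContDiff ℝ ∞ fun z => spatialCoord l (atTimeZero z - X₀) := fun l => by
    simp only [atTimeZero_eq]
    fun_prop
  have h2 : ContDiff ℝ ∞ fun z => ∑ l, q l * spatialCoord l (atTimeZero z - X₀) :=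
    ContDiff.sum fun l _ => contDiff_const.mul (h1 l)
  exact h2.exp.smul (contDiff_const (c := expFlow P w (0 - X₀ 0 0)))

/-- If the first potential is constant on a backward or forward light cone, then there are solutions
with prescribed exponential spatial behaviour to first order at the apex. -/
theorem exists_solution_of_jet {γ : Fin 4 → Mat4} (hγ : IsGammaRep γ) {m : Fin 2 → ℝ}
    {D : Set SpaceTime} (hD : IsOpen D) {V : Fin 2 → Config → SpinMatrix}
    (hsol : SolvableForAllData γ m (diffConfig D) V) {s t : ℝ} (hs : s * s = 1) (ht : 0 ≤ t)
    {x : SpaceTime} (hx : x 0 = s * t) (hKD : lightCone s t (spatialPart x) ⊆ D) {c : SpinMatrix}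
    (hc : ∀ X : Config, X 0 - X 1 ∈ lightCone s t (spatialPart x) → V 0 X = c)
    (q : Fin 3 ⊕ Fin 3 → ℝ) (w : Spinor) :
    ∃ ψ : Config → Spinor, ContDiffOn ℝ 2 ψ (diffConfig D) ∧
      SolvesSystem γ m (diffConfig D) V ψ ∧ ψ (Pi.single 0 x) = w ∧
      ∀ l, fderiv ℝ ψ (Pi.single 0 x) (spatialVec l) = q l • w := by
  set K := lightCone s t (spatialPart x) with hK
  have hKc : IsCompact K := isCompact_lightCone hs t _
  have hsx : s * x 0 = t := by rw [hx, ← mul_assoc, hs, one_mul]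
  have hxK : x ∈ K := ⟨by rw [hsx]; exact ht, hsx.le, by simp [spatialPart_apply, hsx]⟩
  have hΩ := isOpen_diffConfig hD
  set X₀ : Config := Pi.single 0 x with hX₀
  set M : SpinMatrix := -Complex.I • massPotential γ m 0 c with hM
  -- With this generator the exponential wave ξ solves the first equation with the constant
  -- potential c.
  set P : SpinMatrix := -∑ i : Fin 3, q (Sum.inl i) • onParticle 0 (γ 0 * γ i.succ) + M with hP
  set ξ := planeWave q P X₀ w with hξ
  have hξd : ContDiff ℝ 1 ξ := contDiff_planeWave q P X₀ w
  -- the initial values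
  set S : Set (Fin 2 → Fin 3 → ℝ) := atTimeZero ⁻¹' diffConfig D with hS
  have hatc : Continuous atTimeZero := by
    rw [funext atTimeZero_eq]
    exact atTimeZeroL.continuous
  have hSo : IsOpen S := hΩ.preimage hatc
  set β : SpaceTime → Fin 2 → Fin 3 → ℝ := fun y => Pi.single 0 (spatialPart y) with hβ
  have hβc : Continuous β := by
    rw [hβ]
    exact (ContinuousLinearMap.single ℝ (fun _ : Fin 2 => Fin 3 → ℝ) 0).continuous.comp
      spatialPart.continuous
  -- Projecting a point of the cone to time zero does not leave the cone, so the relevant initial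
  -- configurations are admissible.
  have hβS : β '' K ⊆ S := by
    rintro _ ⟨y, hy, rfl⟩
    refine hKD ?_
    have e : atTimeZero (β y) 0 - atTimeZero (β y) 1 = spatialEmb (spatialPart y) := by
      rw [atTimeZero_eq]
      change spatialEmb (β y 0) - spatialEmb (β y 1) = _
      simp [hβ]
    rw [e]
    obtain ⟨h1, h2, h3⟩ := hy
    refine ⟨by simp [spatialEmb_zero], by simpa [spatialEmb_zero] using ht, ?_⟩
    simp only [spatialEmb_zero, spatialEmb_succ, spatialPart_apply, mul_zero, sub_zero]
    exact h3.trans (pow_le_pow_left₀ (by linarith) (by linarith) 2)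
  obtain ⟨χ, hχd, hχc, hχS, hχ1⟩ := exists_contDiff_bump (hKc.image hβc) hSo hβS
  obtain ⟨ψ, hψd, hψs, hψ0⟩ := hsol (fun z => χ z • ξ (atTimeZero z))
    (hχd.smul (contDiff_planeWave_atTimeZero q P X₀ w)) hχc.smul_right
    ((tsupport_smul_subset_left _ _).trans hχS)
  set W : Set (Fin 2 → Fin 3 → ℝ) := {z | ∀ᶠ z' in nhds z, χ z' = 1} with hW
  have hWo : IsOpen W := isOpen_setOfPred_eventually_nhds
  -- the difference of the solution and the plane wave
  set Δ : Config → Spinor := fun X => ψ X - ξ X with hΔ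
  have hΔd : ContDiffOn ℝ 1 Δ (diffConfig D) :=
    (hψd.of_le (by norm_num)).sub hξd.contDiffOn
  have hΔd' : ∀ X ∈ diffConfig D, DifferentiableAt ℝ Δ X := fun X hX =>
    (hΔd.contDiffAt (hΩ.mem_nhds hX)).differentiableAt one_ne_zero
  have hmem : ∀ v, ∀ y ∈ D, shiftConfig v y ∈ diffConfig D := fun v y hy => by
    change _ ∈ D
    rwa [shiftConfig_sub]
  -- The configurations used are (y + z, z) with z purely spatial, so the second time stays zero. In
  -- `N z` the cutoff of the initial values is inactive.
  set N : (Fin 3 → ℝ) → Set SpaceTime := fun z =>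
    D ∩ (fun y => β y + fun _ => z) ⁻¹' W with hN
  have hNo : ∀ z, IsOpen (N z) := fun z =>
    hD.inter (hWo.preimage (hβc.add continuous_const))
  have hu : ∀ z, ContDiffOn ℝ 1 (fun y => Δ (shiftConfig (spatialEmb z) y)) (N z) := fun z =>
    hΔd.comp (contDiff_shiftConfig _).contDiffOn fun y hy => hmem _ y hy.1
  have hufd : ∀ z, ∀ y ∈ D, ∀ d, fderiv ℝ (fun y => Δ (shiftConfig (spatialEmb z) y)) y d =
      fderiv ℝ Δ (shiftConfig (spatialEmb z) y) (Pi.single 0 d) := by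
    intro z y hy d
    have h := ((hΔd' _ (hmem (spatialEmb z) y hy)).hasFDerivAt).comp y
      (hasFDerivAt_shiftConfig (spatialEmb z) y)
    exact congrArg (fun T => T d) h.fderiv
  have hu0 : ∀ z, ∀ y ∈ N z, y 0 = 0 → Δ (shiftConfig (spatialEmb z) y) = 0 := by
    intro z y hy hy0
    have e : shiftConfig (spatialEmb z) y = atTimeZero (β y + fun _ => z) := by
      rw [atTimeZero_eq, map_add]
      have e1 : atTimeZeroL (β y) = Pi.single 0 y := by
        funext k
        change spatialEmb (β y k) = _
        refine Fin.cases ?_ (fun i => ?_) k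
        · simp [hβ, spatialEmb_spatialPart hy0]
        · simp [hβ, Fin.succ_ne_zero]
      rw [e1]
      rfl
    have h1 : χ (β y + fun _ => z) = 1 :=
      Filter.Eventually.self_of_nhds (p := fun z' => χ z' = 1) hy.2
    have h2 := hψ0 (β y + fun _ => z) (e ▸ hmem (spatialEmb z) y hy.1)
    rw [e, hΔ]
    simp only [h2, h1, one_smul, sub_self]
  -- Compactness of the cone makes this uniform in small shifts z; the shifts provide the
  -- derivatives in the second position.
  have hKN : ∀ᶠ z in nhds (0 : Fin 3 → ℝ), K ⊆ N z := by
    have h := hKc.eventually_forall_of_forall_eventually (x₀ := (0 : Fin 3 → ℝ))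
      (P := fun (z : Fin 3 → ℝ) (y : SpaceTime) => (β y + fun _ => z) ∈ W) fun y hy => by
        have hcont : Continuous fun p : (Fin 3 → ℝ) × SpaceTime =>
            β p.2 + fun _ => p.1 := by fun_prop
        have h0 : β y + (fun _ => (0 : Fin 3 → ℝ)) ∈ W := by
          have : β y + (fun _ => (0 : Fin 3 → ℝ)) = β y := add_zero _
          rw [this]
          exact hχ1 _ ⟨y, hy, rfl⟩
        exact (hcont.tendsto (0, y)).eventually (hWo.mem_nhds h0)
    filter_upwards [h] with z hz y hy
    exact ⟨hKD hy, hz y hy⟩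
  -- For fixed z only the first equation matters, and on the cone its coefficients are constant.
  -- Uniqueness applies to the difference of ψ and ξ.
  have hcone : ∀ z, K ⊆ N z → ∀ y ∈ K, Δ (shiftConfig (spatialEmb z) y) = 0 := by
    intro z hz y hy
    refine (hγ.isHermitianClifford 0).eq_zero_on_lightCone M (hNo z) (hu z) (hu0 z) hs hz ?_ hy
    intro y hy
    have hyD := hKD hy
    simp only [hufd z y hyD]
    set Y := shiftConfig (spatialEmb z) y with hY
    have hYΩ : Y ∈ diffConfig D := hmem _ y hyD
    have hψY : DifferentiableAt ℝ ψ Y :=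
      (hψd.contDiffAt (hΩ.mem_nhds hYΩ)).differentiableAt two_ne_zero
    have hξY : DifferentiableAt ℝ ξ Y := hξd.differentiable one_ne_zero Y
    have hfd : ∀ d, fderiv ℝ Δ Y d = fderiv ℝ ψ Y d - fderiv ℝ ξ Y d := fun d =>
      congrArg (fun T => T d) (fderiv_fun_sub hψY hξY)
    have h1 := (satisfiesDiracAt_iff γ m 0 (V 0) ψ Y).mp (hψs 0 Y hYΩ)
    rw [hc Y (by rw [hY, shiftConfig_sub]; exact hy)] at h1
    have h2 : fderiv ℝ ξ Y (Pi.single 0 (unitVec 0)) = P.mulVec (ξ Y) :=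
      fderiv_planeWave_time q P X₀ w Y
    have h3 : ∀ i : Fin 3, fderiv ℝ ξ Y (Pi.single 0 (unitVec i.succ)) = q (Sum.inl i) • ξ Y :=
      fun i => fderiv_planeWave_spatial q P X₀ w Y (Sum.inl i)
    have h4 : Δ Y = ψ Y - ξ Y := rfl
    simp only [hfd, h1, h2, h3, h4, hP, hM, Matrix.mulVec_sub, Matrix.add_mulVec,
      Matrix.neg_mulVec, Matrix.sum_mulVec, Matrix.smul_mulVec, Matrix.mulVec_smul,
      Finset.sum_sub_distrib]
    module
  have hK0 : K ⊆ N 0 := hKN.self_of_nhds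
  have hshift0 : ∀ y, shiftConfig (spatialEmb 0) y = Pi.single 0 y := fun y => by
    rw [map_zero]
    exact add_zero _
  have hX₀Ω : X₀ ∈ diffConfig D := by
    have := hmem (spatialEmb 0) x (hKD hxK)
    rwa [hshift0] at this
  have hΔX₀ : Δ X₀ = 0 := by
    have := hcone 0 hK0 x hxK
    rwa [hshift0] at this
  have hder1 : ∀ a : Fin 3, fderiv ℝ Δ X₀ (Pi.single 0 (unitVec a.succ)) = 0 := by
    intro a
    have h := fderiv_eq_zero_at_apex
      (((hu 0).contDiffAt ((hNo 0).mem_nhds (hK0 hxK))).differentiableAt one_ne_zero) hs ht hx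
      (hcone 0 hK0) (by filter_upwards [(hNo 0).mem_nhds (hK0 hxK)] with y hy using hu0 0 y hy) a
    rwa [hufd 0 x (hKD hxK), hshift0] at h
  have hder2 : ∀ b : Fin 3, fderiv ℝ Δ X₀ (fun _ => unitVec b.succ) = 0 := by
    intro b
    refine fderiv_eq_zero_of_ray (hΔd' X₀ hX₀Ω) hΔX₀ ?_
    have hcont : Filter.Tendsto (fun r : ℝ => r • (Pi.single b 1 : Fin 3 → ℝ)) (nhds 0)
        (nhds 0) := by
      have : Continuous fun r : ℝ => r • (Pi.single b 1 : Fin 3 → ℝ) := by fun_prop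
      simpa using this.tendsto 0
    filter_upwards [nhdsWithin_le_nhds (hcont.eventually hKN)] with r hr
    have h := hcone _ hr x hxK
    rw [map_smul, spatialEmb_single] at h
    exact h
  have hder : ∀ l, fderiv ℝ Δ X₀ (spatialVec l) = 0 := by
    rintro (a | b)
    · exact hder1 a
    -- The joint translation is the sum of the translations of the two particles, so subtracting the
    -- derivative in the first position leaves that in the second.
    · have e : (fun _ => unitVec b.succ : Config) =
          Pi.single 0 (unitVec b.succ) + Pi.single 1 (unitVec b.succ) := by
        funext k
        fin_cases k <;> simp
      have h := hder2 b
      rw [e, map_add, hder1 b, zero_add] at h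
      exact h
  refine ⟨ψ, hψd, hψs, ?_, fun l => ?_⟩
  · have h := sub_eq_zero.mp hΔX₀
    rw [h]
    exact planeWave_self q P X₀ w
  · have hψY : DifferentiableAt ℝ ψ X₀ :=
      (hψd.contDiffAt (hΩ.mem_nhds hX₀Ω)).differentiableAt two_ne_zero
    have hξY : DifferentiableAt ℝ ξ X₀ := hξd.differentiable one_ne_zero X₀
    have hfd : fderiv ℝ Δ X₀ (spatialVec l) = fderiv ℝ ψ X₀ (spatialVec l) -
        fderiv ℝ ξ X₀ (spatialVec l) :=
      congrArg (fun T => T (spatialVec l)) (fderiv_fun_sub hψY hξY)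
    rw [hder l] at hfd
    rw [sub_eq_zero.mp hfd.symm]
    exact (fderiv_planeWave_spatial q P X₀ w X₀ l).trans
      (congrArg (q l • ·) (planeWave_self q P X₀ w))

/-! ### Compatibility conditions from independent jets. -/

/-- All relations say that one linear map annihilates the vectors v κ. By their number these span
the space, so the map vanishes, and with it each of its blocks. -/
theorem eq_zero_of_sum_mulVec_eq_zero {ι S : Type*} [Fintype ι] [DecidableEq ι] [Fintype S]
    [DecidableEq S] {C : ι → Matrix S S ℂ} {v : ι × S → ι × S → ℂ} (hv : LinearIndependent ℂ v)
    (h : ∀ κ, ∑ j, (C j).mulVec (fun s => v κ (j, s)) = 0) (j : ι) : C j = 0 := by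
  set T : (ι × S → ℂ) →ₗ[ℂ] (S → ℂ) :=
    ∑ j, (C j).mulVecLin.comp (LinearMap.funLeft ℂ ℂ fun s => (j, s)) with hT
  have hTa : ∀ ξ, T ξ = ∑ j, (C j).mulVec fun s => ξ (j, s) := by
    intro ξ
    simp only [hT, LinearMap.sum_apply, LinearMap.comp_apply, Matrix.mulVecLin_apply]
    rfl
  have hspan := hv.span_eq_top_of_card_eq_finrank' (by simp)
  have hT0 : T = 0 := by
    refine LinearMap.ext_on_range hspan fun κ => ?_
    rw [hTa, h, LinearMap.zero_apply]
  ext r s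
  have h1 := congrFun (congrArg (fun L => L (Pi.single (j, s) 1)) hT0) r
  simp only [hTa, LinearMap.zero_apply, Pi.zero_apply, Finset.sum_apply] at h1
  rw [Finset.sum_eq_single j] at h1
  · have e : (fun s' => (Pi.single (j, s) 1 : ι × S → ℂ) (j, s')) = Pi.single s 1 := by
      funext s'
      simp [Pi.single_apply]
    rw [e, Matrix.mulVec_single_one] at h1
    exact h1
  · intro j' _ hj
    have e : (fun s' => (Pi.single (j, s) 1 : ι × S → ℂ) (j', s')) = 0 := by
      funext s'
      simp [Pi.single_apply, hj]
    rw [e, Matrix.mulVec_zero]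
    rfl
  · simp

/-- The value and the spatial derivatives of `ψ`. -/
def spatialJet (ψ : Config → Spinor) (X : Config) :
    Option (Fin 3 ⊕ Fin 3) × (Fin 4 × Fin 4) → ℂ :=
  fun κ => (κ.1.elim (ψ X) fun l => fderiv ℝ ψ X (spatialVec l)) κ.2

/-- The vectors are (e_s, 0) and (e_s, e_l ⊗ e_s). The system is triangular: the derivative
components determine the coefficients of the second kind, then the values those of the first. -/
theorem linearIndependent_of_jets {ι S : Type*} [Fintype ι] [DecidableEq ι] [Fintype S]
    [DecidableEq S] {v : Option ι × S → Option ι × S → ℂ}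
    (hnone : ∀ κ s, v κ (none, s) = if s = κ.2 then 1 else 0)
    (hsome : ∀ κ l s, v κ (some l, s) = if some l = κ.1 ∧ s = κ.2 then 1 else 0) :
    LinearIndependent ℂ v := by
  rw [Fintype.linearIndependent_iff]
  intro g hg
  have h1 : ∀ l s, g (some l, s) = 0 := by
    intro l s
    have h := congrFun hg (some l, s)
    simp only [Finset.sum_apply, Pi.smul_apply, hsome, smul_eq_mul, mul_ite, mul_one, mul_zero,
      Pi.zero_apply] at h
    rw [← h, Finset.sum_eq_single (some l, s)]
    · simp
    · rintro ⟨j, s'⟩ - hne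
      rw [if_neg]
      rintro ⟨rfl, rfl⟩
      exact hne rfl
    · simp
  have h2 : ∀ s, g (none, s) = 0 := by
    intro s
    have h := congrFun hg (none, s)
    simp only [Finset.sum_apply, Pi.smul_apply, hnone, smul_eq_mul, mul_ite, mul_one, mul_zero,
      Pi.zero_apply] at h
    rw [← h, Finset.sum_eq_single (none, s)]
    · simp
    · rintro ⟨_ | j, s'⟩ - hne
      · rw [if_neg]
        rintro rfl
        exact hne rfl
      · simp [h1]
    · simp
  rintro ⟨_ | j, s⟩
  · exact h2 s
  · exact h1 j s

theorem onParticle_commute (A B : Mat4) :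
    onParticle 0 A * onParticle 1 B = onParticle 1 B * onParticle 0 A := by
  simp [onParticle_zero, onParticle_one, ← Matrix.mul_kronecker_mul]

/-- The difference of the two space-time points. -/
def differenceL : Config →L[ℝ] SpaceTime :=
  ContinuousLinearMap.proj (R := ℝ) (φ := fun _ : Fin 2 => SpaceTime) 0 -
    ContinuousLinearMap.proj (R := ℝ) (φ := fun _ : Fin 2 => SpaceTime) 1

theorem differenceL_apply (X : Config) : differenceL X = X 0 - X 1 := rfl

/-- The compatibility conditions of the multi-time Dirac system hold near the apex of a light cone
on which the first potential is constant. -/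
theorem eventually_compatible {γ : Fin 4 → Mat4} (hγ : IsGammaRep γ) {m : Fin 2 → ℝ}
    {D : Set SpaceTime} (hD : IsOpen D) {V : Fin 2 → Config → SpinMatrix}
    (hsol : SolvableForAllData γ m (diffConfig D) V)
    {v : Fin 2 → SpaceTime → SpinMatrix} (hv : ∀ k, ContDiffOn ℝ 1 (v k) D)
    (hVv : ∀ k, ∀ X ∈ diffConfig D, V k X = v k (X 0 - X 1))
    {s t : ℝ} (hs : s * s = 1) (ht : 0 ≤ t)
    {x : SpaceTime} (hx : x 0 = s * t) (hKD : lightCone s t (spatialPart x) ⊆ D) {c : SpinMatrix}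
    (hc : ∀ y ∈ lightCone s t (spatialPart x), v 0 y = c) :
    ∀ᶠ y in nhds x,
      (∀ i : Fin 3, Commute (v 0 y) (onParticle 1 (γ 0 * γ i.succ))) ∧
      (∀ i : Fin 3, Commute (v 1 y) (onParticle 0 (γ 0 * γ i.succ))) ∧
      Complex.I • (fderiv ℝ (v 1) y (unitVec 0) +
          ∑ i : Fin 3, onParticle 0 (γ 0 * γ i.succ) * fderiv ℝ (v 1) y (unitVec i.succ) +
          (fderiv ℝ (v 0) y (unitVec 0) +
            ∑ i : Fin 3, onParticle 1 (γ 0 * γ i.succ) * fderiv ℝ (v 0) y (unitVec i.succ))) =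
        massPotential γ m 0 (v 0 y) * massPotential γ m 1 (v 1 y) -
          massPotential γ m 1 (v 1 y) * massPotential γ m 0 (v 0 y) := by
  have hsx : s * x 0 = t := by rw [hx, ← mul_assoc, hs, one_mul]
  have hxD : x ∈ D := hKD ⟨by rw [hsx]; exact ht, hsx.le, by simp [spatialPart_apply, hsx]⟩
  have hΩ := isOpen_diffConfig hD
  have hsingle : ∀ y : SpaceTime, (Pi.single 0 y : Config) 0 - (Pi.single 0 y : Config) 1 = y := by
    intro y
    simp
  have hmem : ∀ y ∈ D, (Pi.single 0 y : Config) ∈ diffConfig D := fun y hy => by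
    change _ ∈ D
    rwa [hsingle]
  -- One solution is taken for each choice of exponent, zero or one of the six unit vectors, and of
  -- a basis spinor.
  have hex := fun κ : Option (Fin 3 ⊕ Fin 3) × (Fin 4 × Fin 4) =>
    exists_solution_of_jet hγ hD hsol hs ht hx hKD
      (fun X hX => (hVv 0 X (hKD hX)).trans (hc _ hX))
      (κ.1.elim 0 fun l => Pi.single l 1) (Pi.single κ.2 1)
  choose ψ hψd hψs hψ0 hψ1 using hex
  have hLI : LinearIndependent ℂ fun κ => spatialJet (ψ κ) (Pi.single 0 x) := by
    refine linearIndependent_of_jets (fun κ s => ?_) fun κ l s => ?_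
    · simp only [spatialJet, Option.elim_none, hψ0]
      rw [Pi.single_apply]
    · simp only [spatialJet, Option.elim_some, hψ1]
      rcases κ with ⟨_ | l', s'⟩
      · simp
      · by_cases h1 : l = l' <;> by_cases h2 : s = s' <;> simp [Pi.single_apply, h1, h2]
  -- The jets are continuous since the solutions are C². Their independence at the apex hence
  -- persists in a neighbourhood, beyond the cone where V₁ is known.
  have hcont : ContinuousAt (fun y => fun κ => spatialJet (ψ κ) (Pi.single 0 y)) x := by
    have hsc : ContinuousAt (fun y : SpaceTime => (Pi.single 0 y : Config)) x :=
      (ContinuousLinearMap.single ℝ (fun _ : Fin 2 => SpaceTime) 0).continuous.continuousAt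
    refine continuousAt_pi.mpr fun κ => continuousAt_pi.mpr fun κ' => ?_
    have hd := (hψd κ).contDiffAt (hΩ.mem_nhds (hmem x hxD))
    rcases κ' with ⟨_ | l, s'⟩
    · have h1 : ContinuousAt (ψ κ) (Pi.single 0 x) := hd.continuousAt
      exact (continuous_apply s').continuousAt.comp (h1.comp_of_eq hsc rfl)
    · have h1 : ContinuousAt (fderiv ℝ (ψ κ)) (Pi.single 0 x) :=
        (hd.fderiv_right (m := 1) (by norm_num)).continuousAt
      have h2 : ContinuousAt (fun X => fderiv ℝ (ψ κ) X (spatialVec l)) (Pi.single 0 x) :=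
        h1.clm_apply continuousAt_const
      exact (continuous_apply s').continuousAt.comp (h2.comp_of_eq hsc rfl)
  filter_upwards [hcont.eventually hLI.eventually, hD.mem_nhds hxD] with y hyLI hyD
  set Y : Config := Pi.single 0 y with hY
  have hYΩ : Y ∈ diffConfig D := hmem y hyD
  have hYnhds := hΩ.mem_nhds hYΩ
  have hVY : ∀ k, V k Y = v k y := fun k => by rw [hVv k Y hYΩ, hY, hsingle]
  set B : Fin 2 → Config → SpinMatrix := fun k X => massPotential γ m k (V k X) with hB
  have hBfd : ∀ k, HasFDerivAt (B k) ((fderiv ℝ (v k) y).comp differenceL) Y := by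
    intro k
    have h1 : HasFDerivAt (v k) (fderiv ℝ (v k) y) (differenceL Y) := by
      rw [differenceL_apply, hY, hsingle]
      exact (((hv k).contDiffAt (hD.mem_nhds hyD)).differentiableAt one_ne_zero).hasFDerivAt
    have h2 := (HasFDerivAt.comp Y h1 (ContinuousLinearMap.hasFDerivAt _)).const_add
      ((m k : ℂ) • onParticle k (γ 0))
    refine HasFDerivAt.congr_of_eventuallyEq h2 ?_
    filter_upwards [hYnhds] with X hX
    rw [hB]
    simp only [massPotential]
    rw [hVv k X hX]
    rfl
  have hB0 : ∀ k d, fderiv ℝ (B k) Y (Pi.single 0 d) = fderiv ℝ (v k) y d := by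
    intro k d
    have h := congrArg (fun T => T (Pi.single 0 d)) (hBfd k).fderiv
    refine h.trans ?_
    simp [differenceL_apply]
  have hB1 : ∀ k d, fderiv ℝ (B k) Y (Pi.single 1 d) = -fderiv ℝ (v k) y d := by
    intro k d
    have h := congrArg (fun T => T (Pi.single 1 d)) (hBfd k).fderiv
    refine h.trans ?_
    simp [differenceL_apply]
  have hcomm := fun κ => commutator_evolution (ψ := ψ κ) (X := Y)
    (e₀ := Pi.single 0 (unitVec 0)) (f₀ := Pi.single 1 (unitVec 0))
    (e := fun i => Pi.single 0 (unitVec i.succ)) (f := fun i => Pi.single 1 (unitVec i.succ))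
    (α := fun i => onParticle 0 (γ 0 * γ i.succ)) (α' := fun i => onParticle 1 (γ 0 * γ i.succ))
    (B := B 0) (B' := B 1)
    ((hψd κ).contDiffAt hYnhds) (hBfd 0).differentiableAt (hBfd 1).differentiableAt
    (fun i j => onParticle_commute _ _)
    (by filter_upwards [hYnhds] with Z hZ
        exact (satisfiesDiracAt_iff γ m 0 (V 0) (ψ κ) Z).mp (hψs κ 0 Z hZ))
    (by filter_upwards [hYnhds] with Z hZ
        exact (satisfiesDiracAt_iff γ m 1 (V 1) (ψ κ) Z).mp (hψs κ 1 Z hZ))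
  simp only [hB0, hB1] at hcomm
  have hBY : ∀ k, B k Y = massPotential γ m k (v k y) := fun k => by rw [hB]; simp only [hVY]
  simp only [hBY] at hcomm
  -- These are the coefficients of the commutator relation: `none` belongs to the value of ψ, the
  -- others to its spatial derivatives.
  set C : Option (Fin 3 ⊕ Fin 3) → SpinMatrix := fun j => j.elim
    (Complex.I • (fderiv ℝ (v 1) y (unitVec 0) +
          ∑ i : Fin 3, onParticle 0 (γ 0 * γ i.succ) * fderiv ℝ (v 1) y (unitVec i.succ) -
          (-fderiv ℝ (v 0) y (unitVec 0) +
            ∑ i : Fin 3, onParticle 1 (γ 0 * γ i.succ) * -fderiv ℝ (v 0) y (unitVec i.succ))) -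
        (massPotential γ m 0 (v 0 y) * massPotential γ m 1 (v 1 y) -
          massPotential γ m 1 (v 1 y) * massPotential γ m 0 (v 0 y)))
    (Sum.elim
      (fun i => Complex.I • (onParticle 0 (γ 0 * γ i.succ) * massPotential γ m 1 (v 1 y) -
        massPotential γ m 1 (v 1 y) * onParticle 0 (γ 0 * γ i.succ)))
      (fun i => Complex.I • (massPotential γ m 0 (v 0 y) * onParticle 1 (γ 0 * γ i.succ) -
        onParticle 1 (γ 0 * γ i.succ) * massPotential γ m 0 (v 0 y)))) with hC
  have hC0 := eq_zero_of_sum_mulVec_eq_zero (C := C) hyLI fun κ => by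
    rw [Fintype.sum_option, Fintype.sum_sum_type, ← hcomm κ]
    simp only [hC, Option.elim_none, Option.elim_some, Sum.elim_inl, Sum.elim_inr, spatialJet,
      Matrix.smul_mulVec, Finset.smul_sum]
    rw [add_comm]
    rfl
  -- The mass term of one particle commutes with every matrix acting on the other.
  have hβ : ∀ A, onParticle 0 A * massPotential γ m 1 (v 1 y) -
      massPotential γ m 1 (v 1 y) * onParticle 0 A =
        onParticle 0 A * v 1 y - v 1 y * onParticle 0 A := by
    intro A
    simp only [massPotential, mul_add, add_mul, mul_smul_comm, smul_mul_assoc, onParticle_commute]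
    abel
  have hβ' : ∀ A, massPotential γ m 0 (v 0 y) * onParticle 1 A -
      onParticle 1 A * massPotential γ m 0 (v 0 y) =
        v 0 y * onParticle 1 A - onParticle 1 A * v 0 y := by
    intro A
    simp only [massPotential, mul_add, add_mul, mul_smul_comm, smul_mul_assoc, onParticle_commute]
    abel
  refine ⟨fun i => ?_, fun i => ?_, ?_⟩
  · have h := hC0 (some (Sum.inr i))
    simp only [hC, Option.elim_some, Sum.elim_inr, hβ', smul_eq_zero, Complex.I_ne_zero,
      false_or] at h
    exact sub_eq_zero.mp h
  · have h := hC0 (some (Sum.inl i))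
    simp only [hC, Option.elim_some, Sum.elim_inl, hβ, smul_eq_zero, Complex.I_ne_zero,
      false_or] at h
    exact (sub_eq_zero.mp h).symm
  · have h := hC0 none
    simp only [hC, Option.elim_none] at h
    rw [← sub_eq_zero.mp h]
    congr 1
    simp only [mul_neg, Finset.sum_neg_distrib]
    abel

/-! ### Propagation of constancy from time zero. -/

/-- The triangle inequality in squared form, from Cauchy–Schwarz. It is the reason that light cones
are nested. -/
theorem sum_add_sq_le {a b : Fin 3 → ℝ} {A B : ℝ} (hA : 0 ≤ A) (hB : 0 ≤ B)
    (ha : ∑ i, a i ^ 2 ≤ A ^ 2) (hb : ∑ i, b i ^ 2 ≤ B ^ 2) :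
    ∑ i, (a i + b i) ^ 2 ≤ (A + B) ^ 2 := by
  have h1 : (∑ i, a i * b i) ^ 2 ≤ (A * B) ^ 2 :=
    (Finset.sum_mul_sq_le_sq_mul_sq _ _ _).trans (by
      rw [mul_pow]
      exact mul_le_mul ha hb (Finset.sum_nonneg fun i _ => sq_nonneg _) (sq_nonneg _))
  have h2 : ∑ i, a i * b i ≤ A * B :=
    (le_abs_self _).trans (abs_le_of_sq_le_sq h1 (mul_nonneg hA hB))
  have h3 : ∑ i, (a i + b i) ^ 2 = ∑ i, a i ^ 2 + 2 * ∑ i, a i * b i + ∑ i, b i ^ 2 := by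
    rw [Finset.mul_sum, ← Finset.sum_add_distrib, ← Finset.sum_add_distrib]
    exact Finset.sum_congr rfl fun i _ => by ring
  nlinarith

theorem lightCone_subset {s t : ℝ} {c : Fin 3 → ℝ} {y : SpaceTime} (hy : y ∈ lightCone s t c) :
    lightCone s (s * y 0) (spatialPart y) ⊆ lightCone s t c := by
  rintro z ⟨h1, h2, h3⟩
  obtain ⟨g1, g2, g3⟩ := hy
  refine ⟨h1, h2.trans g2, ?_⟩
  have h := sum_add_sq_le (sub_nonneg.mpr h2) (sub_nonneg.mpr g2) h3 g3
  simpa [spatialPart_apply] using h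

theorem contDiffOn_of_entries {E : Type*} [NormedAddCommGroup E] [NormedSpace ℝ E]
    {f : E → SpinMatrix} {O : Set E} (h : ∀ i j, ContDiffOn ℝ 1 (fun x => f x i j) O) :
    ContDiffOn ℝ 1 f O := by
  have e : f = fun x => ∑ i, ∑ j, f x i j • Matrix.single i j (1 : ℂ) := by
    funext x
    conv_lhs => rw [Matrix.matrix_eq_sum_single (f x)]
    simp [Matrix.smul_single]
  rw [e]
  exact ContDiffOn.sum fun i _ => ContDiffOn.sum fun j _ => (h i j).smul contDiffOn_const

section Rigidity

variable {γ : Fin 4 → Mat4} (hγ : IsGammaRep γ) {m : Fin 2 → ℝ} {D : Set SpaceTime}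
  (hD : IsOpen D) {V : Fin 2 → Config → SpinMatrix}
  (hsol : SolvableForAllData γ m (diffConfig D) V)
  (hV : ∀ k i j, ContDiffOn ℝ 1 (fun X => V k X i j) (diffConfig D))
  (hP : ∀ k, IsPoincareInvariant γ (diffConfig D) (V k))

include hγ hP in
theorem eq_relative (k : Fin 2) {X : Config} (hX : X ∈ diffConfig D) :
    V k X = V k ![X 0 - X 1, 0] := by
  rw [(hP k).translation hγ (X 1) hX]
  congr 1
  funext j
  fin_cases j <;> simp

theorem mem_diffConfig {y : SpaceTime} (hy : y ∈ D) : ![y, 0] ∈ diffConfig D := by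
  change y - 0 ∈ D
  rwa [sub_zero]

include hV in
theorem contDiffOn_relative (k : Fin 2) : ContDiffOn ℝ 1 (fun y => V k ![y, 0]) D := by
  refine contDiffOn_of_entries fun i j => ?_
  have h : ContDiff ℝ 1 fun y : SpaceTime => (![y, 0] : Config) := by
    refine contDiff_pi.mpr fun k => ?_
    refine Fin.cases ?_ (fun k => ?_) k
    · exact contDiff_id
    · simpa using contDiff_const
  exact (hV k i j).comp h.contDiffOn fun y hy => mem_diffConfig hy

include hγ hD hsol hV hP in
/-- The potentials have vanishing derivatives near the apex of a light cone on which the first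
potential is constant. -/
theorem eventually_fderiv_eq_zero {s t : ℝ} (hs : s * s = 1) (ht : 0 ≤ t)
    {x : SpaceTime} (hx : x 0 = s * t) (hKD : lightCone s t (spatialPart x) ⊆ D) {c : SpinMatrix}
    (hc : ∀ y ∈ lightCone s t (spatialPart x), V 0 ![y, 0] = c) :
    ∀ᶠ y in nhds x, ∀ k, fderiv ℝ (fun y => V k ![y, 0]) y = 0 := by
  have hsx : s * x 0 = t := by rw [hx, ← mul_assoc, hs, one_mul]
  have hxD : x ∈ D := hKD ⟨by rw [hsx]; exact ht, hsx.le, by simp [spatialPart_apply, hsx]⟩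
  have hv := fun k => contDiffOn_relative hV k
  have hcomp := eventually_compatible hγ hD hsol (v := fun k y => V k ![y, 0]) hv
    (fun k X hX => eq_relative hγ hP k hX) hs ht hx hKD hc
  obtain ⟨O, hO, hOo, hxO⟩ := eventually_nhds_iff.mp (hcomp.and (hD.mem_nhds hxD))
  have hcov := fun k => (hP k).isLorentzCovariantOn hγ hOo
    (fun y hy => mem_diffConfig (hO y hy).2)
    (((hv k).differentiableOn one_ne_zero).mono fun y hy => (hO y hy).2)
  have key := fun y (hy : y ∈ O) => hγ.isDiracFrame.fderiv_eq_zero_of_compatible hOo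
    (v := fun y => V 0 ![y, 0]) (w := fun y => V 1 ![y, 0]) (m₁ := m 0) (m₂ := m 1)
    ((hv 0).mono fun y hy => (hO y hy).2) ((hv 1).mono fun y hy => (hO y hy).2)
    (fun y hy i => by
      have := (hO y hy).1.1 i
      rwa [onParticle_one] at this)
    (fun y hy i => by
      have := (hO y hy).1.2.1 i
      rwa [onParticle_zero] at this)
    (hcov 0) (hcov 1)
    (fun y hy => by
      have := (hO y hy).1.2.2
      simpa only [onParticle_zero, onParticle_one, massPotential] using this) hy
  filter_upwards [hOo.mem_nhds hxO] with y hy k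
  fin_cases k
  · exact (key y hy).1
  · exact (key y hy).2

include hV in
theorem eventually_eq_of_fderiv (hD : IsOpen D) {x : SpaceTime} (hx : x ∈ D)
    (h : ∀ᶠ y in nhds x, ∀ k, fderiv ℝ (fun y => V k ![y, 0]) y = 0) :
    ∀ᶠ y in nhds x, ∀ k, V k ![y, 0] = V k ![x, 0] := by
  obtain ⟨ε, hε, hball⟩ := Metric.eventually_nhds_iff_ball.mp (h.and (hD.mem_nhds hx))
  filter_upwards [Metric.ball_mem_nhds x hε] with y hy k
  refine Metric.isOpen_ball.is_const_of_fderiv_eq_zero (𝕜 := ℝ)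
    (convex_ball x ε).isPreconnected (f := fun y => V k ![y, 0])
    (((contDiffOn_relative hV k).differentiableOn one_ne_zero).mono fun z hz => (hball z hz).2)
    (fun z hz => (hball z hz).1 k) hy (Metric.mem_ball_self hε)

include hγ hD hsol hV hP in
-- At time zero the cone consists of its apex, on which V₁ is trivially constant. This starts the
-- propagation.
theorem fderiv_eq_zero_at_time_zero {x : SpaceTime} (hxD : x ∈ D) (hx : x 0 = 0) :
    ∀ᶠ y in nhds x, ∀ k, fderiv ℝ (fun y => V k ![y, 0]) y = 0 := by
  have hcone : ∀ y ∈ lightCone 1 0 (spatialPart x), y = x := by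
    rintro y ⟨h1, h2, h3⟩
    have hy0 : y 0 = 0 := by linarith
    have h4 : ∀ i : Fin 3, (y i.succ - x i.succ) ^ 2 ≤ 0 := fun i =>
      (Finset.single_le_sum (f := fun i : Fin 3 => (y i.succ - spatialPart x i) ^ 2)
        (fun i _ => sq_nonneg _) (Finset.mem_univ i)).trans (h3.trans (by simp [hy0]))
    funext j
    refine Fin.cases ?_ (fun i => ?_) j
    · rw [hy0, hx]
    · nlinarith [h4 i]
  refine eventually_fderiv_eq_zero hγ hD hsol hV hP (s := 1) (t := 0) (by norm_num) le_rfl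
    (by rw [hx, mul_zero]) (fun y hy => (hcone y hy) ▸ hxD) (c := V 0 ![x, 0])
    fun y hy => by rw [hcone y hy]

include hγ hD hsol hV hP in
theorem eq_at_time_zero (hconn : IsPreconnected (spatialEmb ⁻¹' D)) {x y : SpaceTime}
    (hxD : x ∈ D) (hx : x 0 = 0) (hyD : y ∈ D) (hy : y 0 = 0) (k : Fin 2) :
    V k ![x, 0] = V k ![y, 0] := by
  have hd : ∀ z ∈ spatialEmb ⁻¹' D, HasFDerivAt (fun z => V k ![spatialEmb z, 0])
      (0 : (Fin 3 → ℝ) →L[ℝ] SpinMatrix) z := by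
    intro z hz
    have h0 := (fderiv_eq_zero_at_time_zero hγ hD hsol hV hP hz (spatialEmb_zero z)).self_of_nhds k
    have h1 := (((contDiffOn_relative hV k).contDiffAt (hD.mem_nhds hz)).differentiableAt
      one_ne_zero).hasFDerivAt.congr_fderiv h0
    exact (HasFDerivAt.comp z h1 spatialEmb.hasFDerivAt).congr_fderiv
      (ContinuousLinearMap.zero_comp _)
  have h := (hD.preimage spatialEmb.continuous).is_const_of_fderiv_eq_zero (𝕜 := ℝ) hconn
    (f := fun z => V k ![spatialEmb z, 0])
    (fun z hz => (hd z hz).differentiableAt.differentiableWithinAt)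
    (fun z hz => (hd z hz).fderiv) (x := spatialPart x) (y := spatialPart y)
    (by rwa [Set.mem_preimage, spatialEmb_spatialPart hx])
    (by rwa [Set.mem_preimage, spatialEmb_spatialPart hy])
  simpa only [spatialEmb_spatialPart hx, spatialEmb_spatialPart hy] using h

include hγ hD hsol hV hP in
/-- Poincaré invariant potentials of a solvable multi-time Dirac system are constant. -/
theorem eq_const_of_solvable (hconn : IsPreconnected (spatialEmb ⁻¹' D))
    (hcone : ∀ x ∈ D, ∀ s t : ℝ, s * s = 1 → x 0 = s * t → lightCone s t (spatialPart x) ⊆ D)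
    {e : SpaceTime} (heD : e ∈ D) (he : e 0 = 0) {x : SpaceTime} (hxD : x ∈ D) (k : Fin 2) :
    V k ![x, 0] = V k ![e, 0] := by
  obtain ⟨s, t, hs, ht, hx⟩ : ∃ s t : ℝ, s * s = 1 ∧ 0 ≤ t ∧ x 0 = s * t := by
    rcases le_total 0 (x 0) with h | h
    · exact ⟨1, x 0, by norm_num, h, by ring⟩
    · exact ⟨-1, -x 0, by norm_num, by linarith, by ring⟩
  have hsx : s * x 0 = t := by rw [hx, ← mul_assoc, hs, one_mul]
  set K := lightCone s t (spatialPart x) with hK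
  have hxK : x ∈ K := ⟨by rw [hsx]; exact ht, hsx.le, by simp [spatialPart_apply, hsx]⟩
  have hKD : K ⊆ D := hcone x hxD s t hs hx
  set bad : Set SpaceTime := {y ∈ K | ∃ k, V k ![y, 0] ≠ V k ![e, 0]} with hbad
  have hgood : ∀ y ∈ K, y ∉ bad → ∀ k, V k ![y, 0] = V k ![e, 0] := fun y hy h k =>
    by_contra fun hne => h ⟨hy, k, hne⟩
  suffices h : bad = ∅ from hgood x hxK (by rw [h]; exact Set.notMem_empty x) k
  by_contra hne
  have hKc : IsCompact K := isCompact_lightCone hs t _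
  have hsub : closure bad ⊆ K := closure_minimal (fun y hy => hy.1) hKc.isClosed
  -- On K the function s y₀ equals |y₀|. At points of K closer in time to the initial surface than
  -- y, the potentials already have the values at e.
  obtain ⟨y, hy, hmin⟩ := (hKc.of_isClosed_subset isClosed_closure hsub).exists_isMinOn
    (Set.nonempty_iff_ne_empty.mpr hne).closure
    (f := fun y : SpaceTime => s * y 0) (by fun_prop)
  have hyK := hsub hy
  have hyD := hKD hyK
  have hcK := lightCone_subset hyK
  have hlt : ∀ z ∈ K, s * z 0 < s * y 0 → ∀ k, V k ![z, 0] = V k ![e, 0] := fun z hz h =>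
    hgood z hz fun hb => (not_lt.mpr (hmin (subset_closure hb))) h
  -- At y itself this follows from the case of time zero, or by continuity along the time axis below
  -- y.
  have hyeq : ∀ k, V k ![y, 0] = V k ![e, 0] := by
    intro k
    rcases hyK.1.eq_or_lt with h | h
    · have hy0 : y 0 = 0 := by
        have : s * (s * y 0) = y 0 := by rw [← mul_assoc, hs, one_mul]
        rw [← this, ← h, mul_zero]
      exact eq_at_time_zero hγ hD hsol hV hP hconn hyD hy0 heD he k
    · have hc : ContinuousAt (fun z => V k ![z, 0]) y :=
        ((contDiffOn_relative hV k).contDiffAt (hD.mem_nhds hyD)).continuousAt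
      have hray : Filter.Tendsto (fun δ : ℝ => y - (s * δ) • unitVec 0)
          (nhdsWithin 0 (Set.Ioi 0)) (nhds y) := by
        have : Continuous fun δ : ℝ => y - (s * δ) • unitVec 0 := by fun_prop
        simpa using (this.tendsto 0).mono_left nhdsWithin_le_nhds
      refine (tendsto_nhds_unique (hc.tendsto.comp hray) (tendsto_const_nhds.congr' ?_))
      filter_upwards [Ioo_mem_nhdsGT h] with δ hδ
      have e0 : s * (y - (s * δ) • unitVec 0) 0 = s * y 0 - δ := by
        simp only [Pi.sub_apply, Pi.smul_apply, smul_eq_mul, Pi.single_eq_same, mul_one]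
        linear_combination (-δ) * hs
      refine (hlt _ (hcK ⟨by rw [e0]; linarith [hδ.2], by rw [e0]; linarith [hδ.1], ?_⟩)
        (by rw [e0]; linarith [hδ.1]) k).symm
      rw [e0]
      simp [spatialPart_apply, Fin.succ_ne_zero]
      positivity
  have hconst : ∀ z ∈ lightCone s (s * y 0) (spatialPart y), V 0 ![z, 0] = V 0 ![e, 0] := by
    intro z hz
    rcases hz.2.1.eq_or_lt with h | h
    · have hz0 : z = y := by
        have h0 : z 0 = y 0 := by
          have := congrArg (s * ·) h
          simpa only [← mul_assoc, hs, one_mul] using this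
        have h4 : ∀ i : Fin 3, (z i.succ - y i.succ) ^ 2 ≤ 0 := fun i =>
          (Finset.single_le_sum (f := fun i : Fin 3 => (z i.succ - spatialPart y i) ^ 2)
            (fun i _ => sq_nonneg _) (Finset.mem_univ i)).trans (hz.2.2.trans (by simp [h]))
        funext j
        refine Fin.cases h0 (fun i => ?_) j
        nlinarith [h4 i]
      rw [hz0, hyeq]
    · exact hlt z (hcK hz) h 0
  have hy0 : y 0 = s * (s * y 0) := by rw [← mul_assoc, hs, one_mul]
  -- V₁ is constant on the cone of y, so both potentials are constant near y, although y is a limit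
  -- of bad points.
  have hnear := eventually_eq_of_fderiv hV hD hyD (eventually_fderiv_eq_zero hγ hD hsol hV hP hs
    hyK.1 hy0 (hcK.trans hKD) hconst)
  obtain ⟨z, hz, hzb⟩ := mem_closure_iff_nhds.mp hy _ hnear
  obtain ⟨-, k, hk⟩ := hzb
  exact hk ((hz k).trans (hyeq k))

end Rigidity

/-! ### Space-like configurations and the conclusion. -/

theorem isNonInteracting_of_const {γ : Fin 4 → Mat4} {m : Fin 2 → ℝ} {Ω : Set Config}
    {V : Fin 2 → Config → SpinMatrix} {c : Fin 2 → SpinMatrix}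
    (hc : ∀ k, ∀ X ∈ Ω, V k X = c k) : IsNonInteracting γ m Ω V := by
  refine ⟨fun _ => 1, fun k _ => c k, fun i j => contDiffOn_const, fun X _ => one_mem _,
    fun k X hX ψ _ h => ?_⟩
  unfold SatisfiesDiracAt at h ⊢
  rw [hc k X hX] at h
  simpa only [Matrix.one_mulVec] using h

/-- The space-like vectors. -/
def spaceLikeVec : Set SpaceTime := {y | y 0 ^ 2 < ∑ i : Fin 3, y i.succ ^ 2}

theorem isOpen_spaceLikeVec : IsOpen spaceLikeVec :=
  isOpen_lt (f := fun y : SpaceTime => y 0 ^ 2) (by fun_prop) (by fun_prop)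

theorem spaceLike_eq : spaceLike = diffConfig spaceLikeVec := by
  ext X
  constructor
  · exact fun h => h 0 1 (by decide)
  · intro h j k hjk
    have h : (X 0 0 - X 1 0) ^ 2 < ∑ a : Fin 3, (X 0 a.succ - X 1 a.succ) ^ 2 := h
    fin_cases j <;> fin_cases k
    · exact absurd rfl hjk
    · exact h
    · have e : ∀ a b : ℝ, (a - b) ^ 2 = (b - a) ^ 2 := fun a b => by ring
      change (X 1 0 - X 0 0) ^ 2 < ∑ a : Fin 3, (X 1 a.succ - X 0 a.succ) ^ 2
      simp only [e (X 1 _)]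
      exact h
    · exact absurd rfl hjk

/-- If y were not space-like, the triangle inequality would bound the spatial length of x by s y₀ +
(t - s y₀) = t, contradicting that x is space-like. -/
theorem lightCone_subset_spaceLikeVec {x : SpaceTime} (hx : x ∈ spaceLikeVec) {s t : ℝ}
    (hs : s * s = 1) (hxt : x 0 = s * t) :
    lightCone s t (spatialPart x) ⊆ spaceLikeVec := by
  rintro y ⟨h1, h2, h3⟩
  by_contra hy
  have hy : ∑ i : Fin 3, y i.succ ^ 2 ≤ y 0 ^ 2 := not_lt.mp hy
  have e : (s * y 0) ^ 2 = y 0 ^ 2 := by rw [mul_pow, sq s, hs, one_mul]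
  have h3' : ∑ i : Fin 3, (x i.succ - y i.succ) ^ 2 ≤ (t - s * y 0) ^ 2 := by
    refine le_trans (le_of_eq (Finset.sum_congr rfl fun i _ => ?_)) h3
    rw [spatialPart_apply]
    ring
  have h := sum_add_sq_le h1 (sub_nonneg.mpr h2) (hy.trans_eq e.symm) h3'
  have hx : x 0 ^ 2 < ∑ i : Fin 3, x i.succ ^ 2 := hx
  simp only [add_sub_cancel] at h
  rw [hxt, mul_pow, sq s, hs, one_mul] at hx
  linarith

/-- The slice is ℝ³ without the origin, which is connected because the dimension exceeds 1. -/
theorem isPreconnected_spaceLikeVec : IsPreconnected (spatialEmb ⁻¹' spaceLikeVec) := by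
  have e : spatialEmb ⁻¹' spaceLikeVec = {0}ᶜ := by
    ext z
    have h : z ∈ spatialEmb ⁻¹' spaceLikeVec ↔ 0 < ∑ i : Fin 3, z i ^ 2 := by
      change spatialEmb z 0 ^ 2 < ∑ i : Fin 3, spatialEmb z i.succ ^ 2 ↔ _
      simp [spatialEmb_zero, spatialEmb_succ]
    rw [h, Set.mem_compl_iff, Set.mem_singleton_iff]
    constructor
    · rintro h rfl
      simp at h
    · intro h
      obtain ⟨i, hi⟩ := Function.ne_iff.mp h
      exact Finset.sum_pos' (fun i _ => sq_nonneg _) ⟨i, Finset.mem_univ i, by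
        have : z i ≠ 0 := hi
        positivity⟩
  rw [e]
  refine (isConnected_compl_singleton_of_one_lt_rank ?_ 0).isPreconnected
  rw [rank_fin_fun]
  norm_num

theorem not_forall_isPoincareInvariant {γ : Fin 4 → Mat4} (hγ : IsGammaRep γ) {m : Fin 2 → ℝ}
    {D : Set SpaceTime} (hD : IsOpen D) (hconn : IsPreconnected (spatialEmb ⁻¹' D))
    (hcone : ∀ x ∈ D, ∀ s t : ℝ, s * s = 1 → x 0 = s * t → lightCone s t (spatialPart x) ⊆ D)
    {e : SpaceTime} (heD : e ∈ D) (he : e 0 = 0) {V : Fin 2 → Config → SpinMatrix}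
    (hV : ∀ k i j, ContDiffOn ℝ 1 (fun X => V k X i j) (diffConfig D))
    (hint : IsInteracting γ m (diffConfig D) V)
    (hsol : SolvableForAllData γ m (diffConfig D) V) :
    ¬ ∀ k, IsPoincareInvariant γ (diffConfig D) (V k) := fun hP =>
  hint (isNonInteracting_of_const (c := fun k => V k ![e, 0]) fun k _ hX =>
    (eq_relative hγ hP k hX).trans
      (eq_const_of_solvable hγ hD hsol hV hP hconn hcone heD he hX k))

end

theorem theorem1 (γ : Fin 4 → Mat4) (hγ : IsGammaRep γ) (m : Fin 2 → ℝ)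
    (Ω : Set Config) (hΩ : Ω = Set.univ ∨ Ω = spaceLike)
    (V : Fin 2 → Config → SpinMatrix)
    (hV : ∀ k i j, ContDiffOn ℝ 1 (fun X => V k X i j) Ω)
    (hint : IsInteracting γ m Ω V)
    (hsol : SolvableForAllData γ m Ω V) :
    ¬ ∀ k, IsPoincareInvariant γ Ω (V k) := by
  rcases hΩ with rfl | rfl
  · have e : (Set.univ : Set Config) = diffConfig Set.univ := rfl
    rw [e] at hV hint hsol ⊢
    exact not_forall_isPoincareInvariant hγ isOpen_univ isPreconnected_univ
      (fun _ _ _ _ _ _ => Set.subset_univ _) (Set.mem_univ 0) rfl hV hint hsol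
  · rw [spaceLike_eq] at hV hint hsol ⊢
    -- The reference point is a spatial unit vector, as 0 is not space-like.
    refine not_forall_isPoincareInvariant hγ isOpen_spaceLikeVec isPreconnected_spaceLikeVec
      (fun x hx s t hs hxt => lightCone_subset_spaceLikeVec hx hs hxt) (e := unitVec 1) ?_ rfl
      hV hint hsol
    change (unitVec 1 0) ^ 2 < ∑ i : Fin 3, (unitVec 1 i.succ) ^ 2
    simp [Fin.sum_univ_three]
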